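/- Conventions. A countable word over a set $S$ is a map $w:\alpha\to S$ whose domain $\alpha$ is a finite or countably infinite linear ordering, considered up to label-preserving order isomorphism. Write $S^{\circledast}$ for the set of all countable words over $S$, $S^{\oplus}$ for the set of those with nonempty domain, and $\varepsilon$ for the empty word. The concatenation $\prod_{i\in\alpha}u_i$ of words $u_i$ indexed by a linear ordering $\alpha$ has as domain the ordered (lexicographic) sum of the domains. $a^{\omega}$ and $a^{\omega^*}$ are the words with all letters equal to $a$ and with domain $(\mathbb N,<)$ and $(\mathbb N,>)$, respectively. For a nonempty finite set $P$, $P^{\eta}$ is the word, unique up to isomorphism, with domain of order type $(\mathbb Q,<)$, with all letters in $P$, and such that between any two distinct positions every letter of $P$ occurs. A (generalized) product on $S^{\oplus}$ is a map $\pi:S^{\oplus}\to S$ such that $\pi(a)=a$ for every $a\in S$ (viewed as a one-letter word) and $\pi\big(\prod_{i\in\alpha}\pi(u_i)\big)=\pi\big(\prod_{i\in\alpha}u_i\big)$ for every nonempty countable linear ordering $\alpha$ and all $u_i\in S^{\oplus}$ $(i\in\alpha)$; then $(S,\pi)$ is called a $\oplus$-semigroup. A product on $S^{\circledast}$ is defined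 in the same way, with $S^{\circledast}$ in place of $S^{\oplus}$ and with $\alpha$ allowed to be empty; then $(S,\pi)$ is called a $\circledast$-monoid. A $\oplus$-algebra is a structure $(S,\cdot,\tau,\tau^*,\kappa)$ with $\cdot:S^2\to S$, $\tau,\tau^*:S\to S$, $\kappa:\mathcal P(S)\setminus\{\emptyset\}\to S$ such that 1. $a\cdot(b\cdot c)=(a\cdot b)\cdot c$ for all $a,b,c\in S$; 2. $(a\cdot b)^{\tau}=a\cdot(b\cdot a)^{\tau}$ and $(a^n)^{\tau}=a^{\tau}$ for all $a,b\in S$, $n>0$; 3. $(b\cdot a)^{\tau^*}=(a\cdot b)^{\tau^*}\cdot a$ and $(a^n)^{\tau^*}=a^{\tau^*}$ for all $a,b\in S$, $n>0$; 4. for every nonempty $P\subseteq S$, every $c\in P$, every $P'\subseteq P$, and every nonempty $P''\subseteq\{P^{\kappa},\,a\cdot P^{\kappa},\,P^{\kappa}\cdot b,\,a\cdot P^{\kappa}\cdot b\mid a,b\in P\}$, $$P^{\kappa}=P^{\kappa}\cdot P^{\kappa}=P^{\kappa}\cdot c\cdot P^{\kappa}=(P^{\kappa})^{\tau}=(P^{\kappa}\cdot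 c)^{\tau}=(P^{\kappa})^{\tau^*}=(c\cdot P^{\kappa})^{\tau^*}=(P'\cup P'')^{\kappa}.$$ A $\circledast$-algebra $(M,1,\cdot,\tau,\tau^*,\kappa)$ is a $\oplus$-algebra $(M,\cdot,\tau,\tau^*,\kappa)$ with an element $1\in M$ such that $x\cdot1=1\cdot x=x$, $1^{\tau}=1^{\tau^*}=\{1\}^{\kappa}=1$ and $P^{\kappa}=(P\cup\{1\})^{\kappa}$ for all $x\in M$ and all nonempty $P\subseteq M$. A finite $\oplus$-algebra is induced by a product $\pi$ on $S^{\oplus}$ if $a\cdot b=\pi(ab)$, $a^{\tau}=\pi(a^{\omega})$, $a^{\tau^*}=\pi(a^{\omega^*})$ and $P^{\kappa}=\pi(P^{\eta})$ for all $a,b\in S$ and all nonempty $P\subseteq S$. A finite $\circledast$-algebra is induced by a product $\pi$ on $M^{\circledast}$ if the same identities hold and moreover $1=\pi(\varepsilon)$. Theorem. (i) Every finite $\oplus$-algebra $(S,\cdot,\tau,\tau^*,\kappa)$ is induced by a unique product $\pi:S^{\oplus}\to S$. (ii) Every finite $\circledast$-algebra $(M,1,\cdot,\tau,\tau^*,\kappa)$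 is induced by a unique product $\pi:M^{\circledast}\to M$. -/

import Mathlib

universe u

/-- A labelled countable linear ordering: a word over `A`, before passing to isomorphism classes.
Every countable linear ordering is isomorphic to one whose carrier lives in `Type`. -/
structure LWord (A : Type u) where
  dom : Type
  [linearOrder : LinearOrder dom]
  [countable : Countable dom]
  label : dom → A

attribute [instance] LWord.linearOrder LWord.countable

namespace LWord

/-- Isomorphism of words: an order isomorphism of the domains that preserves labels. -/
def Iso {A : Type u} (v w : LWord A) : Prop :=
  ∃ e : v.dom ≃o w.dom, ∀ x, w.label (e x) = v.label x

theorem iso_equivalence (A : Type u) : Equivalence (Iso (A := A)) where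
  refl w := ⟨OrderIso.refl _, fun _ => rfl⟩
  symm := by
    rintro v w ⟨e, he⟩
    refine ⟨e.symm, fun x => ?_⟩
    rw [← he (e.symm x), OrderIso.apply_symm_apply]
  trans := by
    rintro v w z ⟨e, he⟩ ⟨f, hf⟩
    refine ⟨e.trans f, fun x => ?_⟩
    rw [OrderIso.trans_apply, hf, he]

instance setoid (A : Type u) : Setoid (LWord A) := ⟨Iso, iso_equivalence A⟩

/-- The empty word. -/
def empty (A : Type u) : LWord A where
  dom := Empty
  label := Empty.elim

/-- The one-letter word `a`. -/
def letter {A : Type u} (a : A) : LWord A where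
  dom := Unit
  label := fun _ => a

/-- The two-letter word `a b`. -/
def pair {A : Type u} (a b : A) : LWord A where
  dom := Fin 2
  label := ![a, b]

/-- The word `a ^ ω`. -/
def omegaPow {A : Type u} (a : A) : LWord A where
  dom := ℕ
  label := fun _ => a

/-- The word `a ^ ω*`, indexed by the reverse of the natural numbers. -/
def omegaOpPow {A : Type u} (a : A) : LWord A where
  dom := ℕᵒᵈ
  label := fun _ => a

/-- `w` is an `η`-shuffle of the set of letters `P`: its domain has the order type of the
rationals, all its letters belong to `P`, and the positions of each letter of `P` are dense. -/
structure IsShuffle {A : Type u} (P : Set A) (w : LWord A) : Prop where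
  orderType : Nonempty (w.dom ≃o ℚ)
  label_mem : ∀ x, w.label x ∈ P
  dense : ∀ a ∈ P, ∀ x y : w.dom, x < y → ∃ z, w.label z = a ∧ x < z ∧ z < y

/-- The word with domain `α` and labels given by `f`. -/
def ofFun {A : Type u} (α : Type) [LinearOrder α] [Countable α] (f : α → A) : LWord A where
  dom := α
  label := f

/-- The concatenation `∏_{i ∈ α} u i`; its domain is the lexicographic sum of the domains. -/
noncomputable def concat {A : Type u} (α : Type) [LinearOrder α] [Countable α]
    (u : α → LWord A) : LWord A where
  dom := Σₗ i : α, (u i).dom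
  linearOrder := inferInstance
  countable := inferInstanceAs (Countable (Σ i : α, (u i).dom))
  label := fun x => (u (ofLex x).1).label (ofLex x).2

end LWord

/-- `A^⊛`: all countable words over `A`, up to isomorphism. -/
def CWord (A : Type u) : Type (max u 1) := Quotient (LWord.setoid A)

/-- The isomorphism class of a word. -/
def CWord.mk {A : Type u} (w : LWord A) : CWord A := Quotient.mk _ w

/-- Nonempty labelled countable linear orderings. -/
abbrev NLWord (A : Type u) : Type (max u 1) := {w : LWord A // Nonempty w.dom}

/-- `A^⊕`: all nonempty countable words over `A`, up to isomorphism. -/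
def NWord (A : Type u) : Type (max u 1) :=
  Quotient ((LWord.setoid A).comap (Subtype.val : NLWord A → LWord A))

/-- The isomorphism class of a nonempty word. -/
def NWord.mk {A : Type u} (w : LWord A) (hw : Nonempty w.dom) : NWord A :=
  Quotient.mk _ (⟨w, hw⟩ : NLWord A)

/-- The inclusion of `A^⊕` in `A^⊛`. -/
def NWord.toCWord {A : Type u} : NWord A → CWord A :=
  Quotient.lift (fun w : NLWord A => CWord.mk w.1) (fun _ _ h => Quotient.sound h)

theorem LWord.concat_nonempty {A : Type u} (α : Type) [LinearOrder α] [Countable α]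
    [h : Nonempty α] (u : α → LWord A) (hu : ∀ i, Nonempty (u i).dom) :
    Nonempty (LWord.concat α u).dom :=
  h.elim fun i => (hu i).elim fun x => ⟨toLex ⟨i, x⟩⟩

/-- `π : S^⊕ → S` is a generalized product, i.e. `(S, π)` is a `⊕`-semigroup. -/
structure IsProduct {S : Type u} (π : NWord S → S) : Prop where
  letter : ∀ a : S, π (NWord.mk (LWord.letter a) ⟨()⟩) = a
  assoc : ∀ (α : Type) [LinearOrder α] [Countable α] [hα : Nonempty α]
    (u : α → LWord S) (hu : ∀ i, Nonempty (u i).dom),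
    π (NWord.mk (LWord.ofFun α fun i => π (NWord.mk (u i) (hu i))) hα) =
      π (NWord.mk (LWord.concat α u) (LWord.concat_nonempty α u hu))

/-- `π : S^⊛ → S` is a generalized product, i.e. `(S, π)` is a `⊛`-monoid. -/
structure IsStarProduct {S : Type u} (π : CWord S → S) : Prop where
  letter : ∀ a : S, π (CWord.mk (LWord.letter a)) = a
  assoc : ∀ (α : Type) [LinearOrder α] [Countable α] (u : α → LWord S),
    π (CWord.mk (LWord.ofFun α fun i => π (CWord.mk (u i)))) = π (CWord.mk (LWord.concat α u))

/-- `a ^ (n + 1)` for a binary operation `mul`. -/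
def powSucc {S : Type u} (mul : S → S → S) (a : S) : ℕ → S
  | 0 => a
  | n + 1 => mul (powSucc mul a n) a

/-- A `⊕`-algebra `(S, ·, τ, τ*, κ)`. -/
structure OplusAlgebra (S : Type u) where
  mul : S → S → S
  tau : S → S
  tauOp : S → S
  kappa : {P : Set S // P.Nonempty} → S
  mul_assoc : ∀ a b c, mul a (mul b c) = mul (mul a b) c
  tau_mul : ∀ a b, tau (mul a b) = mul a (tau (mul b a))
  tau_pow : ∀ a n, tau (powSucc mul a n) = tau a
  tauOp_mul : ∀ a b, tauOp (mul b a) = mul (tauOp (mul a b)) a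
  tauOp_pow : ∀ a n, tauOp (powSucc mul a n) = tauOp a
  kappa_mul_kappa : ∀ P, kappa P = mul (kappa P) (kappa P)
  kappa_mul_mul_kappa : ∀ P, ∀ c ∈ P.1, kappa P = mul (mul (kappa P) c) (kappa P)
  tau_kappa : ∀ P, kappa P = tau (kappa P)
  tau_kappa_mul : ∀ P, ∀ c ∈ P.1, kappa P = tau (mul (kappa P) c)
  tauOp_kappa : ∀ P, kappa P = tauOp (kappa P)
  tauOp_mul_kappa : ∀ P, ∀ c ∈ P.1, kappa P = tauOp (mul c (kappa P))
  kappa_union : ∀ P, ∀ P' ⊆ P.1, ∀ (P'' : Set S) (h : P''.Nonempty),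
    P'' ⊆ {x | x = kappa P ∨ (∃ a ∈ P.1, x = mul a (kappa P)) ∨
      (∃ b ∈ P.1, x = mul (kappa P) b) ∨
      (∃ a ∈ P.1, ∃ b ∈ P.1, x = mul (mul a (kappa P)) b)} →
    kappa P = kappa ⟨P' ∪ P'', h.inr⟩

/-- A `⊛`-algebra `(M, 1, ·, τ, τ*, κ)`. -/
structure OstarAlgebra (M : Type u) extends OplusAlgebra M where
  one : M
  mul_one : ∀ x, mul x one = x
  one_mul : ∀ x, mul one x = x
  tau_one : tau one = one
  tauOp_one : tauOp one = one
  kappa_one : kappa ⟨{one}, Set.singleton_nonempty one⟩ = one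
  kappa_union_one : ∀ P, kappa P = kappa ⟨P.1 ∪ {one}, P.2.inl⟩

/-- The operations `·, τ, τ*, κ` are induced by `π`. The `η`-shuffle of a finite nonempty set of
letters exists and is unique up to isomorphism, so the last field says `P^κ = π (P^η)`. -/
structure OplusAlgebra.InducedBy {S : Type u} (A : OplusAlgebra S) (π : NWord S → S) : Prop where
  mul : ∀ a b, A.mul a b = π (NWord.mk (LWord.pair a b) ⟨(0 : Fin 2)⟩)
  tau : ∀ a, A.tau a = π (NWord.mk (LWord.omegaPow a) ⟨(0 : ℕ)⟩)
  tauOp : ∀ a, A.tauOp a = π (NWord.mk (LWord.omegaOpPow a) ⟨OrderDual.toDual (0 : ℕ)⟩)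
  kappa : ∀ (P : {P : Set S // P.Nonempty}) (w : LWord S) (hw : Nonempty w.dom),
    LWord.IsShuffle P.1 w → A.kappa P = π (NWord.mk w hw)

/-- The operations `1, ·, τ, τ*, κ` are induced by `π`. -/
structure OstarAlgebra.InducedBy {M : Type u} (A : OstarAlgebra M) (π : CWord M → M) : Prop where
  one : A.one = π (CWord.mk (LWord.empty M))
  ops : A.toOplusAlgebra.InducedBy fun w => π w.toCWord

/-! Fix a countable word and consider its valuations (`IsVal`): maps from convex sets of positions
to `S` with an identity adjoined, the identity being the value of the empty set, that are right on
letters and compatible with `·`, `τ`, `τ*`, `κ`. Here compatibility concerns every cutting of a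
convex set into two pieces, into an `ω`- or `ω*`-sequence of pieces of equal value, or into a dense
shuffle of pieces. The core of the proof is that every nonempty countable word has exactly one
valuation (`good_univ`); the product of the word is the value of the whole.

Both halves of (i) then come from this uniqueness. The values of the blocks of a decomposition form
a new word, and a valuation of the old word induces one of the new word (`IsVal.comp`), so the two
evaluations agree: this is associativity. Conversely, a product inducing the operations gives a
valuation of each word (`isVal_productVal`), so it is the product constructed here.

Existence and uniqueness of valuations are proved by condensation (`CondensationClosed.prop_univ`).
Call two points equivalent if the interval between them is good. Goodness passes to concatenations,
to `ω`- and `ω*`-limits and to shuffles. Limits make each class good, concatenation makes the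
classes densely ordered, and a subinterval of the order of classes with the fewest colours would be
a good shuffle; hence there is only one class.

At each closure step the extended valuation is explicit, and the work is to check it against each
operation. For `ω`-limits, Ramsey's theorem supplies decompositions and `(st)^τ = s(ts)^τ` makes
their values agree. For a shuffle of blocks `U i`, a convex set meeting two blocks has value (first
block)·`P^κ`·(last block), and the absorption laws of `κ` apply. The hard case is a shuffle
regrouped as another shuffle, with set of values `R` (`respKappa_shuffleVal`). A second
condensation, over the index set of the latter, handles it: in its critical case each block `U i`
meets at most one class, and the set `V` of values of classes satisfies `P^κ = V^κ = R^κ` by axiom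
4.

For (ii), the adjoined identity is collapsed onto the identity of the algebra. What is new is that
letters `1` can be deleted (`collapse_eq_preimage`), by a third condensation; empty factors then
disappear and (i) applies. -/

namespace OplusAlgebra

/-! ### Adjoining an identity, and the opposite algebra -/

variable {S : Type u} (A : OplusAlgebra S)

/-- The semigroup underlying a `⊕`-algebra. -/
abbrev semigroup : Semigroup S where
  mul := A.mul
  mul_assoc a b c := (A.mul_assoc a b c).symm

/-- The monoid obtained from a `⊕`-algebra by adjoining an identity. -/
def Ext (_ : OplusAlgebra S) : Type u := WithOne S

instance : Monoid A.Ext := @WithOne.instMonoid S A.semigroup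

instance [Finite S] : Finite A.Ext := inferInstanceAs (Finite (Option S))

/-- The inclusion of a `⊕`-algebra in its extension by an identity. -/
def inj (a : S) : A.Ext := (a : WithOne S)

/-- The `ω`-power on the extension by an identity. -/
def tauExt (x : A.Ext) : A.Ext := Option.map A.tau x

/-- The `ω*`-power on the extension by an identity. -/
def tauOpExt (x : A.Ext) : A.Ext := Option.map A.tauOp x

theorem inj_injective : Function.Injective A.inj := fun _ _ h => Option.some_injective _ h

@[simp] theorem inj_inj {a b : S} : A.inj a = A.inj b ↔ a = b := A.inj_injective.eq_iff

@[simp] theorem inj_ne_one (a : S) : A.inj a ≠ 1 := WithOne.coe_ne_one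

theorem inj_mul (a b : S) : A.inj (A.mul a b) = A.inj a * A.inj b := rfl

theorem eq_one_or_inj (x : A.Ext) : x = 1 ∨ ∃ a, x = A.inj a := by
  cases x with
  | none => exact Or.inl rfl
  | some a => exact Or.inr ⟨a, rfl⟩

theorem exists_inj_of_ne_one {x : A.Ext} (h : x ≠ 1) : ∃ a, x = A.inj a :=
  (A.eq_one_or_inj x).resolve_left h

@[simp] theorem tauExt_one : A.tauExt 1 = 1 := rfl
@[simp] theorem tauOpExt_one : A.tauOpExt 1 = 1 := rfl
@[simp] theorem tauExt_inj (a : S) : A.tauExt (A.inj a) = A.inj (A.tau a) := rfl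
@[simp] theorem tauOpExt_inj (a : S) : A.tauOpExt (A.inj a) = A.inj (A.tauOp a) := rfl

theorem inj_powSucc (a : S) (n : ℕ) : A.inj (powSucc A.mul a n) = A.inj a ^ (n + 1) := by
  induction n with
  | zero => simp [powSucc]
  | succ n ih => rw [powSucc, inj_mul, ih, pow_succ _ (n + 1)]

theorem tauExt_pow (x : A.Ext) (n : ℕ) : A.tauExt (x ^ (n + 1)) = A.tauExt x := by
  rcases A.eq_one_or_inj x with rfl | ⟨a, rfl⟩
  · simp
  · rw [← inj_powSucc, tauExt_inj, A.tau_pow, tauExt_inj]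

/-- The case `b = a` of `(ab)^τ = a(ba)^τ`, combined with `(aa)^τ = a^τ`. -/
theorem mul_tauExt (x : A.Ext) : x * A.tauExt x = A.tauExt x := by
  rcases A.eq_one_or_inj x with rfl | ⟨a, rfl⟩
  · simp
  · have h := A.tau_mul a a
    have h2 := A.tau_pow a 1
    simp only [powSucc] at h2
    rw [h2] at h
    rw [tauExt_inj, ← inj_mul, ← h]

theorem tauExt_mul (x y : A.Ext) : A.tauExt (x * y) = x * A.tauExt (y * x) := by
  rcases A.eq_one_or_inj x with rfl | ⟨a, rfl⟩
  · simp
  rcases A.eq_one_or_inj y with rfl | ⟨b, rfl⟩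
  · rw [_root_.mul_one, _root_.one_mul, mul_tauExt]
  rw [← inj_mul, ← inj_mul, tauExt_inj, tauExt_inj, A.tau_mul, inj_mul]

theorem pow_mul_tauExt (x : A.Ext) (n : ℕ) : x ^ n * A.tauExt x = A.tauExt x := by
  induction n with
  | zero => simp
  | succ n ih => rw [pow_succ, _root_.mul_assoc, mul_tauExt, ih]

/-- The opposite `⊕`-algebra. -/
def op : OplusAlgebra S where
  mul a b := A.mul b a
  tau := A.tauOp
  tauOp := A.tau
  kappa := A.kappa
  mul_assoc a b c := (A.mul_assoc c b a).symm
  tau_mul a b := A.tauOp_mul a b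
  tau_pow a n := by
    have : ∀ n, powSucc (fun a b => A.mul b a) a n = powSucc A.mul a n := by
      intro n
      induction n with
      | zero => rfl
      | succ n ih =>
        rw [powSucc, ih]
        apply A.inj_injective
        rw [inj_mul, inj_powSucc, inj_powSucc, ← pow_succ']
    rw [this, A.tauOp_pow]
  tauOp_mul a b := A.tau_mul a b
  tauOp_pow a n := by
    have : ∀ n, powSucc (fun a b => A.mul b a) a n = powSucc A.mul a n := by
      intro n
      induction n with
      | zero => rfl
      | succ n ih =>
        rw [powSucc, ih]
        apply A.inj_injective
        rw [inj_mul, inj_powSucc, inj_powSucc, ← pow_succ']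
    rw [this, A.tau_pow]
  kappa_mul_kappa := A.kappa_mul_kappa
  kappa_mul_mul_kappa P c hc := by rw [A.mul_assoc]; exact A.kappa_mul_mul_kappa P c hc
  tau_kappa := A.tauOp_kappa
  tau_kappa_mul := A.tauOp_mul_kappa
  tauOp_kappa := A.tau_kappa
  tauOp_mul_kappa := A.tau_kappa_mul
  kappa_union P P' hP' P'' h hP'' := by
    refine A.kappa_union P P' hP' P'' h fun x hx => ?_
    rcases hP'' hx with h | ⟨a, ha, h⟩ | ⟨b, hb, h⟩ | ⟨a, ha, b, hb, h⟩
    · exact Or.inl h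
    · exact Or.inr (Or.inr (Or.inl ⟨a, ha, h⟩))
    · exact Or.inr (Or.inl ⟨b, hb, h⟩)
    · exact Or.inr (Or.inr (Or.inr ⟨b, hb, a, ha, by rw [h, A.mul_assoc]⟩))

/-- Both extensions have the same underlying type, so a map into one is a map into the other. This
identity carries every later transfer from `ω` to `ω*` and from first blocks to last blocks. -/
theorem op_mul (x y : A.Ext) : (show A.op.Ext from x) * (show A.op.Ext from y) = (y * x : A.Ext) := by
  rcases A.eq_one_or_inj x with rfl | ⟨a, rfl⟩
  · rw [_root_.mul_one]; exact _root_.one_mul (M := A.op.Ext) y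
  rcases A.eq_one_or_inj y with rfl | ⟨b, rfl⟩
  · rw [_root_.one_mul]; exact _root_.mul_one (M := A.op.Ext) _
  · rfl

/-! ### Absorption laws of the shuffle -/

variable (P : {P : Set S // P.Nonempty})

/-- The shuffle `κ`, in the extension by an identity. -/
def kap : A.Ext := A.inj (A.kappa P)

theorem kap_mul_kap : A.kap P * A.kap P = A.kap P := by
  rw [kap, ← inj_mul, ← A.kappa_mul_kappa]

theorem kap_mul_mul_kap {c : S} (hc : c ∈ P.1) : A.kap P * A.inj c * A.kap P = A.kap P := by
  rw [kap, ← inj_mul, ← inj_mul, ← A.kappa_mul_mul_kappa P c hc]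

theorem tauExt_kap : A.tauExt (A.kap P) = A.kap P := by
  rw [kap, tauExt_inj, ← A.tau_kappa]

theorem tauExt_kap_mul {c : S} (hc : c ∈ P.1) : A.tauExt (A.kap P * A.inj c) = A.kap P := by
  rw [kap, ← inj_mul, tauExt_inj, ← A.tau_kappa_mul P c hc]

/-- The elements `1` and `inj c` for `c ∈ P`. -/
def OptMem (x : A.Ext) : Prop := x = 1 ∨ ∃ c ∈ P.1, x = A.inj c

variable {P} {A}

/-- Between two adjacent shuffles there is either nothing or one letter of `P`; allowing `x = 1`
treats both cases at once. -/
theorem OptMem.kap_mul_mul_kap {x : A.Ext} (h : A.OptMem P x) : A.kap P * x * A.kap P = A.kap P := by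
  rcases h with rfl | ⟨c, hc, rfl⟩
  · rw [_root_.mul_one, A.kap_mul_kap]
  · exact A.kap_mul_mul_kap P hc

theorem OptMem.tauExt_kap_mul {x : A.Ext} (h : A.OptMem P x) : A.tauExt (A.kap P * x) = A.kap P := by
  rcases h with rfl | ⟨c, hc, rfl⟩
  · rw [_root_.mul_one, A.tauExt_kap]
  · exact A.tauExt_kap_mul P hc

/-- If every element of `R` is an element of `P` or of the form `x · P^κ · y` with `x`, `y` in `P`
or absent, the latter occurring unless `R = P`, then `R^κ = P^κ`. -/
theorem kap_eq_kap {R : {R : Set S // R.Nonempty}}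
    (h : ∀ r ∈ R.1, r ∈ P.1 ∨ ∃ x y, A.OptMem P x ∧ A.OptMem P y ∧ A.inj r = x * A.kap P * y)
    (h' : R.1 = P.1 ∨ ∃ r ∈ R.1, ∃ x y, A.OptMem P x ∧ A.OptMem P y ∧ A.inj r = x * A.kap P * y) :
    A.kap R = A.kap P := by
  rcases h' with h' | ⟨r, hr, hr'⟩
  · rw [Subtype.ext h']
  let Q : Set S := {r | ∃ x y, A.OptMem P x ∧ A.OptMem P y ∧ A.inj r = x * A.kap P * y}
  -- Axiom 4 with `P' = R ∩ P` and `P'' = R ∩ Q`. It requires `P''` to be nonempty, whence the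
  -- separate case `R = P`.
  have key := A.kappa_union P (R.1 ∩ P.1) Set.inter_subset_right (R.1 ∩ Q) ⟨r, hr, hr'⟩ (by
    rintro s ⟨-, x, y, hx, hy, hs⟩
    rcases hx with rfl | ⟨a, ha, rfl⟩ <;> rcases hy with rfl | ⟨b, hb, rfl⟩ <;>
      simp only [_root_.one_mul, _root_.mul_one, kap, ← inj_mul, inj_inj] at hs
    · exact Or.inl hs
    · exact Or.inr (Or.inr (Or.inl ⟨b, hb, hs⟩))
    · exact Or.inr (Or.inl ⟨a, ha, hs⟩)
    · exact Or.inr (Or.inr (Or.inr ⟨a, ha, b, hb, hs⟩)))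
  rw [kap, kap, key, inj_inj]
  congr 1
  apply Subtype.ext
  show R.1 = R.1 ∩ P.1 ∪ R.1 ∩ Q
  rw [← Set.inter_union_distrib_left, eq_comm, Set.inter_eq_left]
  exact fun s hs => h s hs

end OplusAlgebra

/-! ### Ramsey's theorem -/

/-- Infinite Ramsey theorem for pairs of natural numbers. -/
theorem exists_strictMono_monochromatic {C : Type*} [Finite C] (col : ℕ → ℕ → C) :
    ∃ φ : ℕ → ℕ, StrictMono φ ∧ ∃ c, ∀ i j, i < j → col (φ i) (φ j) = c := by
  let U := Filter.hyperfilter ℕ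
  have pick : ∀ g : ℕ → C, ∃ c, ∀ᶠ j in (U : Filter ℕ), g j = c := by
    intro g
    have h := (Ultrafilter.finite_biUnion_mem_iff (f := U) (s := fun c => {j | g j = c})
      (Set.finite_univ (α := C))).1 (by
        have : (⋃ c ∈ (Set.univ : Set C), {j | g j = c}) = Set.univ := by ext j; simp
        rw [this]
        exact Filter.univ_mem)
    obtain ⟨c, -, hc⟩ := h
    exact ⟨c, hc⟩
  -- `lim i` is the colour of `(i, j)` for ultrafilter-almost all `j`, and `c` is the almost sure
  -- value of `lim`. Indices with `lim i = c` can be picked greedily, since finitely many almost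
  -- sure conditions hold together.
  choose lim hlim using fun i => pick (col i)
  obtain ⟨c, hc⟩ := pick lim
  obtain ⟨φ, hφ, hr⟩ := exists_seq_of_forall_finset_exists (fun i => lim i = c)
    (fun i j => i < j ∧ col i j = c) (by
      intro s hs
      have h1 : ∀ᶠ j in (U : Filter ℕ), ∀ x ∈ s, x < j ∧ col x j = c := by
        rw [Filter.eventually_all_finset]
        intro x hx
        have h2 : ∀ᶠ j in (U : Filter ℕ), x < j := by
          apply Filter.hyperfilter_le_cofinite
          rw [Nat.cofinite_eq_atTop]
          exact Filter.eventually_gt_atTop x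
        filter_upwards [h2, hlim x] with j hj hj'
        exact ⟨hj, hj'.trans (hs x hx)⟩
      obtain ⟨y, hy, hy'⟩ := (hc.and h1).exists
      exact ⟨y, hy, hy'⟩)
  exact ⟨φ, fun i j h => (hr i j h).1, c, fun i j h => (hr i j h).2⟩

open Set

/-! ### Sequences of consecutive convex sets -/

section Parts

variable {W ι : Type*}

/-- The union of the members of a family with index in `K`. -/
def part (X : ι → Set W) (K : Set ι) : Set W := ⋃ i ∈ K, X i

theorem mem_part {X : ι → Set W} {K : Set ι} {x : W} : x ∈ part X K ↔ ∃ i ∈ K, x ∈ X i := by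
  simp [part]

@[simp] theorem part_empty (X : ι → Set W) : part X ∅ = ∅ := by simp [part]

@[simp] theorem part_univ (X : ι → Set W) : part X univ = ⋃ i, X i := by simp [part]

@[simp] theorem part_singleton (X : ι → Set W) (i : ι) : part X {i} = X i := by simp [part]

theorem part_union (X : ι → Set W) (K L : Set ι) : part X (K ∪ L) = part X K ∪ part X L :=
  biUnion_union _ _ _

theorem part_iUnion {κ : Sort*} (X : ι → Set W) (K : κ → Set ι) :
    part X (⋃ j, K j) = ⋃ j, part X (K j) := by
  ext x; simp only [mem_part, mem_iUnion]; tauto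

theorem part_mono (X : ι → Set W) {K L : Set ι} (h : K ⊆ L) : part X K ⊆ part X L :=
  biUnion_subset_biUnion_left h

theorem part_subset_iUnion (X : ι → Set W) (K : Set ι) : part X K ⊆ ⋃ i, X i := by
  rw [← part_univ]; exact part_mono X (subset_univ K)

theorem subset_part (X : ι → Set W) {K : Set ι} {i : ι} (h : i ∈ K) : X i ⊆ part X K :=
  subset_biUnion_of_mem (u := X) h

theorem part_nonempty {X : ι → Set W} {K : Set ι} (hX : ∀ i, (X i).Nonempty) (hK : K.Nonempty) :
    (part X K).Nonempty := by
  obtain ⟨i, hi⟩ := hK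
  exact (hX i).mono (subset_part X hi)

theorem part_eq_iUnion (X : ι → Set W) (K : Set ι) : part X K = ⋃ i : K, X i := by
  rw [part, biUnion_eq_iUnion]

end Parts

section Chains

variable {W : Type*} [LinearOrder W]

/-- Every element of `X` is smaller than every element of `Y`. -/
def Before (X Y : Set W) : Prop := ∀ x ∈ X, ∀ y ∈ Y, x < y

theorem Before.mono {X Y X' Y' : Set W} (h : Before X Y) (hX : X' ⊆ X) (hY : Y' ⊆ Y) :
    Before X' Y' := fun x hx y hy => h x (hX hx) y (hY hy)

theorem Before.ordConnected_left {X Y : Set W} (h : Before X Y) (hc : (X ∪ Y).OrdConnected) :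
    X.OrdConnected := by
  refine ⟨fun x hx y hy z hz => ?_⟩
  rcases hc.out (Or.inl hx) (Or.inl hy) hz with h1 | h1
  · exact h1
  · exact absurd (h y hy z h1) hz.2.not_gt

theorem Before.ordConnected_right {X Y : Set W} (h : Before X Y) (hc : (X ∪ Y).OrdConnected) :
    Y.OrdConnected := by
  refine ⟨fun x hx y hy z hz => ?_⟩
  rcases hc.out (Or.inr hx) (Or.inr hy) hz with h1 | h1
  · exact absurd (h z h1 x hx) hz.1.not_gt
  · exact h1

variable {ι : Type*} [LinearOrder ι]

/-- `X` is a family of sets, increasing for the relation `Before`, whose union is a convex subset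
of `D`. -/
structure Chain (D : Set W) (X : ι → Set W) : Prop where
  before : ∀ i j, i < j → Before (X i) (X j)
  ordConnected : (⋃ i, X i).OrdConnected
  subset : (⋃ i, X i) ⊆ D

namespace Chain

variable {D : Set W} {X : ι → Set W}

theorem before_part (h : Chain D X) {K L : Set ι} (hKL : Before K L) :
    Before (part X K) (part X L) := by
  intro x hx y hy
  obtain ⟨i, hi, hx⟩ := mem_part.1 hx
  obtain ⟨j, hj, hy⟩ := mem_part.1 hy
  exact h.before i j (hKL i hi j hj) x hx y hy

theorem le_of_le (h : Chain D X) {i j : ι} {x y : W} (hx : x ∈ X i) (hy : y ∈ X j) (hxy : x ≤ y) :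
    i ≤ j := by
  by_contra hij
  exact absurd (h.before j i (not_le.1 hij) y hy x hx) hxy.not_gt

theorem eq_of_mem (h : Chain D X) {i j : ι} {x : W} (hx : x ∈ X i) (hy : x ∈ X j) : i = j :=
  le_antisymm (h.le_of_le hx hy le_rfl) (h.le_of_le hy hx le_rfl)

theorem ordConnected_part (h : Chain D X) {K : Set ι} (hK : K.OrdConnected) :
    (part X K).OrdConnected := by
  refine ⟨fun x hx y hy z hz => ?_⟩
  obtain ⟨i, hi, hx'⟩ := mem_part.1 hx
  obtain ⟨j, hj, hy'⟩ := mem_part.1 hy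
  obtain ⟨k, hk⟩ := mem_iUnion.1
    (h.ordConnected.out (part_subset_iUnion X K hx) (part_subset_iUnion X K hy) hz)
  exact mem_part.2 ⟨k, hK.out hi hj ⟨h.le_of_le hx' hk hz.1, h.le_of_le hk hy' hz.2⟩, hk⟩

theorem ordConnected_apply (h : Chain D X) (i : ι) : (X i).OrdConnected := by
  rw [← part_singleton X i]; exact h.ordConnected_part ordConnected_singleton

theorem part_subset (h : Chain D X) (K : Set ι) : part X K ⊆ D :=
  (part_subset_iUnion X K).trans h.subset

theorem apply_subset (h : Chain D X) (i : ι) : X i ⊆ D := (subset_iUnion X i).trans h.subset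

/-- Composition of a chain of sets with a chain of index sets. -/
theorem comp (h : Chain D X) {κ : Type*} [LinearOrder κ] {E : Set ι} {K : κ → Set ι}
    (hK : Chain E K) : Chain D fun k => part X (K k) where
  before i j hij := h.before_part (hK.before i j hij)
  ordConnected := by rw [← part_iUnion]; exact h.ordConnected_part hK.ordConnected
  subset := by rw [← part_iUnion]; exact h.part_subset _

theorem restrict (h : Chain D X) {K : Set ι} (hK : K.OrdConnected) :
    Chain D fun i : K => X i where
  before i j hij := h.before i j hij
  ordConnected := by
    have := h.ordConnected_part hK
    rwa [part, biUnion_eq_iUnion] at this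
  subset := by
    have := h.part_subset K
    rwa [part, biUnion_eq_iUnion] at this

theorem mono (h : Chain D X) {D' : Set W} (hD : (⋃ i, X i) ⊆ D') : Chain D' X :=
  ⟨h.before, h.ordConnected, hD⟩

end Chain

theorem chain_singletons : Chain univ fun x : W => ({x} : Set W) where
  before i j hij x hx y hy := by rw [mem_singleton_iff.1 hx, mem_singleton_iff.1 hy]; exact hij
  ordConnected := by rw [iUnion_singleton_eq_range, range_id']; exact ordConnected_univ
  subset := subset_univ _

end Chains

/-! ### Dense orders, shuffled families and valuations -/

/-- Countable dense linear orders without endpoints. -/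
class EtaOrder (Q : Type) [LinearOrder Q] : Prop extends
  Countable Q, DenselyOrdered Q, NoMinOrder Q, NoMaxOrder Q where
  nonempty : Nonempty Q

attribute [instance] EtaOrder.nonempty

instance (Q : Type) [LinearOrder Q] [EtaOrder Q] : EtaOrder Qᵒᵈ where
  toCountable := inferInstanceAs (Countable Q)
  nonempty := inferInstanceAs (Nonempty Q)

/-- Nonempty convex sets without least and greatest elements. -/
structure IsOpenInterval {Q : Type*} [LinearOrder Q] (K : Set Q) : Prop where
  ordConnected : K.OrdConnected
  nonempty : K.Nonempty
  exists_gt : ∀ x ∈ K, ∃ y ∈ K, x < y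
  exists_lt : ∀ x ∈ K, ∃ y ∈ K, y < x

theorem IsOpenInterval.etaOrder {Q : Type} [LinearOrder Q] [Countable Q] [DenselyOrdered Q]
    {K : Set Q} (h : IsOpenInterval K) : EtaOrder K :=
  haveI := h.ordConnected
  { toCountable := inferInstance
    toDenselyOrdered := inferInstance
    toNoMinOrder := ⟨fun x => by
      obtain ⟨y, hy, hlt⟩ := h.exists_lt x x.2
      exact ⟨⟨y, hy⟩, hlt⟩⟩
    toNoMaxOrder := ⟨fun x => by
      obtain ⟨y, hy, hlt⟩ := h.exists_gt x x.2
      exact ⟨⟨y, hy⟩, hlt⟩⟩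
    nonempty := h.nonempty.to_subtype }

theorem isOpenInterval_univ {Q : Type} [LinearOrder Q] [EtaOrder Q] :
    IsOpenInterval (univ : Set Q) where
  ordConnected := ordConnected_univ
  nonempty := univ_nonempty
  exists_gt x _ := (exists_gt x).imp fun _ h => ⟨mem_univ _, h⟩
  exists_lt x _ := (exists_lt x).imp fun _ h => ⟨mem_univ _, h⟩

theorem IsOpenInterval.dual {Q : Type*} [LinearOrder Q] {K : Set Q} (h : IsOpenInterval K) :
    IsOpenInterval (Q := Qᵒᵈ) K where
  ordConnected := h.ordConnected.dual
  nonempty := h.nonempty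
  exists_gt := h.exists_lt
  exists_lt := h.exists_gt

variable {S : Type u}

/-- The values of `g` belong to `P`, and each element of `P` is the value of `g` at a dense set of
arguments. -/
structure Shuffled (A : OplusAlgebra S) (P : Set S) {Q : Type*} [LinearOrder Q] (g : Q → A.Ext) :
    Prop where
  mem : ∀ q, ∃ a ∈ P, g q = A.inj a
  dense : ∀ a ∈ P, ∀ q r, q < r → ∃ t, q < t ∧ t < r ∧ g t = A.inj a

theorem Shuffled.restrict {A : OplusAlgebra S} {P : Set S} {Q : Type*} [LinearOrder Q]
    {g : Q → A.Ext} (h : Shuffled A P g) {K : Set Q} (hK : K.OrdConnected) :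
    Shuffled A P fun q : K => g q where
  mem q := h.mem q
  dense a ha q r hqr := by
    obtain ⟨t, h1, h2, h3⟩ := h.dense a ha q r hqr
    exact ⟨⟨t, hK.out q.2 r.2 ⟨h1.le, h2.le⟩⟩, h1, h2, h3⟩

theorem Shuffled.dual {A : OplusAlgebra S} {P : Set S} {Q : Type*} [LinearOrder Q]
    {g : Q → A.Ext} (h : Shuffled A P g) : Shuffled A.op P (Q := Qᵒᵈ) g where
  mem := h.mem
  dense a ha q r hqr := by
    obtain ⟨t, h1, h2, h3⟩ := h.dense a ha r q hqr
    exact ⟨t, h2, h1, h3⟩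

section Resp

variable {W : Type*} [LinearOrder W] (A : OplusAlgebra S) (D : Set W) (F : Set W → A.Ext)

/-- `F` is compatible with binary concatenation of convex subsets of `D`. -/
structure RespMul : Prop where
  empty : F ∅ = 1
  mul : ∀ X Y, Before X Y → (X ∪ Y).OrdConnected → X ∪ Y ⊆ D → F (X ∪ Y) = F X * F Y

/-- `F` is compatible with `ω`-powers inside `D`. -/
def RespTau : Prop :=
  ∀ (X : ℕ → Set W) (a : A.Ext), Chain D X → (∀ n, F (X n) = a) → F (⋃ n, X n) = A.tauExt a

/-- `F` is compatible with `ω*`-powers inside `D`. -/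
def RespTauOp : Prop :=
  ∀ (X : ℕᵒᵈ → Set W) (a : A.Ext), Chain D X → (∀ n, F (X n) = a) → F (⋃ n, X n) = A.tauOpExt a

/-- `F` is compatible with shuffles inside `D`. -/
def RespKappa : Prop :=
  ∀ (Q : Type) [LinearOrder Q] [EtaOrder Q] (X : Q → Set W) (P : {P : Set S // P.Nonempty}),
    Chain D X → Shuffled A P.1 (fun q => F (X q)) → F (⋃ q, X q) = A.kap P

/-- `F` sends nonempty convex subsets of `D` to elements of `S`. -/
def RespNonempty : Prop := ∀ X ⊆ D, X.OrdConnected → X.Nonempty → F X ≠ 1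

/-- `F` assigns a value to each convex subword of the restriction to `D` of the word `f`, in a way
compatible with the operations of the algebra. -/
structure IsVal (f : W → S) : Prop where
  respNonempty : RespNonempty A D F
  single : ∀ x ∈ D, F {x} = A.inj (f x)
  respMul : RespMul A D F
  respTau : RespTau A D F
  respTauOp : RespTauOp A D F
  respKappa : RespKappa A D F

end Resp

section RespLemmas

variable {W : Type*} [LinearOrder W] {A : OplusAlgebra S} {D : Set W} {F : Set W → A.Ext}

/-- Both the positions and the indices are reversed, so that an `ω`-sequence becomes an
`ω*`-sequence of the same sets. -/
theorem chain_dual {ι : Type*} [LinearOrder ι] {X : ι → Set W} (h : Chain D X) :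
    Chain (W := Wᵒᵈ) (ι := ιᵒᵈ) D X where
  before i j hij x hx y hy := h.before j i hij y hy x hx
  ordConnected := h.ordConnected.dual
  subset := h.subset

theorem RespMul.dual (h : RespMul A D F) : RespMul (W := Wᵒᵈ) A.op D F where
  empty := h.empty
  mul X Y hXY hc hD := by
    refine Eq.trans ?_ (A.op_mul (F X) (F Y)).symm
    have e : X ∪ Y = Y ∪ X := union_comm X Y
    rw [e] at hc hD
    exact (congrArg F e).trans (h.mul Y X (fun y hy x hx => hXY x hx y hy) hc.dual hD)

theorem RespTau.dual (h : RespTau A D F) : RespTauOp (W := Wᵒᵈ) A.op D F :=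
  fun X a hX ha => h X a (chain_dual hX) ha

theorem RespTauOp.dual (h : RespTauOp A D F) : RespTau (W := Wᵒᵈ) A.op D F :=
  fun X a hX ha => h X a (chain_dual hX) ha

theorem RespKappa.dual (h : RespKappa A D F) : RespKappa (W := Wᵒᵈ) A.op D F :=
  fun Q _ _ X P hX hP => h Qᵒᵈ X P (chain_dual hX) hP.dual

theorem IsVal.dual {f : W → S} (h : IsVal A D F f) : IsVal (W := Wᵒᵈ) A.op D F f where
  respNonempty X hX hc hn := h.respNonempty X hX hc.dual hn
  single := h.single
  respMul := h.respMul.dual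
  respTau := h.respTauOp.dual
  respTauOp := h.respTau.dual
  respKappa := h.respKappa.dual

variable {ι : Type*} [LinearOrder ι] {X : ι → Set W}

theorem RespMul.mono (h : RespMul A D F) {D' : Set W} (hD : D' ⊆ D) : RespMul A D' F :=
  ⟨h.empty, fun X Y h1 h2 h3 => h.mul X Y h1 h2 (h3.trans hD)⟩

theorem RespTau.mono (h : RespTau A D F) {D' : Set W} (hD : D' ⊆ D) : RespTau A D' F :=
  fun X a hX => h X a (hX.mono (hX.subset.trans hD))

theorem RespTauOp.mono (h : RespTauOp A D F) {D' : Set W} (hD : D' ⊆ D) : RespTauOp A D' F :=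
  fun X a hX => h X a (hX.mono (hX.subset.trans hD))

theorem RespKappa.mono (h : RespKappa A D F) {D' : Set W} (hD : D' ⊆ D) : RespKappa A D' F :=
  fun Q _ _ X P hX => h Q X P (hX.mono (hX.subset.trans hD))

theorem IsVal.mono {f : W → S} (h : IsVal A D F f) {D' : Set W} (hD : D' ⊆ D) : IsVal A D' F f where
  respNonempty X hX := h.respNonempty X (hX.trans hD)
  single x hx := h.single x (hD hx)
  respMul := h.respMul.mono hD
  respTau := h.respTau.mono hD
  respTauOp := h.respTauOp.mono hD
  respKappa := h.respKappa.mono hD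

theorem RespMul.comp (h : RespMul A D F) (hX : Chain D X) :
    RespMul A univ fun K => F (part X K) where
  empty := by rw [part_empty, h.empty]
  mul K L hKL hc _ := by
    rw [part_union]
    exact h.mul _ _ (hX.before_part hKL) (by rw [← part_union]; exact hX.ordConnected_part hc)
      (by rw [← part_union]; exact hX.part_subset _)

theorem RespTau.comp (h : RespTau A D F) (hX : Chain D X) :
    RespTau A univ fun K => F (part X K) := fun K a hK ha => by
  dsimp only; rw [part_iUnion]; exact h _ a (hX.comp hK) ha

theorem RespTauOp.comp (h : RespTauOp A D F) (hX : Chain D X) :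
    RespTauOp A univ fun K => F (part X K) := fun K a hK ha => by
  dsimp only; rw [part_iUnion]; exact h _ a (hX.comp hK) ha

theorem RespKappa.comp (h : RespKappa A D F) (hX : Chain D X) :
    RespKappa A univ fun K => F (part X K) := fun Q _ _ K P hK hP => by
  dsimp only; rw [part_iUnion]; exact h Q _ P (hX.comp hK) hP

/-- The values of the blocks of a chain make up a word, on which a valuation induces a
valuation. -/
theorem IsVal.comp {f : W → S} (h : IsVal A D F f) (hX : Chain D X) {g : ι → S}
    (hn : ∀ i, (X i).Nonempty) (hg : ∀ i, F (X i) = A.inj (g i)) :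
    IsVal A univ (fun K => F (part X K)) g where
  respNonempty K _ hc hK :=
    h.respNonempty _ (hX.part_subset K) (hX.ordConnected_part hc) (part_nonempty hn hK)
  single i _ := by rw [part_singleton, hg]
  respMul := h.respMul.comp hX
  respTau := h.respTau.comp hX
  respTauOp := h.respTauOp.comp hX
  respKappa := h.respKappa.comp hX

end RespLemmas

/-! ### Monochromatic decompositions and homogeneous intervals -/

/-- A countable set without greatest element has a strictly increasing cofinal sequence. -/
theorem exists_cofinal_seq {W : Type*} [LinearOrder W] [Countable W] {B : Set W} (hn : B.Nonempty)
    (hB : ∀ x ∈ B, ∃ y ∈ B, x < y) :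
    ∃ y : ℕ → W, StrictMono y ∧ (∀ n, y n ∈ B) ∧ ∀ x ∈ B, ∃ n, x < y n := by
  have := hn.to_subtype
  obtain ⟨e, he⟩ := exists_surjective_nat B
  have step : ∀ (n : ℕ) (b : B), ∃ y : B, b < y ∧ e n < y := by
    intro n b
    obtain ⟨y, hy, hlt⟩ := hB (max b (e n) : B) (Subtype.coe_prop _)
    exact ⟨⟨y, hy⟩, (le_max_left b (e n)).trans_lt hlt, (le_max_right b (e n)).trans_lt hlt⟩
  choose next h1 h2 using step
  -- The term `y (n + 1)` exceeds `e n`, so every element of `B` is eventually passed.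
  let y : ℕ → B := Nat.rec (motive := fun _ => B) (e 0) next
  refine ⟨Subtype.val ∘ y, strictMono_nat_of_lt_succ fun n => h1 n (y n), fun n => (y n).2,
    fun x hx => ?_⟩
  obtain ⟨n, hn⟩ := he ⟨x, hx⟩
  refine ⟨n + 1, ?_⟩
  have := h2 n (y n)
  rw [hn] at this
  exact this

/-- A countable convex set without greatest element is the union of a sequence of consecutive
convex sets which, except for the first, all have the same colour. -/
theorem exists_monochromatic_chain {W : Type*} [LinearOrder W] [Countable W] {C : Type*} [Finite C]
    (col : Set W → C) {X : Set W} (hc : X.OrdConnected) (hn : X.Nonempty)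
    (hX : ∀ x ∈ X, ∃ y ∈ X, x < y) :
    ∃ (Z : ℕ → Set W) (c : C), Chain X Z ∧ (⋃ n, Z n) = X ∧ (∀ n, (Z n).Nonempty) ∧
      ∀ n, col (Z (n + 1)) = c := by
  obtain ⟨y, hy, hyX, hcof⟩ := exists_cofinal_seq hn hX
  obtain ⟨φ, hφ, c, hcol⟩ := exists_strictMono_monochromatic fun i j => col (Ico (y i) (y j))
  let z : ℕ → W := fun n => y (φ n)
  have hz : StrictMono z := hy.comp hφ
  have hzX : ∀ n, z n ∈ X := fun n => hyX _
  have hzcof : ∀ x ∈ X, ∃ n, x < z n := fun x hx => by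
    obtain ⟨n, hn⟩ := hcof x hx
    exact ⟨n, hn.trans_le (hy.monotone (hφ.id_le n))⟩
  -- The first block runs up to `z 1` rather than `z 0`, so that it contains `z 0` and is nonempty.
  -- Its colour is not controlled.
  let Z : ℕ → Set W := fun n => Nat.casesOn n (X ∩ Iio (z 1)) fun n => Ico (z (n + 1)) (z (n + 2))
  have hlt : ∀ n, ∀ x ∈ Z n, x < z (n + 1) := by
    rintro (_ | n) x hx
    exacts [hx.2, hx.2]
  have hge : ∀ n, ∀ x ∈ Z (n + 1), z (n + 1) ≤ x := fun n x hx => hx.1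
  have hU : (⋃ n, Z n) = X := by
    apply Subset.antisymm
    · refine iUnion_subset ?_
      rintro (_ | n) x hx
      · exact hx.1
      · exact hc.out (hzX _) (hzX _) ⟨hx.1, hx.2.le⟩
    · intro x hx
      have hex := hzcof x hx
      classical
      have hspec := Nat.find_spec hex
      refine mem_iUnion.2 ?_
      rcases hk : Nat.find hex with _ | _ | n
      · rw [hk] at hspec
        exact ⟨0, hx, hspec.trans (hz Nat.zero_lt_one)⟩
      · rw [hk] at hspec
        exact ⟨0, hx, hspec⟩
      · rw [hk] at hspec
        exact ⟨n + 1, not_lt.1 (Nat.find_min hex (by omega)), hspec⟩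
  refine ⟨Z, c, ⟨?_, by rwa [hU], hU.le⟩, hU, ?_, ?_⟩
  · intro i j hij x hx w hw
    obtain ⟨j, rfl⟩ := Nat.exists_eq_succ_of_ne_zero (by omega : j ≠ 0)
    exact (hlt i x hx).trans_le ((hz.monotone (by omega)).trans (hge j w hw))
  · rintro (_ | n)
    · exact ⟨z 0, hzX 0, hz Nat.zero_lt_one⟩
    · exact ⟨z (n + 1), le_rfl, hz (Nat.lt_succ_self _)⟩
  · exact fun n => hcol _ _ (Nat.lt_succ_self _)

/-- In a dense linear order with finitely many colours, there is an interval all of whose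
subintervals have the same colours. -/
theorem exists_homogeneous_interval {Q : Type*} [LinearOrder Q] {C : Type*}
    [Finite C] (col : Q → C) {c d : Q} (hcd : c < d) :
    ∃ a b, a < b ∧ ∀ x y t, a ≤ x → x < y → y ≤ b → a < t → t < b →
      ∃ s, x < s ∧ s < y ∧ col s = col t := by
  let cs : Q × Q → Set C := fun p => {k | ∃ s, p.1 < s ∧ s < p.2 ∧ col s = k}
  -- An interval with the fewest colours: no subinterval can lose one.
  obtain ⟨⟨a, b⟩, hab, hmin⟩ := (measure fun p => (cs p).ncard).wf.has_min
    {p : Q × Q | p.1 < p.2} ⟨(c, d), hcd⟩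
  refine ⟨a, b, hab, fun x y t hax hxy hyb hat htb => ?_⟩
  have hsub : cs (x, y) ⊆ cs (a, b) := by
    rintro k ⟨s, h1, h2, h3⟩
    exact ⟨s, hax.trans_lt h1, h2.trans_le hyb, h3⟩
  have hle : (cs (a, b)).ncard ≤ (cs (x, y)).ncard := not_lt.1 (hmin (x, y) hxy)
  have heq := eq_of_subset_of_ncard_le hsub hle (toFinite _)
  have : col t ∈ cs (x, y) := by rw [heq]; exact ⟨t, hat, htb, rfl⟩
  exact this

/-! ### The condensation argument -/

section Condensation

variable {W : Type} [LinearOrder W]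

/-- The closure properties under which a property of convex sets holds for a whole countable
linear order. -/
structure CondensationClosed {C : Type*} (col : Set W → C) (Φ : Set W → Prop) : Prop where
  mono : ∀ D D', D' ⊆ D → D'.OrdConnected → Φ D → Φ D'
  single : ∀ x, Φ {x}
  concat : ∀ X Y, Before X Y → (X ∪ Y).OrdConnected → Φ X → Φ Y → Φ (X ∪ Y)
  omega : ∀ D, D.OrdConnected → D.Nonempty → (∀ x ∈ D, ∃ y ∈ D, x < y) →
    (∀ y ∈ D, Φ (D ∩ Iic y)) → Φ D
  omegaOp : ∀ D, D.OrdConnected → D.Nonempty → (∀ x ∈ D, ∃ y ∈ D, y < x) →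
    (∀ y ∈ D, Φ (D ∩ Ici y)) → Φ D
  shuffle : ∀ (Q : Type) [LinearOrder Q] [EtaOrder Q] (K : Q → Set W), Chain univ K →
    (∀ q, (K q).Nonempty) → (∀ q, Φ (K q)) →
    (∀ p q r, p < q → ∃ t, p < t ∧ t < q ∧ col (K t) = col (K r)) →
    -- This hypothesis costs nothing, because the clause is only applied to distinct condensation
    -- classes; `respKappa_shuffleVal` depends on it.
    (∀ p q, p < q → ∀ x ∈ K p, ∀ y ∈ K q, ¬ Φ (Icc x y)) → Φ (⋃ q, K q)

namespace CondensationClosed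

variable {C : Type*} {col : Set W → C} {Φ : Set W → Prop}

theorem omega' (h : CondensationClosed col Φ) {D : Set W} (hc : D.OrdConnected) (hn : D.Nonempty)
    (hD : ∀ y ∈ D, Φ (D ∩ Iic y)) : Φ D := by
  by_cases hmax : ∀ x ∈ D, ∃ y ∈ D, x < y
  · exact h.omega D hc hn hmax hD
  · push Not at hmax
    obtain ⟨m, hm, hle⟩ := hmax
    have := hD m hm
    rwa [inter_eq_left.2 (show D ⊆ Iic m from hle)] at this

theorem omegaOp' (h : CondensationClosed col Φ) {D : Set W} (hc : D.OrdConnected)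
    (hn : D.Nonempty) (hD : ∀ y ∈ D, Φ (D ∩ Ici y)) : Φ D := by
  by_cases hmax : ∀ x ∈ D, ∃ y ∈ D, y < x
  · exact h.omegaOp D hc hn hmax hD
  · push Not at hmax
    obtain ⟨m, hm, hle⟩ := hmax
    have := hD m hm
    rwa [inter_eq_left.2 (show D ⊆ Ici m from hle)] at this

theorem Icc_trans (h : CondensationClosed col Φ) {x y z : W} (hxy : x ≤ y) (hyz : y ≤ z)
    (h1 : Φ (Icc x y)) (h2 : Φ (Icc y z)) : Φ (Icc x z) := by
  rw [← Icc_union_Ioc_eq_Icc hxy hyz]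
  refine h.concat _ _ (fun a ha b hb => ha.2.trans_lt hb.1) ?_ h1
    (h.mono _ _ Ioc_subset_Icc_self ordConnected_Ioc h2)
  rw [Icc_union_Ioc_eq_Icc hxy hyz]
  exact ordConnected_Icc

/-- Two points are equivalent when the property holds for the interval between them. -/
def setoid (h : CondensationClosed col Φ) : Setoid W where
  r x y := Φ (uIcc x y)
  iseqv :=
    { refl := fun x => by rw [uIcc_self]; exact h.single x
      symm := fun {x y} hxy => by rwa [uIcc_comm]
      trans := fun {x y z} h1 h2 => by
        have hm : ∀ {a b c d : W}, c ≤ a → b ≤ d → Φ (Icc c d) → Φ (Icc a b) :=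
          fun h1 h2 h3 => h.mono _ _ (Icc_subset_Icc h1 h2) ordConnected_Icc h3
        rcases le_total x y with hxy | hxy <;> rcases le_total y z with hyz | hyz <;>
          rcases le_total x z with hxz | hxz <;>
          simp only [uIcc_of_le, uIcc_of_ge, hxy, hyz, hxz] at h1 h2 ⊢
        · exact h.Icc_trans hxy hyz h1 h2
        · have e : x = z := le_antisymm (hxy.trans hyz) hxz
          subst e; rw [Icc_self]; exact h.single x
        · exact hm le_rfl hyz h1
        · exact hm le_rfl hxy h2
        · exact hm hxy le_rfl h2
        · exact hm hyz le_rfl h1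
        · have e : x = z := le_antisymm hxz (hyz.trans hxy)
          subst e; rw [Icc_self]; exact h.single x
        · exact h.Icc_trans hyz hxy h2 h1 }

theorem rel_iff (h : CondensationClosed col Φ) {x y : W} (hxy : x ≤ y) :
    h.setoid x y ↔ Φ (Icc x y) := by
  show Φ (uIcc x y) ↔ _
  rw [uIcc_of_le hxy]

theorem rel_of_mem_Icc (h : CondensationClosed col Φ) {x y z : W} (hxy : h.setoid x y) (h1 : x ≤ z)
    (h2 : z ≤ y) : h.setoid x z :=
  (h.rel_iff h1).2
    (h.mono _ _ (Icc_subset_Icc_right h2) ordConnected_Icc ((h.rel_iff (h1.trans h2)).1 hxy))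

/-- The class of a point. -/
def cls (h : CondensationClosed col Φ) (x : W) : Set W := {y | h.setoid x y}

theorem cls_ordConnected (h : CondensationClosed col Φ) (x : W) : (h.cls x).OrdConnected := by
  refine ⟨fun y hy z hz w hw => ?_⟩
  exact h.setoid.trans hy (h.rel_of_mem_Icc (h.setoid.trans (h.setoid.symm hy) hz) hw.1 hw.2)

/-- The part of the class above a point `y` is exhausted by intervals `[y, z]`, which have the
property since `y` and `z` are equivalent. Then let `y` move down. -/
theorem prop_cls (h : CondensationClosed col Φ) (x : W) : Φ (h.cls x) := by
  have hx : x ∈ h.cls x := h.setoid.refl x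
  refine h.omegaOp' (h.cls_ordConnected x) ⟨x, hx⟩ fun y hy => ?_
  refine h.omega' ((h.cls_ordConnected x).inter ordConnected_Ici) ⟨y, hy, le_rfl⟩ fun z hz => ?_
  have hyz : h.setoid y z := h.setoid.trans (h.setoid.symm hy) hz.1
  exact h.mono (Icc y z) _ (fun w hw => ⟨hw.1.2, hw.2⟩)
    (((h.cls_ordConnected x).inter ordConnected_Ici).inter ordConnected_Iic)
    ((h.rel_iff hz.2).1 hyz)

/-- A property of convex sets that is closed under concatenation, `ω`- and `ω*`-sequences and
shuffles holds for every countable linear order. -/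
theorem prop_univ [Countable W] [Nonempty W] [Finite C] (h : CondensationClosed col Φ) :
    Φ univ := by
  let rep : W → W := fun x => (Quotient.mk h.setoid x).out
  have rep_rel : ∀ x, h.setoid (rep x) x := fun x => Quotient.mk_out (s := h.setoid) x
  have rep_eq : ∀ {x y}, h.setoid x y → rep x = rep y := fun {x y} hxy =>
    congrArg Quotient.out (Quotient.sound (s := h.setoid) hxy)
  -- The quotient is realised by representatives, which inherit a linear order from `W`; convexity
  -- of classes makes this order independent of the choice.
  let R : Type := {c : W // rep c = c}
  let K : R → Set W := fun c => h.cls c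
  have eq_of_rel : ∀ {c d : R}, h.setoid c d → c = d := fun {c d} hcd => by
    apply Subtype.ext; rw [← c.2, ← d.2]; exact rep_eq hcd
  have rep_rep : ∀ x, rep (rep x) = rep x := fun x => rep_eq (rep_rel x)
  have hU : (⋃ c, K c) = univ := by
    refine eq_univ_of_forall fun x => mem_iUnion.2 ⟨⟨rep x, rep_rep x⟩, rep_rel x⟩
  have hK : Chain univ K := by
    refine ⟨fun c d hcd x hx y hy => ?_, by rw [hU]; exact ordConnected_univ, subset_univ _⟩
    by_contra hlt
    rw [not_lt] at hlt
    apply hcd.ne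
    apply eq_of_rel
    rcases le_total y c with hyc | hyc
    · exact h.setoid.symm (h.setoid.trans hy
        (h.rel_of_mem_Icc (h.setoid.symm hy) hyc (le_of_lt hcd)))
    · exact h.setoid.trans (h.rel_of_mem_Icc hx hyc hlt) (h.setoid.symm hy)
  have hself : ∀ c : R, (c : W) ∈ K c := fun c => h.setoid.refl _
  have hne : ∀ {c d : R}, c < d → ∀ x ∈ K c, ∀ y ∈ K d, ¬ Φ (Icc x y) := by
    intro c d hcd x hx y hy hΦ
    have hxy := (h.rel_iff (hK.before c d hcd x hx y hy).le).2 hΦ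
    exact hcd.ne (eq_of_rel (h.setoid.trans (h.setoid.trans hx hxy) (h.setoid.symm hy)))
  -- Two neighbouring classes would have a convex union, hence satisfy `Φ` together by concatenation
  -- and be a single class.
  have hdense : DenselyOrdered R := by
    refine ⟨fun c d hcd => ?_⟩
    by_contra hno
    push Not at hno
    have hcon : (({c, d} : Set R)).OrdConnected := by
      refine ⟨fun a ha b hb e he => ?_⟩
      have hce : c ≤ e := by
        rcases ha with rfl | ha
        · exact he.1
        · rw [mem_singleton_iff.1 ha] at he; exact hcd.le.trans he.1
      have hed : e ≤ d := by
        rcases hb with rfl | hb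
        · exact he.2.trans hcd.le
        · rw [mem_singleton_iff.1 hb] at he; exact he.2
      rcases hce.eq_or_lt with rfl | hce
      · exact Or.inl rfl
      · exact Or.inr (le_antisymm hed (not_lt.1 (hno e hce)))
    have hcon' := hK.ordConnected_part hcon
    rw [insert_eq, part_union, part_singleton, part_singleton] at hcon'
    have hΦ := h.concat _ _ (hK.before c d hcd) hcon' (h.prop_cls c) (h.prop_cls d)
    exact hne hcd c (hself c) d (hself d) (h.mono _ _
      (hcon'.out (Or.inl (hself c)) (Or.inr (hself d))) ordConnected_Icc hΦ)
  obtain ⟨x₀⟩ := ‹Nonempty W›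
  let c₀ : R := ⟨rep x₀, rep_rep x₀⟩
  -- With two classes, a homogeneous open interval of classes is a shuffle and satisfies `Φ`; this
  -- identifies any two classes in it, a contradiction.
  by_cases hsub : ∃ c d : R, c < d
  · exfalso
    obtain ⟨c, d, hcd⟩ := hsub
    obtain ⟨a, b, hab, hhom⟩ := exists_homogeneous_interval (fun c => col (K c)) hcd
    have hopen : IsOpenInterval (Ioo a b) := by
      refine ⟨ordConnected_Ioo, nonempty_Ioo.2 hab, fun x hx => ?_, fun x hx => ?_⟩
      · obtain ⟨y, h1, h2⟩ := exists_between hx.2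
        exact ⟨y, ⟨hx.1.trans h1, h2⟩, h1⟩
      · obtain ⟨y, h1, h2⟩ := exists_between hx.1
        exact ⟨y, ⟨h1, h2.trans hx.2⟩, h2⟩
    have := hopen.etaOrder
    have hΦ := h.shuffle (Ioo a b) (fun q => K q) (hK.restrict hopen.ordConnected)
      (fun q => ⟨_, hself q⟩) (fun q => h.prop_cls _)
      (fun p q r hpq => by
        obtain ⟨s, h1, h2, h3⟩ := hhom p q r p.2.1.le hpq q.2.2.le r.2.1 r.2.2
        exact ⟨⟨s, p.2.1.trans h1, h2.trans q.2.2⟩, h1, h2, h3⟩)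
      (fun p q hpq => hne hpq)
    obtain ⟨x, hx⟩ := hopen.nonempty
    obtain ⟨y, hy, hxy⟩ := hopen.exists_gt x hx
    refine hne hxy x (hself x) y (hself y) (h.mono _ _ ?_ ordConnected_Icc hΦ)
    exact (hK.restrict hopen.ordConnected).ordConnected.out
      (mem_iUnion.2 ⟨⟨x, hx⟩, hself x⟩) (mem_iUnion.2 ⟨⟨y, hy⟩, hself y⟩)
  · have : (⋃ c, K c) = K c₀ := by
      apply Subset.antisymm
      · refine iUnion_subset fun c => ?_
        have e : c = c₀ := le_antisymm (not_lt.1 fun h => hsub ⟨_, _, h⟩) (not_lt.1 fun h => hsub ⟨_, _, h⟩)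
        rw [e]
      · exact subset_iUnion K c₀
    rw [← hU, this]
    exact h.prop_cls _

end CondensationClosed

end Condensation

namespace OplusAlgebra

theorem mul_ne_one_left {A : OplusAlgebra S} {x y : A.Ext} (h : x ≠ 1) : x * y ≠ 1 := by
  obtain ⟨a, rfl⟩ := A.exists_inj_of_ne_one h
  rcases A.eq_one_or_inj y with rfl | ⟨b, rfl⟩
  · rwa [_root_.mul_one]
  · rw [← inj_mul]; exact A.inj_ne_one _

theorem mul_ne_one_right {A : OplusAlgebra S} {x y : A.Ext} (h : y ≠ 1) : x * y ≠ 1 := by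
  obtain ⟨b, rfl⟩ := A.exists_inj_of_ne_one h
  rcases A.eq_one_or_inj x with rfl | ⟨a, rfl⟩
  · rwa [_root_.one_mul]
  · rw [← inj_mul]; exact A.inj_ne_one _

end OplusAlgebra

theorem iUnion_shift {W : Type*} (X : ℕ → Set W) (m : ℕ) : (⋃ n, X (m + n)) = part X (Ici m) := by
  ext x
  simp only [mem_iUnion, mem_part, mem_Ici]
  constructor
  · rintro ⟨n, hn⟩; exact ⟨m + n, by omega, hn⟩
  · rintro ⟨n, hmn, hn⟩; exact ⟨n - m, by rwa [Nat.add_sub_cancel' hmn]⟩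

/-! ### Tails of sequences, good sets and canonical values -/

section General

variable {W : Type*} [LinearOrder W] {A : OplusAlgebra S} {D : Set W} {F : Set W → A.Ext}

theorem RespTauOp.of_dual (h : RespTau (W := Wᵒᵈ) A.op D F) : RespTauOp A D F :=
  fun X a hX ha => h X a (chain_dual hX) ha

theorem Chain.shift {X : ℕ → Set W} (h : Chain D X) (m : ℕ) : Chain D fun n => X (m + n) := by
  have e := iUnion_shift X m
  refine ⟨fun i j hij => h.before _ _ (by omega), ?_, ?_⟩
  · rw [e]; exact h.ordConnected_part ordConnected_Ici
  · rw [e]; exact h.part_subset _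

theorem RespMul.apply_Ico {H : Set ℕ → A.Ext} (h : RespMul A univ H) {a : A.Ext} {m : ℕ}
    (ha : ∀ n, m ≤ n → H {n} = a) (k : ℕ) : H (Ico m (m + k)) = a ^ k := by
  induction k with
  | zero => simp [h.empty]
  | succ k ih =>
    have e : Ico m (m + (k + 1)) = Ico m (m + k) ∪ {m + k} := by
      ext x; simp only [mem_Ico, mem_union, mem_singleton_iff]; omega
    rw [e, h.mul _ _ _ (by rw [← e]; exact ordConnected_Ico) (subset_univ _), ih, ha _ (by omega),
      pow_succ]
    rintro x hx y rfl
    exact hx.2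

theorem RespMul.apply_part_Ico (h : RespMul A D F) {X : ℕ → Set W} (hX : Chain D X) {a : A.Ext}
    {m n : ℕ} (hmn : m ≤ n) (ha : ∀ n, m ≤ n → F (X n) = a) : F (part X (Ico m n)) = a ^ (n - m) := by
  have := (h.comp hX).apply_Ico (m := m) (a := a) (fun n hn => by rw [part_singleton, ha n hn]) (n - m)
  rwa [Nat.add_sub_cancel' hmn] at this

/-- Splitting off an initial segment of a sequence. -/
theorem RespMul.iUnion_nat (h : RespMul A D F) {X : ℕ → Set W} (hX : Chain D X) (m : ℕ) :
    F (⋃ n, X n) = F (part X (Iio m)) * F (part X (Ici m)) := by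
  have := (h.comp hX).mul (Iio m) (Ici m) (fun x hx y hy => lt_of_lt_of_le hx hy)
    (by rw [Iio_union_Ici]; exact ordConnected_univ) (subset_univ _)
  simpa only [Iio_union_Ici, part_univ] using this

/-- Compatibility with an `ω`-power can be checked on a tail. -/
theorem RespMul.tau_of_tail (h : RespMul A D F) {X : ℕ → Set W} (hX : Chain D X) {a : A.Ext}
    (ha : ∀ n, F (X n) = a) (m : ℕ) (hm : F (⋃ n, X (m + n)) = A.tauExt a) :
    F (⋃ n, X n) = A.tauExt a := by
  have e : Iio m = Ico 0 m := by ext; simp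
  rw [h.iUnion_nat hX m, ← iUnion_shift, hm, e, h.apply_part_Ico hX (Nat.zero_le m) fun n _ => ha n,
    A.pow_mul_tauExt]

theorem Chain.shiftOp {X : ℕᵒᵈ → Set W} (h : Chain D X) (m : ℕ) :
    Chain D fun n : ℕᵒᵈ => X (OrderDual.toDual (m + OrderDual.ofDual n)) :=
  chain_dual (W := Wᵒᵈ) (ι := ℕ) ((chain_dual h : Chain (W := Wᵒᵈ) (ι := ℕ) D X).shift m)

theorem RespMul.tauOp_of_tail (h : RespMul A D F) {X : ℕᵒᵈ → Set W} (hX : Chain D X) {a : A.Ext}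
    (ha : ∀ n, F (X n) = a) (m : ℕ)
    (hm : F (⋃ n : ℕᵒᵈ, X (OrderDual.toDual (m + OrderDual.ofDual n))) = A.tauOpExt a) :
    F (⋃ n, X n) = A.tauOpExt a :=
  h.dual.tau_of_tail (X := X) (chain_dual hX) ha m hm

/-- All the clauses but `F ∅ = 1` concern convex subsets of `D`, and `∅` is one of these; values
elsewhere are irrelevant. -/
theorem IsVal.congr {f : W → S} {G : Set W → A.Ext} (hF : IsVal A D F f)
    (h : ∀ X ⊆ D, X.OrdConnected → F X = G X) : IsVal A D G f where
  respNonempty X hX hc hn := by rw [← h X hX hc]; exact hF.respNonempty X hX hc hn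
  single x hx := by
    rw [← h _ (singleton_subset_iff.2 hx) ordConnected_singleton]; exact hF.single x hx
  respMul :=
    ⟨by rw [← h _ (empty_subset _) ordConnected_empty]; exact hF.respMul.empty,
      fun X Y hXY hc hD => by
        rw [← h _ hD hc, ← h X (subset_union_left.trans hD) (hXY.ordConnected_left hc),
          ← h Y (subset_union_right.trans hD) (hXY.ordConnected_right hc)]
        exact hF.respMul.mul X Y hXY hc hD⟩
  respTau X a hX ha := by
    rw [← h _ hX.subset hX.ordConnected]
    exact hF.respTau X a hX fun n => by
      rw [h _ (hX.apply_subset n) (hX.ordConnected_apply n)]; exact ha n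
  respTauOp X a hX ha := by
    rw [← h _ hX.subset hX.ordConnected]
    exact hF.respTauOp X a hX fun n => by
      rw [h _ (hX.apply_subset n) (hX.ordConnected_apply n)]; exact ha n
  respKappa Q _ _ X P hX hP := by
    rw [← h _ hX.subset hX.ordConnected]
    refine hF.respKappa Q X P hX ?_
    have : (fun q => F (X q)) = fun q => G (X q) := funext fun q =>
      h _ (hX.apply_subset q) (hX.ordConnected_apply q)
    rwa [this]

variable (A)

/-- The convex subwords of the restriction to `D` of the word `f` have a unique valuation. -/
def Good (f : W → S) (D : Set W) : Prop :=
  ∃ F, IsVal A D F f ∧ ∀ X ⊆ D, X.OrdConnected → ∀ G, IsVal A X G f → G X = F X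

open Classical in
/-- The value of the restriction to `X` of the word `f`. -/
noncomputable def canon (f : W → S) (X : Set W) : A.Ext :=
  -- The valuation is chosen separately for each `X`; only uniqueness ties the choices together. The
  -- default `1` is not reached on subsets of good sets.
  if h : ∃ G, IsVal A X G f then h.choose X else 1

variable {A} {f : W → S}

theorem Good.dual (h : Good A f D) : Good (W := Wᵒᵈ) A.op f D := by
  obtain ⟨F, hF, hu⟩ := h
  exact ⟨F, hF.dual, fun X hX hc G hG => hu X hX hc.dual G hG.dual⟩

theorem Good.of_dual (h : Good (W := Wᵒᵈ) A.op f D) : Good A f D := by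
  obtain ⟨F, hF, hu⟩ := h
  exact ⟨F, hF.dual, fun X hX hc G hG => hu X hX hc.dual G hG.dual⟩

theorem canon_eq_of_unique {X : Set W} (hF : IsVal A X F f)
    (hu : ∀ G, IsVal A X G f → G X = F X) : canon A f X = F X := by
  have h : ∃ G, IsVal A X G f := ⟨F, hF⟩
  rw [canon, dif_pos h]
  exact hu _ h.choose_spec

theorem Good.eq_canon (h : Good A f D) {X : Set W} (hX : X ⊆ D) (hc : X.OrdConnected)
    {G : Set W → A.Ext} (hG : IsVal A X G f) : G X = canon A f X := by
  obtain ⟨F, hF, hu⟩ := h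
  rw [canon_eq_of_unique (hF.mono hX) (hu X hX hc)]
  exact hu X hX hc G hG

/-- By uniqueness the separate choices in `canon` agree with one valuation of `D` on convex sets.
Since `canon` does not mention `D`, valuations of different good sets need no gluing. -/
theorem Good.isVal_canon (h : Good A f D) : IsVal A D (canon A f) f := by
  obtain ⟨F, hF, hu⟩ := h
  exact hF.congr fun X hX hc => (canon_eq_of_unique (hF.mono hX) (hu X hX hc)).symm

theorem Good.mono (h : Good A f D) {D' : Set W} (hD : D' ⊆ D) : Good A f D' := by
  obtain ⟨F, hF, hu⟩ := h
  exact ⟨F, hF.mono hD, fun X hX => hu X (hX.trans hD)⟩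

end General

/-! ### Computing the value of a shuffle from its parts -/

section Cuts

theorem Shuffled.optMem {A : OplusAlgebra S} {R : {R : Set S // R.Nonempty}} {Q : Type*}
    [LinearOrder Q] {g : Q → A.Ext} (h : Shuffled A R.1 g) (q : Q) : A.OptMem R (g q) :=
  Or.inr (h.mem q)

theorem IsOpenInterval.inter_Iio {Q : Type*} [LinearOrder Q] [DenselyOrdered Q] {E : Set Q}
    (hE : IsOpenInterval E) {q : Q} (hq : q ∈ E) : IsOpenInterval (E ∩ Iio q) where
  ordConnected := hE.ordConnected.inter ordConnected_Iio
  nonempty := hE.exists_lt q hq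
  exists_gt x hx := by
    obtain ⟨y, h1, h2⟩ := exists_between hx.2
    exact ⟨y, ⟨hE.ordConnected.out hx.1 hq ⟨h1.le, h2.le⟩, h2⟩, h1⟩
  exists_lt x hx := by
    obtain ⟨y, h1, h2⟩ := hE.exists_lt x hx.1
    exact ⟨y, ⟨h1, h2.trans hx.2⟩, h2⟩

theorem IsOpenInterval.inter_Ioi {Q : Type*} [LinearOrder Q] [DenselyOrdered Q] {E : Set Q}
    (hE : IsOpenInterval E) {q : Q} (hq : q ∈ E) : IsOpenInterval (E ∩ Ioi q) :=
  (hE.dual.inter_Iio hq).dual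

theorem isOpenInterval_Ioo {Q : Type*} [LinearOrder Q] [DenselyOrdered Q] {a b : Q} (hab : a < b) :
    IsOpenInterval (Ioo a b) where
  ordConnected := ordConnected_Ioo
  nonempty := nonempty_Ioo.2 hab
  exists_gt x hx := by
    obtain ⟨y, h1, h2⟩ := exists_between hx.2
    exact ⟨y, ⟨hx.1.trans h1, h2⟩, h1⟩
  exists_lt x hx := by
    obtain ⟨y, h1, h2⟩ := exists_between hx.1
    exact ⟨y, ⟨h1, h2.trans hx.2⟩, h2⟩

variable {Q : Type} [LinearOrder Q] [EtaOrder Q] {A : OplusAlgebra S} {H : Set Q → A.Ext}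
  {R : {R : Set S // R.Nonempty}}

theorem RespMul.inter_Iio_mul {W : Type*} [LinearOrder W] {H : Set W → A.Ext}
    (h : RespMul A univ H) {E : Set W} (hE : E.OrdConnected) {q : W} (hq : q ∈ E) :
    H E = H (E ∩ Iio q) * H {q} * H (E ∩ Ioi q) := by
  have e1 : E ∩ Iio q ∪ {q} = E ∩ Iic q := by
    ext x
    simp only [mem_union, mem_inter_iff, mem_Iio, mem_singleton_iff, mem_Iic]
    constructor
    · rintro (⟨h1, h2⟩ | rfl)
      exacts [⟨h1, h2.le⟩, ⟨hq, le_rfl⟩]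
    · rintro ⟨h1, h2⟩
      rcases h2.lt_or_eq with h2 | h2
      exacts [Or.inl ⟨h1, h2⟩, Or.inr h2]
  have e2 : E ∩ Iic q ∪ E ∩ Ioi q = E := by rw [← inter_union_distrib_left, Iic_union_Ioi, inter_univ]
  rw [← h.mul _ _ _ (by rw [e1]; exact hE.inter ordConnected_Iic) (subset_univ _), e1, ← h.mul _ _ _
    (by rw [e2]; exact hE) (subset_univ _), e2]
  · exact fun x hx y hy => lt_of_le_of_lt hx.2 hy.2
  · rintro x hx y rfl
    exact hx.2

/-- A shuffle cut in two pieces takes the value `κ` if it does so on either side of the cut. -/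
theorem kap_of_cut (hH : RespMul A univ H) (hR : Shuffled A R.1 fun q => H {q}) {E L₁ L₂ : Set Q}
    (hE : IsOpenInterval E) (hL : Before L₁ L₂) (hn₁ : (E ∩ L₁).Nonempty) (hn₂ : (E ∩ L₂).Nonempty)
    (hrest : ∀ q ∈ E, q ∉ L₁ → q ∉ L₂ → ∀ p ∈ E, (p < q → p ∈ L₁) ∧ (q < p → p ∈ L₂))
    (h₁ : ∀ K ⊆ E ∩ L₁, IsOpenInterval K → H K = A.kap R)
    (h₂ : ∀ K ⊆ E ∩ L₂, IsOpenInterval K → H K = A.kap R) : H E = A.kap R := by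
  -- Such a `q` sits exactly at the cut, as the last point of `L₁`, the first of `L₂`, or a point in
  -- neither. Then `κ c κ = κ` with `c` the letter at `q`; without such a point both halves are open
  -- intervals and `κ κ = κ`.
  by_cases hq : ∃ q ∈ E, E ∩ Iio q ⊆ L₁ ∧ E ∩ Ioi q ⊆ L₂
  · obtain ⟨q, hqE, hq1, hq2⟩ := hq
    rw [hH.inter_Iio_mul hE.ordConnected hqE,
      h₁ _ (subset_inter inter_subset_left hq1) (hE.inter_Iio hqE),
      h₂ _ (subset_inter inter_subset_left hq2) (hE.inter_Ioi hqE)]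
    exact (hR.optMem q).kap_mul_mul_kap
  push Not at hq
  have hall : ∀ q ∈ E, q ∈ L₁ ∨ q ∈ L₂ := by
    intro q hqE
    by_contra hno
    push Not at hno
    have := hrest q hqE hno.1 hno.2
    exact hq q hqE (fun p hp => (this p hp.1).1 hp.2) fun p hp => (this p hp.1).2 hp.2
  have low : ∀ p ∈ E, ∀ q ∈ L₁, p ≤ q → p ∈ L₁ := fun p hp q hqL hpq =>
    (hall p hp).resolve_right fun hp2 => (hL q hqL p hp2).not_ge hpq
  have upp : ∀ p ∈ E, ∀ q ∈ L₂, q ≤ p → p ∈ L₂ := fun p hp q hqL hpq =>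
    (hall p hp).resolve_left fun hp2 => (hL p hp2 q hqL).not_ge hpq
  have o1 : IsOpenInterval (E ∩ L₁) := by
    refine ⟨⟨fun x hx y hy z hz => ?_⟩, hn₁, fun x hx => ?_, fun x hx => ?_⟩
    · have hzE := hE.ordConnected.out hx.1 hy.1 hz
      exact ⟨hzE, low z hzE y hy.2 hz.2⟩
    · by_contra hno
      push Not at hno
      exact hq x hx.1 (fun p hp => low p hp.1 x hx.2 hp.2.le) fun p hp =>
        (hall p hp.1).resolve_left fun hp1 => (hno p ⟨hp.1, hp1⟩).not_gt hp.2
    · obtain ⟨y, hy, hlt⟩ := hE.exists_lt x hx.1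
      exact ⟨y, ⟨hy, low y hy x hx.2 hlt.le⟩, hlt⟩
  have o2 : IsOpenInterval (E ∩ L₂) := by
    refine ⟨⟨fun x hx y hy z hz => ?_⟩, hn₂, fun x hx => ?_, fun x hx => ?_⟩
    · have hzE := hE.ordConnected.out hx.1 hy.1 hz
      exact ⟨hzE, upp z hzE x hx.2 hz.1⟩
    · obtain ⟨y, hy, hlt⟩ := hE.exists_gt x hx.1
      exact ⟨y, ⟨hy, upp y hy x hx.2 hlt.le⟩, hlt⟩
    · by_contra hno
      push Not at hno
      exact hq x hx.1 (fun p hp => (hall p hp.1).resolve_right fun hp1 =>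
        (hno p ⟨hp.1, hp1⟩).not_gt hp.2) fun p hp => upp p hp.1 x hx.2 hp.2.le
  have e : E ∩ L₁ ∪ E ∩ L₂ = E := by
    rw [← inter_union_distrib_left]; exact inter_eq_left.2 hall
  have := hH.mul (E ∩ L₁) (E ∩ L₂) (hL.mono inter_subset_right inter_subset_right)
    (by rw [e]; exact hE.ordConnected) (subset_univ _)
  rw [e, h₁ _ Subset.rfl o1, h₂ _ Subset.rfl o2, A.kap_mul_kap] at this
  exact this

/-- A shuffle takes the value `κ` if it does so on bounded intervals. -/
theorem kap_of_omega (hH : RespMul A univ H) (hT : RespTau A univ H)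
    (hR : Shuffled A R.1 fun q => H {q}) {E : Set Q} (hE : IsOpenInterval E)
    (h : ∀ K ⊆ E, IsOpenInterval K → (∃ b ∈ E, K ⊆ Iic b) → H K = A.kap R) : H E = A.kap R := by
  obtain ⟨a, ha⟩ := R.2
  -- Cutting after a cofinal sequence of occurrences of one letter `a` gives blocks of value `κ a`,
  -- and `(κ a)^τ = κ`.
  let B : Set Q := {q | q ∈ E ∧ H {q} = A.inj a}
  have hcof : ∀ x ∈ E, ∃ y ∈ B, x < y := fun x hx => by
    obtain ⟨z, hz, hxz⟩ := hE.exists_gt x hx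
    obtain ⟨t, h1, h2, h3⟩ := hR.dense a ha x z hxz
    exact ⟨t, ⟨hE.ordConnected.out hx hz ⟨h1.le, h2.le⟩, h3⟩, h1⟩
  obtain ⟨x₀, hx₀⟩ := hE.nonempty
  obtain ⟨y₀, hy₀, -⟩ := hcof x₀ hx₀
  obtain ⟨y, hy, hyB, hycof⟩ := exists_cofinal_seq (B := B) ⟨y₀, hy₀⟩ fun x hx => hcof x hx.1
  have hyE : ∀ n, y n ∈ E := fun n => (hyB n).1
  let Z : ℕ → Set Q := fun n => Nat.casesOn n (E ∩ Iic (y 0)) fun n => Ioc (y n) (y (n + 1))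
  have hle : ∀ n, ∀ x ∈ Z n, x ≤ y n := by
    rintro (_ | n) x hx
    exacts [hx.2, hx.2]
  have hlt : ∀ n, ∀ x ∈ Z (n + 1), y n < x := fun n x hx => hx.1
  have hU : (⋃ n, Z n) = E := by
    apply Subset.antisymm
    · refine iUnion_subset ?_
      rintro (_ | n) x hx
      · exact hx.1
      · exact hE.ordConnected.out (hyE n) (hyE (n + 1)) ⟨hx.1.le, hx.2⟩
    · intro x hx
      have hex : ∃ n, x ≤ y n := by
        obtain ⟨z, hz, hxz⟩ := hcof x hx
        obtain ⟨n, hn⟩ := hycof z hz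
        exact ⟨n, (hxz.trans hn).le⟩
      classical
      have hspec := Nat.find_spec hex
      refine mem_iUnion.2 ?_
      rcases hk : Nat.find hex with _ | n
      · rw [hk] at hspec
        exact ⟨0, hx, hspec⟩
      · rw [hk] at hspec
        exact ⟨n + 1, not_le.1 (Nat.find_min hex (by omega)), hspec⟩
  have hZ : Chain univ Z := by
    refine ⟨fun i j hij x hx w hw => ?_, by rw [hU]; exact hE.ordConnected, subset_univ _⟩
    obtain ⟨j, rfl⟩ := Nat.exists_eq_succ_of_ne_zero (by omega : j ≠ 0)
    exact (hle i x hx).trans_lt ((hy.monotone (by omega)).trans_lt (hlt j w hw))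
  have hval : ∀ n, H (Z n) = A.kap R * A.inj a := by
    have key : ∀ (n : ℕ) (K : Set Q), IsOpenInterval K → K ⊆ E → K ⊆ Iio (y n) →
        (K ∪ {y n}).OrdConnected → H (K ∪ {y n}) = A.kap R * A.inj a := by
      intro n K hK hKE hKy hc
      rw [hH.mul K {y n} _ hc (subset_univ _), (hyB n).2,
        h K hKE hK ⟨y n, hyE n, fun x hx => (hKy hx).le⟩]
      rintro x hx _ rfl
      exact hKy hx
    rintro (_ | n)
    · have e : E ∩ Iic (y 0) = E ∩ Iio (y 0) ∪ {y 0} := by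
        ext x
        simp only [mem_inter_iff, mem_Iic, mem_union, mem_Iio, mem_singleton_iff]
        constructor
        · rintro ⟨h1, h2⟩
          rcases h2.lt_or_eq with h2 | h2
          exacts [Or.inl ⟨h1, h2⟩, Or.inr h2]
        · rintro (⟨h1, h2⟩ | rfl)
          exacts [⟨h1, h2.le⟩, ⟨hyE 0, le_rfl⟩]
      show H (E ∩ Iic (y 0)) = _
      rw [e]
      refine key 0 _ (hE.inter_Iio (hyE 0)) inter_subset_left inter_subset_right ?_
      rw [← e]; exact hE.ordConnected.inter ordConnected_Iic
    · have hlt := hy (Nat.lt_succ_self n)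
      show H (Ioc (y n) (y (n + 1))) = _
      rw [← Ioo_union_right hlt]
      refine key (n + 1) _ (isOpenInterval_Ioo hlt) ?_ (fun x hx => hx.2) ?_
      · exact fun x hx => hE.ordConnected.out (hyE n) (hyE (n + 1)) ⟨hx.1.le, hx.2.le⟩
      · rw [Ioo_union_right hlt]; exact ordConnected_Ioc
  have := hT Z _ hZ hval
  rwa [hU, A.tauExt_kap_mul R ha] at this

theorem kap_of_omegaOp (hH : RespMul A univ H) (hT : RespTauOp A univ H)
    (hR : Shuffled A R.1 fun q => H {q}) {E : Set Q} (hE : IsOpenInterval E)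
    (h : ∀ K ⊆ E, IsOpenInterval K → (∃ b ∈ E, K ⊆ Ici b) → H K = A.kap R) : H E = A.kap R :=
  kap_of_omega (Q := Qᵒᵈ) (A := A.op) (H := H) hH.dual hT.dual hR.dual hE.dual
    fun K hK hK' hb => h K hK hK'.dual hb

end Cuts

/-! ### Good sets are closed under concatenation -/

section Concat

variable {W : Type*} [LinearOrder W] {A : OplusAlgebra S} {D₁ D₂ : Set W} {v : Set W → A.Ext}

/-- The valuation of a concatenation. -/
def concatVal (v : Set W → A.Ext) (D₁ D₂ : Set W) (X : Set W) : A.Ext := v (X ∩ D₁) * v (X ∩ D₂)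

theorem concatVal_of_subset_left (hB : Before D₁ D₂) (he : v ∅ = 1) {X : Set W} (hX : X ⊆ D₁) :
    concatVal v D₁ D₂ X = v X := by
  have : X ∩ D₂ = ∅ := by
    ext x
    simp only [mem_inter_iff, mem_empty_iff_false, iff_false, not_and]
    exact fun h1 h2 => (hB x (hX h1) x h2).false
  rw [concatVal, this, he, inter_eq_left.2 hX, mul_one]

theorem concatVal_of_subset_right (hB : Before D₁ D₂) (he : v ∅ = 1) {X : Set W} (hX : X ⊆ D₂) :
    concatVal v D₁ D₂ X = v X := by
  have : X ∩ D₁ = ∅ := by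
    ext x
    simp only [mem_inter_iff, mem_empty_iff_false, iff_false, not_and]
    exact fun h1 h2 => (hB x h2 x (hX h1)).false
  rw [concatVal, this, he, inter_eq_left.2 hX, one_mul]

/-- The inner two of the four factors appear in the wrong order, but one of `Y ∩ D₁` and `X ∩ D₂` is
empty. -/
theorem respMul_concatVal (hB : Before D₁ D₂) (hc : (D₁ ∪ D₂).OrdConnected) (h₁ : RespMul A D₁ v)
    (h₂ : RespMul A D₂ v) : RespMul A (D₁ ∪ D₂) (concatVal v D₁ D₂) where
  empty := by simp [concatVal, h₁.empty]
  mul X Y hXY hcXY _ := by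
    have c₁ := hB.ordConnected_left hc
    have c₂ := hB.ordConnected_right hc
    have e1 := h₁.mul (X ∩ D₁) (Y ∩ D₁) (hXY.mono inter_subset_left inter_subset_left)
      (by rw [← union_inter_distrib_right]; exact hcXY.inter c₁)
      (by rw [← union_inter_distrib_right]; exact inter_subset_right)
    have e2 := h₂.mul (X ∩ D₂) (Y ∩ D₂) (hXY.mono inter_subset_left inter_subset_left)
      (by rw [← union_inter_distrib_right]; exact hcXY.inter c₂)
      (by rw [← union_inter_distrib_right]; exact inter_subset_right)
    rw [← union_inter_distrib_right] at e1 e2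
    rw [concatVal, concatVal, concatVal, e1, e2]
    rcases (Y ∩ D₁).eq_empty_or_nonempty with hY | ⟨y, hy⟩
    · rw [hY, h₁.empty, mul_one, one_mul, mul_assoc]
    · have : X ∩ D₂ = ∅ := by
        ext x
        simp only [mem_inter_iff, mem_empty_iff_false, iff_false, not_and]
        exact fun h1 h2 => (hXY x h1 y hy.1).asymm (hB y hy.2 x h2)
      rw [this, h₁.empty, one_mul, mul_one, mul_assoc]

/-- A sequence that ever reaches `D₂` stays there from the next term on, and `tau_of_tail` allows
the earlier terms to be dropped. -/
theorem respTau_concatVal (hB : Before D₁ D₂) (hc : (D₁ ∪ D₂).OrdConnected) (h₁ : RespMul A D₁ v)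
    (h₂ : RespMul A D₂ v) (t₁ : RespTau A D₁ v) (t₂ : RespTau A D₂ v) :
    RespTau A (D₁ ∪ D₂) (concatVal v D₁ D₂) := by
  intro X a hX ha
  by_cases hall : ∀ n, X n ⊆ D₁
  · rw [concatVal_of_subset_left hB h₁.empty (iUnion_subset hall)]
    refine t₁ X a (hX.mono (iUnion_subset hall)) fun n => ?_
    rw [← ha n, concatVal_of_subset_left hB h₁.empty (hall n)]
  · push Not at hall
    obtain ⟨m, hm⟩ := hall
    obtain ⟨x, hx, hx1⟩ := not_subset.1 hm
    have hx2 := (hX.apply_subset m hx).resolve_left hx1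
    have hall2 : ∀ n, X (m + 1 + n) ⊆ D₂ := fun n y hy =>
      (hX.apply_subset _ hy).resolve_left fun hy1 =>
        (hX.before m (m + 1 + n) (by omega) x hx y hy).asymm (hB y hy1 x hx2)
    refine (respMul_concatVal hB hc h₁ h₂).tau_of_tail hX ha (m + 1) ?_
    rw [concatVal_of_subset_right hB h₁.empty (iUnion_subset hall2)]
    refine t₂ _ a ((hX.shift (m + 1)).mono (iUnion_subset hall2)) fun n => ?_
    rw [← ha (m + 1 + n), concatVal_of_subset_right hB h₁.empty (hall2 n)]

theorem respTauOp_concatVal (hB : Before D₁ D₂) (hc : (D₁ ∪ D₂).OrdConnected)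
    (h₁ : RespMul A D₁ v) (h₂ : RespMul A D₂ v) (t₁ : RespTauOp A D₁ v) (t₂ : RespTauOp A D₂ v) :
    RespTauOp A (D₁ ∪ D₂) (concatVal v D₁ D₂) := by
  have e : (D₁ ∪ D₂ : Set W) = D₂ ∪ D₁ := union_comm _ _
  have hc' : (D₂ ∪ D₁).OrdConnected := e ▸ hc
  rw [e]
  have key := respTau_concatVal (W := Wᵒᵈ) (A := A.op) (v := v) (D₁ := D₂) (D₂ := D₁)
    (fun x hx y hy => hB y hy x hx) hc'.dual h₂.dual h₁.dual t₂.dual t₁.dual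
  have e' : (concatVal (A := A.op) (W := Wᵒᵈ) v D₂ D₁) = (concatVal v D₁ D₂ : Set W → A.Ext) :=
    funext fun X => A.op_mul _ _
  rw [e'] at key
  exact RespTauOp.of_dual key

/-- At most one member of the family straddles the boundary; the members inside `D₁` and those
inside `D₂` form the cut required by `kap_of_cut`. -/
theorem respKappa_concatVal (hB : Before D₁ D₂) (hc : (D₁ ∪ D₂).OrdConnected)
    (h₁ : RespMul A D₁ v) (h₂ : RespMul A D₂ v) (k₁ : RespKappa A D₁ v) (k₂ : RespKappa A D₂ v) :
    RespKappa A (D₁ ∪ D₂) (concatVal v D₁ D₂) := by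
  intro Q _ _ X P hX hP
  have hH := (respMul_concatVal hB hc h₁ h₂).comp hX
  have hP' : Shuffled A P.1 fun q => concatVal v D₁ D₂ (part X {q}) := by
    simpa only [part_singleton] using hP
  have left : ∀ K : Set Q, IsOpenInterval K → (∀ q ∈ K, X q ⊆ D₁) →
      concatVal v D₁ D₂ (part X K) = A.kap P := by
    intro K hK hKD
    have := hK.etaOrder
    have hsub : part X K ⊆ D₁ := iUnion₂_subset hKD
    rw [concatVal_of_subset_left hB h₁.empty hsub]
    rw [part_eq_iUnion] at hsub ⊢
    refine k₁ K (fun q => X q) P ((hX.restrict hK.ordConnected).mono hsub) ?_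
    have := hP.restrict hK.ordConnected
    simpa only [fun q : K => concatVal_of_subset_left hB h₁.empty (hKD q q.2)] using this
  have right : ∀ K : Set Q, IsOpenInterval K → (∀ q ∈ K, X q ⊆ D₂) →
      concatVal v D₁ D₂ (part X K) = A.kap P := by
    intro K hK hKD
    have := hK.etaOrder
    have hsub : part X K ⊆ D₂ := iUnion₂_subset hKD
    rw [concatVal_of_subset_right hB h₁.empty hsub]
    rw [part_eq_iUnion] at hsub ⊢
    refine k₂ K (fun q => X q) P ((hX.restrict hK.ordConnected).mono hsub) ?_
    have := hP.restrict hK.ordConnected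
    simpa only [fun q : K => concatVal_of_subset_right hB h₁.empty (hKD q q.2)] using this
  rw [← part_univ]
  have low : ∀ p q x, x ∈ X q → x ∈ D₁ → p < q → X p ⊆ D₁ := fun p q x hx hx1 hpq y hy =>
    (hX.apply_subset p hy).resolve_right fun hy2 => (hX.before p q hpq y hy x hx).asymm (hB x hx1 y hy2)
  have upp : ∀ p q x, x ∈ X q → x ∈ D₂ → q < p → X p ⊆ D₂ := fun p q x hx hx1 hpq y hy =>
    (hX.apply_subset p hy).resolve_left fun hy2 => (hX.before q p hpq x hx y hy).asymm (hB y hy2 x hx1)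
  by_cases all₁ : ∀ q, X q ⊆ D₁
  · exact left _ isOpenInterval_univ fun q _ => all₁ q
  by_cases all₂ : ∀ q, X q ⊆ D₂
  · exact right _ isOpenInterval_univ fun q _ => all₂ q
  push Not at all₁ all₂
  obtain ⟨q₁, hq₁⟩ := all₁
  obtain ⟨q₂, hq₂⟩ := all₂
  obtain ⟨x₁, hx₁, hx₁'⟩ := not_subset.1 hq₁
  obtain ⟨x₂, hx₂, hx₂'⟩ := not_subset.1 hq₂
  obtain ⟨p₁, hp₁⟩ := exists_gt q₁
  obtain ⟨p₂, hp₂⟩ := exists_lt q₂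
  have ne : ∀ q, (X q).Nonempty := fun q => by
    rw [nonempty_iff_ne_empty]
    intro h0
    obtain ⟨a, -, ha⟩ := hP.mem q
    rw [h0, (respMul_concatVal hB hc h₁ h₂).empty] at ha
    exact A.inj_ne_one a ha.symm
  refine kap_of_cut hH hP' isOpenInterval_univ (L₁ := {q | X q ⊆ D₁}) (L₂ := {q | X q ⊆ D₂})
    ?_ ⟨p₂, mem_univ _, low _ _ _ hx₂ ((hX.apply_subset _ hx₂).resolve_right hx₂') hp₂⟩
    ⟨p₁, mem_univ _, upp _ _ _ hx₁ ((hX.apply_subset _ hx₁).resolve_left hx₁') hp₁⟩ ?_ ?_ ?_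
  · intro p hp q hq
    obtain ⟨x, hx⟩ := ne p
    obtain ⟨y, hy⟩ := ne q
    by_contra hle
    rcases (not_lt.1 hle).eq_or_lt with h | h
    · subst h
      exact (hB x (hp hx) x (hq hx)).false
    · exact (hX.before q p h y hy x hx).asymm (hB x (hp hx) y (hq hy))
  · intro q _ hq1 hq2 p _
    obtain ⟨y₁, hy₁, hy₁'⟩ := not_subset.1 hq1
    obtain ⟨y₂, hy₂, hy₂'⟩ := not_subset.1 hq2
    exact ⟨low _ _ _ hy₂ ((hX.apply_subset _ hy₂).resolve_right hy₂'),
      upp _ _ _ hy₁ ((hX.apply_subset _ hy₁).resolve_left hy₁')⟩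
  · exact fun K hK hK' => left K hK' fun q hq => (hK hq).2
  · exact fun K hK hK' => right K hK' fun q hq => (hK hq).2

theorem Good.concat {f : W → S} (hB : Before D₁ D₂) (hc : (D₁ ∪ D₂).OrdConnected)
    (h₁ : Good A f D₁) (h₂ : Good A f D₂) : Good A f (D₁ ∪ D₂) := by
  have v₁ := h₁.isVal_canon
  have v₂ := h₂.isVal_canon
  have he := v₁.respMul.empty
  have c₁ := hB.ordConnected_left hc
  have c₂ := hB.ordConnected_right hc
  refine ⟨concatVal (canon A f) D₁ D₂, ⟨?_, ?_, respMul_concatVal hB hc v₁.respMul v₂.respMul,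
    respTau_concatVal hB hc v₁.respMul v₂.respMul v₁.respTau v₂.respTau,
    respTauOp_concatVal hB hc v₁.respMul v₂.respMul v₁.respTauOp v₂.respTauOp,
    respKappa_concatVal hB hc v₁.respMul v₂.respMul v₁.respKappa v₂.respKappa⟩, ?_⟩
  · rintro X hX hcX ⟨x, hx⟩
    rcases hX hx with hx' | hx'
    · exact OplusAlgebra.mul_ne_one_left
        (v₁.respNonempty _ inter_subset_right (hcX.inter c₁) ⟨x, hx, hx'⟩)
    · exact OplusAlgebra.mul_ne_one_right
        (v₂.respNonempty _ inter_subset_right (hcX.inter c₂) ⟨x, hx, hx'⟩)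
  · rintro x (hx | hx)
    · rw [concatVal_of_subset_left hB he (singleton_subset_iff.2 hx), v₁.single x hx]
    · rw [concatVal_of_subset_right hB he (singleton_subset_iff.2 hx), v₂.single x hx]
  · intro X hX hcX G hG
    have e : X ∩ D₁ ∪ X ∩ D₂ = X := by
      rw [← inter_union_distrib_left]; exact inter_eq_left.2 hX
    have := hG.respMul.mul (X ∩ D₁) (X ∩ D₂) (hB.mono inter_subset_right inter_subset_right)
      (by rwa [e]) e.subset
    rw [e] at this
    rw [this, concatVal, h₁.eq_canon inter_subset_right (hcX.inter c₁) (hG.mono inter_subset_left),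
      h₂.eq_canon inter_subset_right (hcX.inter c₂) (hG.mono inter_subset_left)]

end Concat

/-! ### Good sets are closed under limits of type `ω` and `ω*` -/

section Omega

variable {W : Type*} [LinearOrder W] {A : OplusAlgebra S} {D : Set W} {v : Set W → A.Ext}

/-- `B` is an initial segment of `X`. -/
structure IsInitial (X B : Set W) : Prop where
  subset : B ⊆ X
  mem_of_le : ∀ x ∈ X, ∀ y ∈ B, x ≤ y → x ∈ B

variable (D v) in
/-- `v` is compatible with concatenation of convex subsets of `D` that are bounded in `D`. -/
def RespMulBdd : Prop :=
  ∀ X Y, Before X Y → (X ∪ Y).OrdConnected → X ∪ Y ⊆ D → (∃ y ∈ D, X ∪ Y ⊆ Iic y) →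
    v (X ∪ Y) = v X * v Y

theorem RespMulBdd.diff (hv : RespMulBdd D v) {X B₁ B₂ B₃ : Set W} (hX : X ⊆ D)
    (hc : X.OrdConnected) (h₁ : IsInitial X B₁) (h₂ : IsInitial X B₂) (h₃ : IsInitial X B₃)
    (h₁₂ : B₁ ⊆ B₂) (h₂₃ : B₂ ⊆ B₃) (hb : ∃ y ∈ D, B₃ ⊆ Iic y) :
    v (B₃ \ B₁) = v (B₂ \ B₁) * v (B₃ \ B₂) := by
  have e : B₂ \ B₁ ∪ B₃ \ B₂ = B₃ \ B₁ := by
    ext x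
    simp only [mem_union, mem_sdiff]
    constructor
    · rintro (⟨h, h'⟩ | ⟨h, h'⟩)
      exacts [⟨h₂₃ h, h'⟩, ⟨h, fun h'' => h' (h₁₂ h'')⟩]
    · rintro ⟨h, h'⟩
      by_cases hx : x ∈ B₂
      exacts [Or.inl ⟨hx, h'⟩, Or.inr ⟨h, hx⟩]
  rw [← e]
  apply hv
  · intro x hx y hy
    by_contra hlt
    exact hy.2 (h₂.mem_of_le y (h₃.subset hy.1) x hx.1 (not_lt.1 hlt))
  · rw [e]
    refine ⟨fun x hx y hy z hz => ?_⟩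
    have hzX := hc.out (h₃.subset hx.1) (h₃.subset hy.1) hz
    exact ⟨h₃.mem_of_le z hzX y hy.1 hz.2, fun hz1 =>
      hx.2 (h₁.mem_of_le x (h₃.subset hx.1) z hz1 hz.1)⟩
  · rw [e]; exact sdiff_subset.trans (h₃.subset.trans hX)
  · obtain ⟨y, hy, hle⟩ := hb
    exact ⟨y, hy, by rw [e]; exact sdiff_subset.trans hle⟩

/-- A decomposition of `X` into a sequence of nonempty consecutive sets which, apart from the
first, have the same value. -/
structure OmegaDecomp (v : Set W → A.Ext) (X : Set W) (Z : ℕ → Set W) (e : A.Ext) : Prop where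
  chain : Chain X Z
  iUnion_eq : (⋃ n, Z n) = X
  nonempty : ∀ n, (Z n).Nonempty
  apply_succ : ∀ n, v (Z (n + 1)) = e

namespace OmegaDecomp

variable {X : Set W} {Z : ℕ → Set W} {e : A.Ext}

theorem isInitial (h : OmegaDecomp v X Z e) (n : ℕ) : IsInitial X (part Z (Iio n)) where
  subset := h.chain.part_subset _
  mem_of_le x hx y hy hxy := by
    rw [← h.iUnion_eq] at hx
    obtain ⟨i, hi⟩ := mem_iUnion.1 hx
    obtain ⟨j, hj, hy⟩ := mem_part.1 hy
    exact mem_part.2 ⟨i, (h.chain.le_of_le hi hy hxy).trans_lt hj, hi⟩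

theorem exists_bound (h : OmegaDecomp v X Z e) (n : ℕ) : ∃ y ∈ X, part Z (Iio n) ⊆ Iio y := by
  obtain ⟨y, hy⟩ := h.nonempty n
  refine ⟨y, h.chain.apply_subset n hy, fun x hx => ?_⟩
  obtain ⟨i, hi, hx⟩ := mem_part.1 hx
  exact h.chain.before i n hi x hx y hy

theorem exists_subset (h : OmegaDecomp v X Z e) {B : Set W} (hB : B ⊆ X) {y : W} (hy : y ∈ X)
    (hBy : B ⊆ Iio y) : ∃ n, ∀ m, n ≤ m → B ⊆ part Z (Iio m) := by
  rw [← h.iUnion_eq] at hy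
  obtain ⟨j, hj⟩ := mem_iUnion.1 hy
  refine ⟨j + 1, fun m hm x hx => ?_⟩
  have hxX := hB hx
  rw [← h.iUnion_eq] at hxX
  obtain ⟨i, hi⟩ := mem_iUnion.1 hxX
  exact mem_part.2 ⟨i, (h.chain.le_of_le hi hj (hBy hx).le).trans_lt (by omega), hi⟩

theorem le_of_subset (h : OmegaDecomp v X Z e) {m n : ℕ} (hmn : part Z (Iio m) ⊆ part Z (Iio n)) :
    m ≤ n := by
  by_contra hlt
  obtain ⟨x, hx⟩ := h.nonempty n
  obtain ⟨j, hj, hx'⟩ := mem_part.1 (hmn (mem_part.2 ⟨n, not_le.1 hlt, hx⟩))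
  have hj : j < n := hj
  exact hj.ne (h.chain.eq_of_mem hx' hx)

theorem apply_diff (h : OmegaDecomp v X Z e) (hv : RespMulBdd D v) (he : v ∅ = 1) (hX : X ⊆ D)
    (hc : X.OrdConnected) {m : ℕ} (hm : 1 ≤ m) (k : ℕ) :
    v (part Z (Iio (m + k)) \ part Z (Iio m)) = e ^ k := by
  induction k with
  | zero => simp [he]
  | succ k ih =>
    obtain ⟨y, hy, hyb⟩ := h.exists_bound (m + (k + 1))
    rw [hv.diff hX hc (h.isInitial m) (h.isInitial (m + k)) (h.isInitial (m + (k + 1)))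
      (part_mono _ (Iio_subset_Iio (by omega))) (part_mono _ (Iio_subset_Iio (by omega)))
      ⟨y, hX hy, fun x hx => (hyb hx).le⟩, ih, pow_succ]
    have e1 : part Z (Iio (m + (k + 1))) \ part Z (Iio (m + k)) = Z (m + k) := by
      ext x
      rw [mem_sdiff, mem_part, mem_part]
      constructor
      · rintro ⟨⟨i, hi, hx⟩, hno⟩
        have hi : i < m + (k + 1) := hi
        have : i = m + k := by
          by_contra hne
          exact hno ⟨i, show i < m + k by omega, hx⟩
        rwa [← this]
      · intro hx
        refine ⟨⟨m + k, show m + k < m + (k + 1) by omega, hx⟩, ?_⟩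
        rintro ⟨i, hi, hx'⟩
        have hi : i < m + k := hi
        exact hi.ne (h.chain.eq_of_mem hx' hx)
    obtain ⟨m, rfl⟩ := Nat.exists_eq_add_of_le' hm
    rw [e1, show m + 1 + k = m + k + 1 by omega, h.apply_succ]

theorem apply_Iio (h : OmegaDecomp v X Z e) (hv : RespMulBdd D v) (he : v ∅ = 1) (hX : X ⊆ D)
    (hc : X.OrdConnected) (k : ℕ) : v (part Z (Iio (1 + k))) = v (Z 0) * e ^ k := by
  obtain ⟨y, hy, hyb⟩ := h.exists_bound (1 + k)
  have := hv.diff hX hc (B₁ := ∅) ⟨empty_subset _, fun _ _ _ h => h.elim⟩ (h.isInitial 1)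
    (h.isInitial (1 + k)) (empty_subset _) (part_mono _ (Iio_subset_Iio (by omega)))
    ⟨y, hX hy, fun x hx => (hyb hx).le⟩
  rw [sdiff_empty, sdiff_empty, h.apply_diff hv he hX hc le_rfl] at this
  rw [this]
  congr 2
  have : Iio 1 = ({0} : Set ℕ) := by ext; simp
  rw [this, part_singleton]

/-- The value assigned to `X` by a decomposition does not depend on the decomposition. -/
theorem value_unique [Finite S] (h : OmegaDecomp v X Z e) {Z' : ℕ → Set W} {e' : A.Ext}
    (h' : OmegaDecomp v X Z' e') (hv : RespMulBdd D v) (he : v ∅ = 1) (hX : X ⊆ D)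
    (hc : X.OrdConnected) : v (Z 0) * A.tauExt e = v (Z' 0) * A.tauExt e' := by
  have hex : ∀ n, ∃ m, part Z (Iio n) ⊆ part Z' (Iio (1 + m)) := fun n => by
    obtain ⟨y, hy, hyb⟩ := h.exists_bound n
    obtain ⟨m, hm⟩ := h'.exists_subset (h.isInitial n).subset hy hyb
    exact ⟨m, hm _ (by omega)⟩
  choose m hm using hex
  -- The two decompositions are interleaved: `s` is an overhang of `Z'` beyond `Z` that recurs at
  -- infinitely many cuts.
  obtain ⟨s, hs⟩ := Finite.exists_infinite_fiber
    fun n => v (part Z' (Iio (1 + m n)) \ part Z (Iio n))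
  rw [Set.infinite_coe_iff] at hs
  obtain ⟨n, hn, hn1⟩ := hs.exists_gt 0
  -- One more block of `Z'` is required before the next cut `n'`, so that the powers of `e` and `e'`
  -- compared below have positive exponents, as `tauExt_pow` needs.
  obtain ⟨y, hy, hyb⟩ := h'.exists_bound (1 + m n + 1)
  obtain ⟨N, hN⟩ := h.exists_subset (h'.isInitial _).subset hy hyb
  obtain ⟨n', hn', hNn'⟩ := hs.exists_gt N
  have h1 := hm n
  have h2 := hN n' hNn'.le
  have h3 := hm n'
  have hstep : part Z' (Iio (1 + m n)) ⊆ part Z' (Iio (1 + m n + 1)) :=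
    part_mono _ (Iio_subset_Iio (by omega))
  have hlt' : 1 + m n + 1 ≤ 1 + m n' := h'.le_of_subset (h2.trans h3)
  have hlt : n < n' := by
    by_contra hle
    have := h'.le_of_subset (h2.trans ((part_mono _ (Iio_subset_Iio (not_lt.1 hle))).trans h1))
    omega
  obtain ⟨y, hy, hyb⟩ := h'.exists_bound (1 + m n')
  have hbd : ∃ y ∈ D, part Z' (Iio (1 + m n')) ⊆ Iic y := ⟨y, hX hy, fun x hx => (hyb hx).le⟩
  have hbd3 : ∃ y ∈ D, part Z (Iio n') ⊆ Iic y := ⟨y, hX hy, fun x hx => (hyb (h3 hx)).le⟩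
  have d13 := hv.diff hX hc (h.isInitial n) (h'.isInitial (1 + m n)) (h.isInitial n') h1
    (hstep.trans h2) hbd3
  have d24 := hv.diff hX hc (h'.isInitial (1 + m n)) (h.isInitial n') (h'.isInitial (1 + m n'))
    (hstep.trans h2) h3 hbd
  have d02 := hv.diff hX hc (B₁ := ∅) ⟨empty_subset _, fun _ _ _ h => h.elim⟩ (h.isInitial n)
    (h'.isInitial (1 + m n)) (empty_subset _) h1
    ⟨y, hX hy, fun x hx => (hyb (h3 (h2 (hstep hx)))).le⟩
  have hn : v (part Z' (Iio (1 + m n)) \ part Z (Iio n)) = s := hn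
  have hn' : v (part Z' (Iio (1 + m n')) \ part Z (Iio n')) = s := hn'
  obtain ⟨k, hk⟩ : ∃ k, n + (k + 1) = n' := ⟨n' - n - 1, by omega⟩
  obtain ⟨l, hl⟩ : ∃ l, 1 + m n + (l + 1) = 1 + m n' := ⟨m n' - m n - 1, by omega⟩
  obtain ⟨j, hj⟩ : ∃ j, 1 + j = n := ⟨n - 1, by omega⟩
  have p1 := h.apply_Iio hv he hX hc j
  have p13 := h.apply_diff hv he hX hc hn1 (k + 1)
  have p24 := h'.apply_diff hv he hX hc (show 1 ≤ 1 + m n by omega) (l + 1)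
  rw [hj] at p1
  rw [hk] at p13
  rw [hl] at p24
  rw [sdiff_empty, sdiff_empty, hn, h'.apply_Iio hv he hX hc, p1] at d02
  rw [hn, p13] at d13
  rw [hn', p24] at d24
  -- With `t` the value of the stretch from the end of the first overhang to the cut `n'`, a power
  -- of `e` is `s t` and a power of `e'` is `t s`, so `e^τ = (st)^τ = s (ts)^τ = s e'^τ`.
  have key : A.tauExt e = s * A.tauExt e' := by
    rw [← A.tauExt_pow e k, d13, A.tauExt_mul, ← d24, A.tauExt_pow]
  calc v (Z 0) * A.tauExt e = v (Z 0) * (e ^ j * A.tauExt e) := by rw [A.pow_mul_tauExt]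
    _ = v (Z 0) * e ^ j * s * A.tauExt e' := by rw [key]; simp only [mul_assoc]
    _ = v (Z' 0) * A.tauExt e' := by rw [← d02, mul_assoc, A.pow_mul_tauExt]

end OmegaDecomp

open Classical in
/-- The valuation of a set `D` without greatest element, extending a valuation of its bounded
subsets. -/
noncomputable def omegaVal (v : Set W → A.Ext) (D X : Set W) : A.Ext :=
  if ∃ y ∈ D, X ⊆ Iic y then v X
  -- `value_unique` makes the choice of decomposition immaterial, and `exists_omegaDecomp` supplies
  -- one for each unbounded convex `X ⊆ D` when `D` is nonempty, so the default `1` plays no role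
  -- there.
  else if h : ∃ c Z e, OmegaDecomp v X Z e ∧ c = v (Z 0) * A.tauExt e then h.choose else 1

theorem omegaVal_of_bdd {X : Set W} (h : ∃ y ∈ D, X ⊆ Iic y) : omegaVal v D X = v X := if_pos h

theorem omegaVal_of_not_bdd [Finite S] {X : Set W} (h : ¬ ∃ y ∈ D, X ⊆ Iic y) {Z : ℕ → Set W}
    {e : A.Ext} (hZ : OmegaDecomp v X Z e) (hv : RespMulBdd D v) (he : v ∅ = 1) (hX : X ⊆ D)
    (hc : X.OrdConnected) : omegaVal v D X = v (Z 0) * A.tauExt e := by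
  have hex : ∃ c Z e, OmegaDecomp v X Z e ∧ c = v (Z 0) * A.tauExt e := ⟨_, Z, e, hZ, rfl⟩
  rw [omegaVal, if_neg h, dif_pos hex]
  obtain ⟨Z', e', hZ', h'⟩ := hex.choose_spec
  rw [h', hZ.value_unique hZ' hv he hX hc]

theorem exists_omegaDecomp [Finite S] [Countable W] (v : Set W → A.Ext) {X : Set W} (hX : X ⊆ D)
    (hc : X.OrdConnected) (hn : D.Nonempty) (h : ¬ ∃ y ∈ D, X ⊆ Iic y) :
    ∃ Z e, OmegaDecomp v X Z e := by
  push Not at h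
  have hne : X.Nonempty := by
    obtain ⟨y, hy⟩ := hn
    obtain ⟨x, hx, -⟩ := not_subset.1 (h y hy)
    exact ⟨x, hx⟩
  obtain ⟨Z, e, h1, h2, h3, h4⟩ := exists_monochromatic_chain v hc hne fun x hx => by
    obtain ⟨y, hy, hlt⟩ := not_subset.1 (h x (hX hx))
    exact ⟨y, hy, not_le.1 hlt⟩
  exact ⟨Z, e, h1, h2, h3, h4⟩

/-- A nonempty `Y` bounds `X`, so only `Y` and the union can be unbounded. Enlarging the first block
of a decomposition of `Y` by `X` leaves the later values unchanged. -/
theorem respMul_omegaVal [Finite S] [Countable W] (hn : D.Nonempty) (hv : RespMulBdd D v)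
    (he : v ∅ = 1) : RespMul A D (omegaVal v D) where
  empty := by
    obtain ⟨y, hy⟩ := hn
    rw [omegaVal_of_bdd ⟨y, hy, empty_subset _⟩, he]
  mul X Y hXY hc hD := by
    obtain ⟨y₀, hy₀⟩ := hn
    rcases Y.eq_empty_or_nonempty with rfl | ⟨y, hy⟩
    · rw [union_empty, omegaVal_of_bdd (X := ∅) ⟨y₀, hy₀, empty_subset _⟩, he, mul_one]
    have hXb : ∃ y ∈ D, X ⊆ Iic y := ⟨y, hD (Or.inr hy), fun x hx => (hXY x hx y hy).le⟩
    by_cases hb : ∃ y ∈ D, X ∪ Y ⊆ Iic y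
    · have hYb : ∃ y ∈ D, Y ⊆ Iic y := hb.imp fun y h => ⟨h.1, subset_union_right.trans h.2⟩
      rw [omegaVal_of_bdd hb, omegaVal_of_bdd hXb, omegaVal_of_bdd hYb, hv X Y hXY hc hD hb]
    have hYb : ¬ ∃ y ∈ D, Y ⊆ Iic y := by
      rintro ⟨z, hz, hYz⟩
      exact hb ⟨z, hz, union_subset (fun x hx => (hXY x hx y hy).le.trans (hYz hy)) hYz⟩
    have hYD := subset_union_right.trans hD
    have hYc := hXY.ordConnected_right hc
    obtain ⟨Z, e, hZ⟩ := exists_omegaDecomp v hYD hYc ⟨y₀, hy₀⟩ hYb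
    let Z' : ℕ → Set W := fun n => Nat.casesOn n (X ∪ Z 0) fun n => Z (n + 1)
    have hU : (⋃ n, Z' n) = X ∪ Y := by
      rw [← hZ.iUnion_eq]
      ext x
      simp only [mem_iUnion, mem_union]
      constructor
      · rintro ⟨_ | n, hn⟩
        · exact hn.imp id fun h => ⟨0, h⟩
        · exact Or.inr ⟨n + 1, hn⟩
      · rintro (hx | ⟨_ | n, hn⟩)
        exacts [⟨0, Or.inl hx⟩, ⟨0, Or.inr hn⟩, ⟨n + 1, hn⟩]
    have hZ' : OmegaDecomp v (X ∪ Y) Z' e := by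
      refine ⟨⟨?_, by rwa [hU], hU.subset⟩, hU, ?_, hZ.apply_succ⟩
      · rintro (_ | i) (_ | j) hij x hx z hz
        · omega
        · rcases hx with hx | hx
          · exact hXY x hx z (hZ.chain.apply_subset _ hz)
          · exact hZ.chain.before 0 (j + 1) hij x hx z hz
        · omega
        · exact hZ.chain.before (i + 1) (j + 1) hij x hx z hz
      · rintro (_ | n)
        · exact (hZ.nonempty 0).mono subset_union_right
        · exact hZ.nonempty (n + 1)
    rw [omegaVal_of_not_bdd hb hZ' hv he hD hc, omegaVal_of_bdd hXb,
      omegaVal_of_not_bdd hYb hZ hv he hYD hYc, ← mul_assoc]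
    congr 1
    obtain ⟨z, hz⟩ := hZ.nonempty 1
    have hcZ : (X ∪ Z 0).OrdConnected := by
      have := hZ'.chain.ordConnected_apply 0
      exact this
    refine hv X (Z 0) (hXY.mono Subset.rfl (hZ.chain.apply_subset 0)) hcZ
      ((hZ'.chain.apply_subset 0).trans hD) ⟨z, hYD (hZ.chain.apply_subset 1 hz), fun x hx =>
        (hZ'.chain.before 0 1 Nat.zero_lt_one x hx z hz).le⟩

theorem respNonempty_omegaVal [Finite S] [Countable W] (hn : D.Nonempty) (hv : RespMulBdd D v)
    (he : v ∅ = 1) (hne : ∀ y ∈ D, RespNonempty A (D ∩ Iic y) v) :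
    RespNonempty A D (omegaVal v D) := by
  intro X hX hc hXn
  by_cases hb : ∃ y ∈ D, X ⊆ Iic y
  · obtain ⟨y, hy, hle⟩ := hb
    rw [omegaVal_of_bdd ⟨y, hy, hle⟩]
    exact hne y hy X (subset_inter hX hle) hc hXn
  · obtain ⟨Z, e, hZ⟩ := exists_omegaDecomp v hX hc hn hb
    rw [omegaVal_of_not_bdd hb hZ hv he hX hc]
    obtain ⟨y, hy⟩ := hZ.nonempty 1
    exact OplusAlgebra.mul_ne_one_left (hne y (hX (hZ.chain.apply_subset 1 hy)) _
      (subset_inter ((hZ.chain.apply_subset 0).trans hX)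
        fun x hx => (hZ.chain.before 0 1 Nat.zero_lt_one x hx y hy).le)
      (hZ.chain.ordConnected_apply 0) (hZ.nonempty 0))

/-- If the union is unbounded, the terms are nonempty and each is bounded by the next, so the
sequence is itself a decomposition; its value is `a · a^τ = a^τ`. -/
theorem respTau_omegaVal [Finite S] [Countable W] (hn : D.Nonempty) (hv : RespMulBdd D v)
    (he : v ∅ = 1) (hne : ∀ y ∈ D, RespNonempty A (D ∩ Iic y) v)
    (ht : ∀ y ∈ D, RespTau A (D ∩ Iic y) v) : RespTau A D (omegaVal v D) := by
  intro X a hX ha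
  have hm := respMul_omegaVal hn hv he
  by_cases hb : ∃ y ∈ D, (⋃ n, X n) ⊆ Iic y
  · obtain ⟨y, hy, hle⟩ := hb
    rw [omegaVal_of_bdd ⟨y, hy, hle⟩]
    refine ht y hy X a (hX.mono (subset_inter hX.subset hle)) fun n => ?_
    rw [← ha n, omegaVal_of_bdd ⟨y, hy, (subset_iUnion X n).trans hle⟩]
  · by_cases ha1 : ∃ n, X n = ∅
    · obtain ⟨n, hn'⟩ := ha1
      have h1 : a = 1 := by rw [← ha n, hn', hm.empty]
      exfalso
      obtain ⟨y, hy⟩ := hn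
      refine hb ⟨y, hy, ?_⟩
      rw [iUnion_eq_empty.2]
      · exact empty_subset _
      · intro m
        by_contra hm'
        exact respNonempty_omegaVal ⟨y, hy⟩ hv he hne (X m) (hX.apply_subset m)
          (hX.ordConnected_apply m) (nonempty_iff_ne_empty.2 hm') ((ha m).trans h1)
    · push Not at ha1
      have hXb : ∀ n, ∃ y ∈ D, X n ⊆ Iic y := fun n => by
        obtain ⟨y, hy⟩ := ha1 (n + 1)
        exact ⟨y, hX.apply_subset _ hy, fun x hx => (hX.before n (n + 1) (by omega) x hx y hy).le⟩
      have hdec : OmegaDecomp v (⋃ n, X n) X a :=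
        ⟨hX.mono Subset.rfl, rfl, ha1, fun n => by rw [← ha (n + 1), omegaVal_of_bdd (hXb _)]⟩
      rw [omegaVal_of_not_bdd hb hdec hv he hX.subset hX.ordConnected, ← omegaVal_of_bdd (v := v) (hXb 0),
        ha, A.mul_tauExt]

/-- In an `ω*`-sequence only the rightmost term can be unbounded, and it can be dropped. -/
theorem respTauOp_omegaVal [Finite S] [Countable W] (hn : D.Nonempty) (hv : RespMulBdd D v)
    (he : v ∅ = 1) (hne : ∀ y ∈ D, RespNonempty A (D ∩ Iic y) v)
    (ht : ∀ y ∈ D, RespTauOp A (D ∩ Iic y) v) : RespTauOp A D (omegaVal v D) := by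
  intro X a hX ha
  have hm := respMul_omegaVal hn hv he
  rcases (X (OrderDual.toDual 0)).eq_empty_or_nonempty with h0 | ⟨y, hy⟩
  · have h1 : a = 1 := by rw [← ha (OrderDual.toDual 0), h0, hm.empty]
    have hall : ∀ n, X n = ∅ := by
      intro m
      by_contra hm'
      exact respNonempty_omegaVal hn hv he hne (X m) (hX.apply_subset m)
        (hX.ordConnected_apply m) (nonempty_iff_ne_empty.2 hm') ((ha m).trans h1)
    rw [iUnion_eq_empty.2 hall, hm.empty, h1, A.tauOpExt_one]
  · have hyD := hX.apply_subset _ hy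
    have hle : ∀ n : ℕᵒᵈ, X (OrderDual.toDual (1 + OrderDual.ofDual n)) ⊆ Iic y := fun n x hx =>
      (hX.before _ (OrderDual.toDual 0) (show 0 < 1 + OrderDual.ofDual n by omega) x hx y hy).le
    refine hm.tauOp_of_tail hX ha 1 ?_
    rw [omegaVal_of_bdd ⟨y, hyD, iUnion_subset hle⟩]
    refine ht y hyD _ a ((hX.shiftOp 1).mono
      (subset_inter (hX.shiftOp 1).subset (iUnion_subset hle))) fun n => ?_
    rw [← ha (OrderDual.toDual (1 + OrderDual.ofDual n)), omegaVal_of_bdd ⟨y, hyD, hle n⟩]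

theorem respKappa_omegaVal [Finite S] [Countable W] (hn : D.Nonempty) (hv : RespMulBdd D v)
    (he : v ∅ = 1) (hne : ∀ y ∈ D, RespNonempty A (D ∩ Iic y) v)
    (ht : ∀ y ∈ D, RespTau A (D ∩ Iic y) v) (hk : ∀ y ∈ D, RespKappa A (D ∩ Iic y) v) :
    RespKappa A D (omegaVal v D) := by
  intro Q _ _ X P hX hP
  have hm := respMul_omegaVal hn hv he
  have hP' : Shuffled A P.1 fun q => omegaVal v D (part X {q}) := by
    simpa only [part_singleton] using hP
  rw [← part_univ]
  refine kap_of_omega (hm.comp hX) ((respTau_omegaVal hn hv he hne ht).comp hX) hP'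
    isOpenInterval_univ ?_
  rintro K - hK ⟨b, -, hb⟩
  obtain ⟨c, hc⟩ := exists_gt b
  have hXc : (X c).Nonempty := by
    rw [nonempty_iff_ne_empty]
    intro h0
    obtain ⟨a, -, ha⟩ := hP.mem c
    rw [h0, hm.empty] at ha
    exact A.inj_ne_one a ha.symm
  obtain ⟨y, hy⟩ := hXc
  have hyD := hX.apply_subset c hy
  have hsub : part X K ⊆ Iic y := fun x hx => by
    obtain ⟨q, hq, hx⟩ := mem_part.1 hx
    exact (hX.before q c ((hb hq).trans_lt hc) x hx y hy).le
  have := hK.etaOrder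
  rw [omegaVal_of_bdd ⟨y, hyD, hsub⟩]
  have hXK : ∀ q : K, ∃ y ∈ D, X q ⊆ Iic y := fun q =>
    ⟨y, hyD, (subset_part X q.2).trans hsub⟩
  have hsub' := subset_inter (hX.part_subset K) hsub
  rw [part_eq_iUnion] at hsub' ⊢
  refine hk y hyD K (fun q => X q) P ((hX.restrict hK.ordConnected).mono hsub') ?_
  have := hP.restrict hK.ordConnected
  simpa only [fun q : K => omegaVal_of_bdd (v := v) (hXK q)] using this

/-- A set without greatest element is good if its bounded initial segments are. -/
theorem Good.omega [Finite S] [Countable W] {f : W → S} (hn : D.Nonempty)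
    (h : ∀ y ∈ D, Good A f (D ∩ Iic y)) : Good A f D := by
  have hval : ∀ y ∈ D, IsVal A (D ∩ Iic y) (canon A f) f := fun y hy => (h y hy).isVal_canon
  have he : canon A f ∅ = 1 := by
    obtain ⟨y, hy⟩ := hn
    exact (hval y hy).respMul.empty
  have hv : RespMulBdd D (canon A f) := by
    rintro X Y hXY hc' hD ⟨y, hy, hle⟩
    exact (hval y hy).respMul.mul X Y hXY hc' (subset_inter hD hle)
  refine ⟨omegaVal (canon A f) D, ⟨?_, ?_, respMul_omegaVal hn hv he, ?_, ?_, ?_⟩, ?_⟩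
  · exact respNonempty_omegaVal hn hv he fun y hy => (hval y hy).respNonempty
  · intro x hx
    rw [omegaVal_of_bdd ⟨x, hx, singleton_subset_iff.2 (mem_Iic.2 le_rfl)⟩]
    exact (hval x hx).single x ⟨hx, le_rfl⟩
  · exact respTau_omegaVal hn hv he (fun y hy => (hval y hy).respNonempty)
      fun y hy => (hval y hy).respTau
  · exact respTauOp_omegaVal hn hv he (fun y hy => (hval y hy).respNonempty)
      fun y hy => (hval y hy).respTauOp
  · exact respKappa_omegaVal hn hv he (fun y hy => (hval y hy).respNonempty)
      (fun y hy => (hval y hy).respTau) fun y hy => (hval y hy).respKappa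
  · intro X hX hcX G hG
    by_cases hb : ∃ y ∈ D, X ⊆ Iic y
    · obtain ⟨y, hy, hle⟩ := hb
      rw [omegaVal_of_bdd ⟨y, hy, hle⟩]
      exact (h y hy).eq_canon (subset_inter hX hle) hcX hG
    -- Uniqueness: a valuation `G` agrees with `canon` on the bounded blocks, and its compatibility
    -- with `·` and `τ` fixes it on the union.
    · obtain ⟨Z, e, hZ⟩ := exists_omegaDecomp (canon A f) hX hcX hn hb
      have hGZ : ∀ n, G (Z n) = canon A f (Z n) := fun n => by
        obtain ⟨y, hy⟩ := hZ.nonempty (n + 1)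
        exact (h y (hX (hZ.chain.apply_subset _ hy))).eq_canon
          (subset_inter ((hZ.chain.apply_subset n).trans hX)
            fun x hx => (hZ.chain.before n (n + 1) (by omega) x hx y hy).le)
          (hZ.chain.ordConnected_apply n) (hG.mono (hZ.chain.apply_subset n))
      rw [omegaVal_of_not_bdd hb hZ hv he hX hcX]
      have h1 := hG.respMul.iUnion_nat hZ.chain 1
      have h2 := hG.respTau _ e (hZ.chain.shift 1) fun n => by
        rw [hGZ, Nat.add_comm, hZ.apply_succ]
      have h3 : Iio 1 = ({0} : Set ℕ) := by ext; simp
      rw [hZ.iUnion_eq, ← iUnion_shift, h2, h3, part_singleton, hGZ] at h1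
      exact h1

/-- A set without least element is good if its bounded final segments are. -/
theorem Good.omegaOp [Finite S] [Countable W] {f : W → S} (hn : D.Nonempty)
    (h : ∀ y ∈ D, Good A f (D ∩ Ici y)) : Good A f D :=
  have : Countable Wᵒᵈ := inferInstanceAs (Countable W)
  Good.of_dual (Good.omega (W := Wᵒᵈ) (A := A.op) hn fun y hy => (h y hy).dual)

end Omega

/-! ### First block, full blocks and last block of a convex set -/

section Touch

variable {W J : Type*} {U : J → Set W} {X Y : Set W}

/-- The indices of the members of a family that meet `X`. -/
def touch (U : J → Set W) (X : Set W) : Set J := {i | (X ∩ U i).Nonempty}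

theorem touch_union (U : J → Set W) (X Y : Set W) : touch U (X ∪ Y) = touch U X ∪ touch U Y := by
  ext i
  simp only [touch, mem_ofPred_eq, mem_union, union_inter_distrib_right, union_nonempty]

theorem touch_mono (U : J → Set W) (h : X ⊆ Y) : touch U X ⊆ touch U Y :=
  fun _ hi => hi.mono (inter_subset_inter_left _ h)

variable [LinearOrder J]

/-- The indices that lie strictly between two indices of members of a family that meet `X`. -/
def midTouch (U : J → Set W) (X : Set W) : Set J :=
  {i | (∃ a ∈ touch U X, a < i) ∧ ∃ b ∈ touch U X, i < b}

/-- The first block of `X`, if there is one. -/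
def firstBlock (U : J → Set W) (X : Set W) : Set W := X ∩ part U {i | IsLeast (touch U X) i}

/-- The last block of `X`, if there is one. -/
def lastBlock (U : J → Set W) (X : Set W) : Set W := X ∩ part U {i | IsGreatest (touch U X) i}

theorem firstBlock_of_isLeast {i : J} (h : IsLeast (touch U X) i) : firstBlock U X = X ∩ U i := by
  have : {i | IsLeast (touch U X) i} = {i} := by
    ext j
    exact ⟨fun hj => hj.unique h, fun hj => by rw [mem_singleton_iff.1 hj]; exact h⟩
  rw [firstBlock, this, part_singleton]

theorem firstBlock_of_not (h : ¬ ∃ i, IsLeast (touch U X) i) : firstBlock U X = ∅ := by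
  have : {i | IsLeast (touch U X) i} = ∅ := by
    ext j
    exact ⟨fun hj => h ⟨j, hj⟩, fun hj => hj.elim⟩
  rw [firstBlock, this, part_empty, inter_empty]

theorem lastBlock_of_isGreatest {i : J} (h : IsGreatest (touch U X) i) :
    lastBlock U X = X ∩ U i :=
  firstBlock_of_isLeast (J := Jᵒᵈ) h

theorem lastBlock_of_not (h : ¬ ∃ i, IsGreatest (touch U X) i) : lastBlock U X = ∅ :=
  firstBlock_of_not (J := Jᵒᵈ) h

theorem exists_touch_lt (hX : X ⊆ ⋃ i, U i) [Nonempty J] (hbig : ¬ ∃ i, X ⊆ U i) :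
    ∃ i ∈ touch U X, ∃ j ∈ touch U X, i < j := by
  push Not at hbig
  obtain ⟨i₀⟩ := ‹Nonempty J›
  obtain ⟨x, hx, -⟩ := not_subset.1 (hbig i₀)
  obtain ⟨i, hi⟩ := mem_iUnion.1 (hX hx)
  obtain ⟨y, hy, hyi⟩ := not_subset.1 (hbig i)
  obtain ⟨j, hj⟩ := mem_iUnion.1 (hX hy)
  rcases lt_trichotomy i j with h | h | h
  · exact ⟨i, ⟨x, hx, hi⟩, j, ⟨y, hy, hj⟩, h⟩
  · exact absurd (h ▸ hj) hyi
  · exact ⟨j, ⟨y, hy, hj⟩, i, ⟨x, hx, hi⟩, h⟩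

theorem isOpenInterval_midTouch [DenselyOrdered J] {i j : J} (hi : i ∈ touch U X)
    (hj : j ∈ touch U X) (hij : i < j) : IsOpenInterval (midTouch U X) where
  ordConnected := ⟨fun _ hx _ hy _ hz =>
    ⟨hx.1.imp fun _ h => ⟨h.1, h.2.trans_le hz.1⟩, hy.2.imp fun _ h => ⟨h.1, hz.2.trans_lt h.2⟩⟩⟩
  nonempty := by
    obtain ⟨m, h1, h2⟩ := exists_between hij
    exact ⟨m, ⟨i, hi, h1⟩, j, hj, h2⟩
  exists_gt x hx := by
    obtain ⟨b, hb, hxb⟩ := hx.2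
    obtain ⟨m, h1, h2⟩ := exists_between hxb
    exact ⟨m, ⟨hx.1.imp fun _ h => ⟨h.1, h.2.trans h1⟩, b, hb, h2⟩, h1⟩
  exists_lt x hx := by
    obtain ⟨a, ha, hax⟩ := hx.1
    obtain ⟨m, h1, h2⟩ := exists_between hax
    exact ⟨m, ⟨⟨a, ha, h1⟩, hx.2.imp fun _ h => ⟨h.1, h2.trans h.2⟩⟩, h2⟩

variable [LinearOrder W] {D : Set W}

theorem Chain.touch_le (hU : Chain D U) (hXY : Before X Y) {i j : J} (hi : i ∈ touch U X) (hj : j ∈ touch U Y) :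
    i ≤ j := by
  obtain ⟨x, hx, hxi⟩ := hi
  obtain ⟨y, hy, hyj⟩ := hj
  exact hU.le_of_le hxi hyj (hXY x hx y hy).le

theorem Chain.touch_eq (hU : Chain D U) {i j : J} (hX : X ⊆ U i) (hj : j ∈ touch U X) : j = i := by
  obtain ⟨x, hx, hxj⟩ := hj
  exact hU.eq_of_mem hxj (hX hx)

theorem Chain.apply_subset_of_mid (hU : Chain D U) (hc : X.OrdConnected) {i : J} (hi : i ∈ midTouch U X) :
    U i ⊆ X := by
  obtain ⟨⟨a, ⟨x, hx, hxa⟩, hai⟩, b, ⟨y, hy, hyb⟩, hib⟩ := hi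
  exact fun z hz => hc.out hx hy
    ⟨(hU.before a i hai x hxa z hz).le, (hU.before i b hib z hz y hyb).le⟩

theorem Chain.not_subset_of_touch_lt (hU : Chain D U) {i j : J} (hi : i ∈ touch U X) (hj : j ∈ touch U X)
    (hij : i < j) : ¬ ∃ i, X ⊆ U i := by
  rintro ⟨k, hk⟩
  exact hij.ne ((hU.touch_eq hk hi).trans (hU.touch_eq hk hj).symm)

/-- A convex set meeting two members of a chain consists of its first block, if any, a union of
members of the chain, and its last block, if any. -/
theorem Chain.apply_eq_mul (hU : Chain D U) {A : OplusAlgebra S} {G : Set W → A.Ext} (hX : X ⊆ ⋃ i, U i)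
    (hc : X.OrdConnected) {i j : J} (hi : i ∈ touch U X) (hj : j ∈ touch U X) (hij : i < j)
    (hG : RespMul A X G) :
    G X = G (firstBlock U X) * G (part U (midTouch U X)) * G (lastBlock U X) := by
  have hm : part U (midTouch U X) ⊆ X := iUnion₂_subset fun i hi => hU.apply_subset_of_mid hc hi
  have b1 : Before (firstBlock U X) (part U (midTouch U X)) := by
    intro x hx y hy
    obtain ⟨k, hk, hxk⟩ := mem_part.1 hx.2
    obtain ⟨l, hl, hyl⟩ := mem_part.1 hy
    obtain ⟨a, ha, hal⟩ := hl.1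
    exact hU.before k l ((hk.2 ha).trans_lt hal) x hxk y hyl
  have b2 : Before (firstBlock U X ∪ part U (midTouch U X)) (lastBlock U X) := by
    intro x hx y hy
    obtain ⟨k, hk, hyk⟩ := mem_part.1 hy.2
    rcases hx with hx | hx
    · obtain ⟨l, hl, hxl⟩ := mem_part.1 hx.2
      exact hU.before l k ((hl.2 hi).trans_lt (hij.trans_le (hk.2 hj))) x hxl y hyk
    · obtain ⟨l, hl, hxl⟩ := mem_part.1 hx
      obtain ⟨b, hb, hlb⟩ := hl.2
      exact hU.before l k (hlb.trans_le (hk.2 hb)) x hxl y hyk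
  have e : firstBlock U X ∪ part U (midTouch U X) ∪ lastBlock U X = X := by
    apply Subset.antisymm
    · exact union_subset (union_subset inter_subset_left hm) inter_subset_left
    · intro x hx
      obtain ⟨k, hk⟩ := mem_iUnion.1 (hX hx)
      have hkt : k ∈ touch U X := ⟨x, hx, hk⟩
      by_cases h1 : ∃ a ∈ touch U X, a < k
      · by_cases h2 : ∃ b ∈ touch U X, k < b
        · exact Or.inl (Or.inr (mem_part.2 ⟨k, ⟨h1, h2⟩, hk⟩))
        · push Not at h2
          exact Or.inr ⟨hx, mem_part.2 ⟨k, ⟨hkt, h2⟩, hk⟩⟩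
      · push Not at h1
        exact Or.inl (Or.inl ⟨hx, mem_part.2 ⟨k, ⟨hkt, h1⟩, hk⟩⟩)
  have c2 : (firstBlock U X ∪ part U (midTouch U X) ∪ lastBlock U X).OrdConnected := by rwa [e]
  have h2 := hG.mul _ _ b2 c2 e.subset
  have h1 := hG.mul _ _ b1 (b2.ordConnected_left c2) (subset_union_left.trans e.subset)
  rw [e, h1] at h2
  exact h2

end Touch

/-! ### The valuation of a shuffle: products and `ω`-powers -/

section ShuffleVal

variable {W J : Type*} [LinearOrder J] {A : OplusAlgebra S}

open Classical in
/-- The valuation of a shuffle `⋃ i, U i` extending a valuation of its blocks `U i`, where `k` is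
the value of the shuffle. -/
noncomputable def shuffleVal (v : Set W → A.Ext) (U : J → Set W) (k : A.Ext) (X : Set W) : A.Ext :=
  -- A convex `X` meeting two blocks contains all the blocks strictly between touched ones. When `J`
  -- is dense, their indices form an open interval, again a shuffle of value `k`.
  if ∃ i, X ⊆ U i then v X else v (firstBlock U X) * k * v (lastBlock U X)

variable {v : Set W → A.Ext} {U : J → Set W} {X Y D : Set W}
  {P : {P : Set S // P.Nonempty}} {k : A.Ext}

theorem shuffleVal_of_subset {i : J} (h : X ⊆ U i) : shuffleVal v U k X = v X := if_pos ⟨i, h⟩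

theorem shuffleVal_of_not_subset (h : ¬ ∃ i, X ⊆ U i) :
    shuffleVal v U k X = v (firstBlock U X) * k * v (lastBlock U X) := if_neg h

theorem shuffleVal_dual (v : Set W → A.Ext) (U : J → Set W) (k : A.Ext) :
    shuffleVal (A := A.op) (W := Wᵒᵈ) (J := Jᵒᵈ) v U k = shuffleVal v U k := by
  funext X
  by_cases h : ∃ i, X ⊆ U i
  · exact (if_pos h).trans (if_pos h).symm
  · refine ((if_neg h).trans ?_).trans (if_neg h).symm
    exact ((A.op_mul _ _).trans (congrArg (fun t : A.Ext => v (firstBlock U X) * t)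
      (A.op_mul (v (lastBlock U X)) k))).trans
      (mul_assoc (G := A.Ext) (v (firstBlock U X)) k (v (lastBlock U X))).symm

variable [LinearOrder W]

theorem Chain.firstBlock_union (hU : Chain D U) (hXY : Before X Y) {i j : J} (hi : i ∈ touch U X)
    (hj : j ∈ touch U X) (hij : i < j) : firstBlock U (X ∪ Y) = firstBlock U X := by
  have hiff : ∀ l, IsLeast (touch U (X ∪ Y)) l ↔ IsLeast (touch U X) l := by
    intro l
    rw [touch_union]
    constructor
    · rintro ⟨hl | hl, hle⟩
      · exact ⟨hl, fun m hm => hle (Or.inl hm)⟩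
      · exact absurd (hle (Or.inl hi)) (hij.trans_le (hU.touch_le hXY hj hl)).not_ge
    · rintro ⟨hl, hle⟩
      exact ⟨Or.inl hl, fun m hm => hm.elim (fun hm => hle hm) fun hm => hU.touch_le hXY hl hm⟩
  by_cases h : ∃ l, IsLeast (touch U X) l
  · obtain ⟨l, hl⟩ := h
    rw [firstBlock_of_isLeast hl, firstBlock_of_isLeast ((hiff l).2 hl), union_inter_distrib_right]
    have : Y ∩ U l = ∅ := by
      rw [← not_nonempty_iff_eq_empty]
      intro hY
      exact ((hl.2 hi).trans_lt hij).not_ge (hU.touch_le hXY hj hY)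
    rw [this, union_empty]
  · rw [firstBlock_of_not h, firstBlock_of_not (by simpa only [hiff] using h)]

theorem Chain.lastBlock_union (hU : Chain D U) (hXY : Before X Y) {i j : J} (hi : i ∈ touch U Y)
    (hj : j ∈ touch U Y) (hij : i < j) : lastBlock U (X ∪ Y) = lastBlock U Y := by
  rw [union_comm]
  exact Chain.firstBlock_union (W := Wᵒᵈ) (J := Jᵒᵈ) (D := D) (U := U) (chain_dual hU)
    (fun y hy x hx => hXY x hx y hy) hj hi hij

/-- If `Y` misses `U i`, it can have no first block: a block strictly between would lie in `X ∪ Y`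
but in neither set. -/
theorem Chain.apply_firstBlock_union (hU : Chain D U) [DenselyOrdered J] (hne : ∀ i, (U i).Nonempty)
    (hv : ∀ i, RespMul A (U i) v) (hXY : Before X Y) (hc : (X ∪ Y).OrdConnected) {i : J}
    (hX : X ⊆ U i) (hXn : X.Nonempty) :
    v (firstBlock U (X ∪ Y)) = v X * v (firstBlock U Y) := by
  have hi : i ∈ touch U X := by
    obtain ⟨x, hx⟩ := hXn
    exact ⟨x, hx, hX hx⟩
  have hleast : IsLeast (touch U (X ∪ Y)) i := by
    rw [touch_union]
    exact ⟨Or.inl hi, fun m hm => hm.elim (fun hm => (hU.touch_eq hX hm).ge)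
      fun hm => hU.touch_le hXY hi hm⟩
  have e : (X ∪ Y) ∩ U i = X ∪ Y ∩ U i := by rw [union_inter_distrib_right, inter_eq_left.2 hX]
  have hmul := (hv i).mul X (Y ∩ U i) (hXY.mono Subset.rfl inter_subset_left)
    (by rw [← e]; exact hc.inter (hU.ordConnected_apply i)) (by rw [← e]; exact inter_subset_right)
  rw [firstBlock_of_isLeast hleast, e, hmul]
  by_cases hiY : i ∈ touch U Y
  · rw [firstBlock_of_isLeast ⟨hiY, fun m hm => hU.touch_le hXY hi hm⟩]
  · have hempty : Y ∩ U i = ∅ := by rwa [← not_nonempty_iff_eq_empty]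
    have hno : ¬ ∃ j, IsLeast (touch U Y) j := by
      rintro ⟨j, hj, hle⟩
      have hij : i < j := lt_of_le_of_ne (hU.touch_le hXY hi hj) fun h => hiY (h ▸ hj)
      obtain ⟨m, h1, h2⟩ := exists_between hij
      obtain ⟨z, hz⟩ := hne m
      have hmid : m ∈ midTouch U (X ∪ Y) :=
        ⟨⟨i, touch_mono U subset_union_left hi, h1⟩, j, touch_mono U subset_union_right hj, h2⟩
      rcases hU.apply_subset_of_mid hc hmid hz with hzX | hzY
      · exact h1.ne' (hU.eq_of_mem hz (hX hzX))
      · exact h2.not_ge (hle ⟨z, hzY, hz⟩)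
    rw [firstBlock_of_not hno, hempty]

theorem Chain.apply_lastBlock_union (hU : Chain D U) [DenselyOrdered J] (hne : ∀ i, (U i).Nonempty)
    (hv : ∀ i, RespMul A (U i) v) (hXY : Before X Y) (hc : (X ∪ Y).OrdConnected) {i : J}
    (hY : Y ⊆ U i) (hYn : Y.Nonempty) :
    v (lastBlock U (X ∪ Y)) = v (lastBlock U X) * v Y := by
  have e : X ∪ Y = Y ∪ X := union_comm X Y
  rw [e] at hc ⊢
  exact (Chain.apply_firstBlock_union (W := Wᵒᵈ) (J := Jᵒᵈ) (A := A.op) (v := v) (D := D) (U := U)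
    (X := Y) (Y := X) (chain_dual hU) hne (fun i => (hv i).dual) (fun y hy x hx => hXY x hx y hy)
    hc.dual hY hYn).trans (A.op_mul _ _)

/-- The last block of a set and the first block of the next set make up at most one block. -/
theorem Chain.optMem_lastBlock_mul_firstBlock (hU : Chain D U) [DenselyOrdered J] (hne : ∀ i, (U i).Nonempty)
    (hv : ∀ i, RespMul A (U i) v) (he : v ∅ = 1) (hP : ∀ i, A.OptMem P (v (U i)))
    (hXY : Before X Y) (hc : (X ∪ Y).OrdConnected)
    {a b c d : J} (ha : a ∈ touch U X) (hb : b ∈ touch U X) (hab : a < b)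
    (hc' : c ∈ touch U Y) (hd : d ∈ touch U Y) (hcd : c < d) :
    A.OptMem P (v (lastBlock U X) * v (firstBlock U Y)) := by
  have hXs := touch_mono U (subset_union_left (s := X) (t := Y))
  have hYs := touch_mono U (subset_union_right (s := X) (t := Y))
  by_cases hi : ∃ i, IsGreatest (touch U X) i
  · obtain ⟨i, hi, hile⟩ := hi
    have hUi : U i ⊆ X ∪ Y := hU.apply_subset_of_mid hc
      ⟨⟨a, hXs ha, hab.trans_le (hile hb)⟩, d, hYs hd, (hU.touch_le hXY hi hc').trans_lt hcd⟩
    rw [lastBlock_of_isGreatest ⟨hi, hile⟩]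
    by_cases hiY : i ∈ touch U Y
    · rw [firstBlock_of_isLeast ⟨hiY, fun m hm => hU.touch_le hXY hi hm⟩]
      have e : X ∩ U i ∪ Y ∩ U i = U i := by
        rw [← union_inter_distrib_right]; exact inter_eq_right.2 hUi
      have := (hv i).mul (X ∩ U i) (Y ∩ U i) (hXY.mono inter_subset_left inter_subset_left)
        (by rw [e]; exact hU.ordConnected_apply i) e.subset
      rw [← this, e]
      exact hP i
    · have hempty : Y ∩ U i = ∅ := by rwa [← not_nonempty_iff_eq_empty]
      have e : X ∩ U i = U i := by
        apply inter_eq_right.2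
        intro z hz
        exact (hUi hz).resolve_right fun hzY => hiY ⟨z, hzY, hz⟩
      have hno : ¬ ∃ j, IsLeast (touch U Y) j := by
        rintro ⟨j, hj, hle⟩
        have hij : i < j := lt_of_le_of_ne (hU.touch_le hXY hi hj) fun h => hiY (h ▸ hj)
        obtain ⟨m, h1, h2⟩ := exists_between hij
        obtain ⟨z, hz⟩ := hne m
        rcases hU.apply_subset_of_mid hc ⟨⟨i, hXs hi, h1⟩, j, hYs hj, h2⟩ hz with hzX | hzY
        · exact h1.not_ge (hile ⟨z, hzX, hz⟩)
        · exact h2.not_ge (hle ⟨z, hzY, hz⟩)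
      rw [firstBlock_of_not hno, he, mul_one, e]
      exact hP i
  · rw [lastBlock_of_not hi, he, one_mul]
    by_cases hj : ∃ j, IsLeast (touch U Y) j
    · obtain ⟨j, hj, hjle⟩ := hj
      have hUj : U j ⊆ X ∪ Y := hU.apply_subset_of_mid hc
        ⟨⟨a, hXs ha, hab.trans_le (hU.touch_le hXY hb hj)⟩, d, hYs hd, (hjle hc').trans_lt hcd⟩
      have e : Y ∩ U j = U j := by
        apply inter_eq_right.2
        intro z hz
        exact (hUj hz).resolve_left fun hzX => hi ⟨j, ⟨z, hzX, hz⟩,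
          fun m hm => hU.touch_le hXY hm hj⟩
      rw [firstBlock_of_isLeast ⟨hj, hjle⟩, e]
      exact hP j
    · rw [firstBlock_of_not hj, he]
      exact Or.inl rfl

/-- When both sets meet two blocks, the pieces at the junction make up at most one block, of value
`x` in `P` or `1`, and `κ x κ = κ`. -/
theorem respMul_shuffleVal (hU : Chain D U) [DenselyOrdered J] [Nonempty J] (hne : ∀ i, (U i).Nonempty)
    (hv : ∀ i, RespMul A (U i) v) (hP : ∀ i, A.OptMem P (v (U i))) :
    RespMul A (⋃ i, U i) (shuffleVal v U (A.kap P)) := by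
  obtain ⟨i₀⟩ := ‹Nonempty J›
  have he : v ∅ = 1 := (hv i₀).empty
  have he' : shuffleVal v U (A.kap P) ∅ = 1 := by
    rw [shuffleVal_of_subset (empty_subset (U i₀)), he]
  refine ⟨he', fun X Y hXY hc hD => ?_⟩
  rcases X.eq_empty_or_nonempty with rfl | hXn
  · rw [he', empty_union, one_mul]
  rcases Y.eq_empty_or_nonempty with rfl | hYn
  · rw [he', union_empty, mul_one]
  have : Nonempty J := ⟨i₀⟩
  have hXs := touch_mono U (subset_union_left (s := X) (t := Y))
  have hYs := touch_mono U (subset_union_right (s := X) (t := Y))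
  by_cases hb : ∃ i, X ∪ Y ⊆ U i
  · obtain ⟨i, hi⟩ := hb
    rw [shuffleVal_of_subset hi, shuffleVal_of_subset (subset_union_left.trans hi),
      shuffleVal_of_subset (subset_union_right.trans hi), (hv i).mul X Y hXY hc hi]
  rw [shuffleVal_of_not_subset hb]
  by_cases hXb : ∃ i, X ⊆ U i
  · obtain ⟨i, hi⟩ := hXb
    rw [shuffleVal_of_subset hi, hU.apply_firstBlock_union hne hv hXY hc hi hXn]
    have hYb : ¬ ∃ j, Y ⊆ U j := by
      rintro ⟨j, hj⟩
      obtain ⟨x, hx⟩ := hXn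
      obtain ⟨y, hy⟩ := hYn
      rcases (hU.touch_le hXY ⟨x, hx, hi hx⟩ ⟨y, hy, hj hy⟩).eq_or_lt with rfl | hij
      · exact hb ⟨i, union_subset hi hj⟩
      · obtain ⟨m, h1, h2⟩ := exists_between hij
        obtain ⟨z, hz⟩ := hne m
        rcases hU.apply_subset_of_mid hc ⟨⟨i, hXs ⟨x, hx, hi hx⟩, h1⟩, j, hYs ⟨y, hy, hj hy⟩, h2⟩ hz
          with hzX | hzY
        · exact h1.ne' (hU.eq_of_mem hz (hi hzX))
        · exact h2.ne (hU.eq_of_mem hz (hj hzY))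
    obtain ⟨c, hc', d, hd, hcd⟩ := exists_touch_lt (subset_union_right.trans hD) hYb
    rw [shuffleVal_of_not_subset hYb, hU.lastBlock_union hXY hc' hd hcd]
    simp only [mul_assoc]
  obtain ⟨a, ha, b, hb', hab⟩ := exists_touch_lt (subset_union_left.trans hD) hXb
  rw [hU.firstBlock_union hXY ha hb' hab, shuffleVal_of_not_subset hXb]
  by_cases hYb : ∃ j, Y ⊆ U j
  · obtain ⟨j, hj⟩ := hYb
    rw [shuffleVal_of_subset hj, hU.apply_lastBlock_union hne hv hXY hc hj hYn]
    simp only [mul_assoc]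
  · obtain ⟨c, hc', d, hd, hcd⟩ := exists_touch_lt (subset_union_right.trans hD) hYb
    rw [shuffleVal_of_not_subset hYb, hU.lastBlock_union hXY hc' hd hcd]
    have := (hU.optMem_lastBlock_mul_firstBlock hne hv he hP hXY hc ha hb' hab hc' hd hcd
      ).kap_mul_mul_kap
    calc _ = v (firstBlock U X) * (A.kap P * (v (lastBlock U X) * v (firstBlock U Y)) * A.kap P) *
          v (lastBlock U Y) := by rw [this]
      _ = _ := by simp only [mul_assoc]

/-- Unless the sequence ends in one block, its tails have no last block. Two tails with equal
first-block value `s` give `a^n = s κ z` with `z s` in `P` or `1`, and `(sκz)^τ = s (κzs)^τ = sκ`,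
the value of the tail. -/
theorem respTau_shuffleVal (hU : Chain D U) [Finite S] [DenselyOrdered J] [Nonempty J] (hne : ∀ i, (U i).Nonempty)
    (hv : ∀ i, RespMul A (U i) v) (hP : ∀ i, A.OptMem P (v (U i))) (ht : ∀ i, RespTau A (U i) v) :
    RespTau A (⋃ i, U i) (shuffleVal v U (A.kap P)) := by
  intro X a hX ha
  have hm := respMul_shuffleVal hU hne hv hP
  have he : v ∅ = 1 := (hv (Classical.arbitrary J)).empty
  by_cases hs : ∃ i m, ∀ n, X (m + n) ⊆ U i
  · obtain ⟨i, m, hi⟩ := hs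
    refine hm.tau_of_tail hX ha m ?_
    rw [shuffleVal_of_subset (iUnion_subset hi)]
    refine ht i _ a ((hX.shift m).mono (iUnion_subset hi)) fun n => ?_
    rw [← ha (m + n), shuffleVal_of_subset (hi n)]
  push Not at hs
  let tail : ℕ → Set W := fun m => part X (Ici m)
  have htail : ∀ m, ⋃ n, X (m + n) = tail m := iUnion_shift X
  have hbig : ∀ m, ∃ i ∈ touch U (tail m), ∃ j ∈ touch U (tail m), i < j := by
    intro m
    refine exists_touch_lt (hX.part_subset _) ?_
    rintro ⟨i, hi⟩
    obtain ⟨n, hn⟩ := hs i m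
    exact hn ((subset_part X (show m ≤ m + n by omega)).trans hi)
  -- A last touched block would contain all later terms of the sequence, contrary to `hs`.
  have hlast : ∀ m, v (lastBlock U (tail m)) = 1 := by
    intro m
    rw [lastBlock_of_not, he]
    rintro ⟨j, ⟨x, hx, hxj⟩, hle⟩
    obtain ⟨n, hn, hxn⟩ := mem_part.1 hx
    have hn : m ≤ n := hn
    obtain ⟨l, hl⟩ := hs j (n + 1)
    apply hl
    intro y hy
    obtain ⟨i, hi⟩ := mem_iUnion.1 (hX.apply_subset _ hy)
    have h1 := hU.le_of_le hxj hi (hX.before n (n + 1 + l) (by omega) x hxn y hy).le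
    have h2 := hle (show i ∈ touch U (tail m) from
      ⟨y, mem_part.2 ⟨n + 1 + l, show m ≤ n + 1 + l by omega, hy⟩, hi⟩)
    rwa [le_antisymm h1 h2]
  have hval : ∀ m, shuffleVal v U (A.kap P) (tail m) = v (firstBlock U (tail m)) * A.kap P := by
    intro m
    obtain ⟨i, hi, j, hj, hij⟩ := hbig m
    rw [shuffleVal_of_not_subset (hU.not_subset_of_touch_lt hi hj hij), hlast, mul_one]
  obtain ⟨s, hs'⟩ := Finite.exists_infinite_fiber fun m => v (firstBlock U (tail m))
  rw [Set.infinite_coe_iff] at hs'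
  obtain ⟨m, hsm⟩ := hs'.nonempty
  obtain ⟨i, hi, j, hj, hij⟩ := hbig m
  obtain ⟨x, hx, hxi⟩ := hi
  obtain ⟨y, hy, hyj⟩ := hj
  obtain ⟨p, hp, hxp⟩ := mem_part.1 hx
  obtain ⟨q, hq, hyq⟩ := mem_part.1 hy
  -- Going beyond both `p` and `q` makes the stretch from `m` to `m'` meet two blocks.
  obtain ⟨m', hsm', hm'⟩ := hs'.exists_gt (max p q)
  have hpm : p < m' := (le_max_left p q).trans_lt hm'
  have hqm : q < m' := (le_max_right p q).trans_lt hm'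
  have hmm : m < m' := lt_of_le_of_lt hp hpm
  have hsm : v (firstBlock U (tail m)) = s := hsm
  have hsm' : v (firstBlock U (tail m')) = s := hsm'
  let block : Set W := part X (Ico m m')
  have hbi : i ∈ touch U block := ⟨x, mem_part.2 ⟨p, ⟨hp, hpm⟩, hxp⟩, hxi⟩
  have hbj : j ∈ touch U block := ⟨y, mem_part.2 ⟨q, ⟨hq, hqm⟩, hyq⟩, hyj⟩
  have hbt : Before block (tail m') := hX.before_part fun a ha b hb => lt_of_lt_of_le ha.2 hb
  have hun : block ∪ tail m' = tail m := by
    rw [← part_union, Ico_union_Ici_eq_Ici hmm.le]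
  have hun_c : (block ∪ tail m').OrdConnected := by
    rw [hun]; exact hX.ordConnected_part ordConnected_Ici
  obtain ⟨c, hc, d, hd, hcd⟩ := hbig m'
  have hopt := hU.optMem_lastBlock_mul_firstBlock hne hv he hP hbt hun_c hbi hbj hij hc hd hcd
  have hfirst := hU.firstBlock_union hbt hbi hbj hij
  rw [hun] at hfirst
  have hpow := hm.apply_part_Ico hX hmm.le fun n _ => ha n
  rw [shuffleVal_of_not_subset (hU.not_subset_of_touch_lt hbi hbj hij), ← hfirst, hsm] at hpow
  rw [hsm'] at hopt
  obtain ⟨l, hl⟩ : ∃ l, m' - m = l + 1 := ⟨m' - m - 1, by omega⟩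
  refine hm.tau_of_tail hX ha m ?_
  rw [htail, hval, hsm, ← A.tauExt_pow a l, ← hl, ← hpow, mul_assoc, A.tauExt_mul, mul_assoc,
    hopt.tauExt_kap_mul]

theorem respTauOp_shuffleVal (hU : Chain D U) [Finite S] [DenselyOrdered J] [Nonempty J]
    (hne : ∀ i, (U i).Nonempty) (hv : ∀ i, RespMul A (U i) v) (hP : ∀ i, A.OptMem P (v (U i)))
    (ht : ∀ i, RespTauOp A (U i) v) : RespTauOp A (⋃ i, U i) (shuffleVal v U (A.kap P)) := by
  have : Nonempty Jᵒᵈ := inferInstanceAs (Nonempty J)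
  have key := respTau_shuffleVal (W := Wᵒᵈ) (J := Jᵒᵈ) (A := A.op) (v := v) (D := D) (U := U)
    (P := P) (chain_dual hU) hne (fun i => (hv i).dual) hP fun i => (ht i).dual
  exact RespTauOp.of_dual ((shuffleVal_dual v U (A.kap P)) ▸ key)

end ShuffleVal

set_option linter.unusedSectionVars false


/-! ### Sets on all of whose open intervals the value is `R^κ` -/

section OpenKap

variable {Q : Type} [LinearOrder Q] [EtaOrder Q] {A : OplusAlgebra S} {H : Set Q → A.Ext}
  {R : {R : Set S // R.Nonempty}}

/-- `H` takes the value `R^κ` on all open intervals contained in `K`. -/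
def OpenKap (H : Set Q → A.Ext) (R : {R : Set S // R.Nonempty}) (K : Set Q) : Prop :=
  ∀ K' ⊆ K, IsOpenInterval K' → H K' = A.kap R

/-- Removing the greatest element, if there is one, leaves an open interval. -/
theorem OpenKap.eq_kap_mul (hH : RespMul A univ H) (hR : Shuffled A R.1 fun q => H {q})
    {K L : Set Q} (hK : OpenKap H R K) (hL : L ⊆ K) (hc : L.OrdConnected) (hn : L.Nonempty)
    (hmin : ∀ x ∈ L, ∃ y ∈ L, y < x) : ∃ x, A.OptMem R x ∧ H L = A.kap R * x := by
  by_cases hmax : ∀ x ∈ L, ∃ y ∈ L, x < y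
  · exact ⟨1, Or.inl rfl, by rw [hK L hL ⟨hc, hn, hmax, hmin⟩, mul_one]⟩
  · push Not at hmax
    obtain ⟨m, hm, hle⟩ := hmax
    refine ⟨H {m}, hR.optMem m, ?_⟩
    have hopen : IsOpenInterval (L ∩ Iio m) := by
      refine ⟨hc.inter ordConnected_Iio, hmin m hm, fun x hx => ?_, fun x hx => ?_⟩
      · obtain ⟨y, h1, h2⟩ := exists_between hx.2
        exact ⟨y, ⟨hc.out hx.1 hm ⟨h1.le, h2.le⟩, h2⟩, h1⟩
      · obtain ⟨y, h1, h2⟩ := hmin x hx.1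
        exact ⟨y, ⟨h1, h2.trans hx.2⟩, h2⟩
    have hempty : L ∩ Ioi m = ∅ := by
      ext x
      simp only [mem_inter_iff, mem_Ioi, mem_empty_iff_false, iff_false, not_and, not_lt]
      exact hle x
    rw [hH.inter_Iio_mul hc hm, hempty, hH.empty, mul_one,
      hK _ (inter_subset_left.trans hL) hopen]

theorem OpenKap.dual {K : Set Q} (hK : OpenKap H R K) :
    OpenKap (Q := Qᵒᵈ) (A := A.op) H R K :=
  fun K' h h' => hK K' h h'.dual

theorem OpenKap.eq_mul_kap (hH : RespMul A univ H) (hR : Shuffled A R.1 fun q => H {q})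
    {K L : Set Q} (hK : OpenKap H R K) (hL : L ⊆ K) (hc : L.OrdConnected) (hn : L.Nonempty)
    (hmax : ∀ x ∈ L, ∃ y ∈ L, x < y) : ∃ x, A.OptMem R x ∧ H L = x * A.kap R := by
  obtain ⟨x, hx, he⟩ := OpenKap.eq_kap_mul (Q := Qᵒᵈ) (A := A.op) (H := H) hH.dual hR.dual hK.dual
    hL hc.dual hn hmax
  exact ⟨x, hx, he.trans (A.op_mul _ _)⟩

theorem touch_singletons {W : Type*} (K : Set W) : touch (fun x : W => ({x} : Set W)) K = K := by
  ext x
  simp [touch]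

theorem part_singletons {W : Type*} (K : Set W) : part (fun x : W => ({x} : Set W)) K = K :=
  biUnion_of_singleton K

theorem OpenKap.eq_mul_kap_mul (hH : RespMul A univ H) (hR : Shuffled A R.1 fun q => H {q})
    {K : Set Q} (hK : OpenKap H R K) (hc : K.OrdConnected) {p q : Q} (hp : p ∈ K) (hq : q ∈ K)
    (hpq : p < q) : ∃ x y, A.OptMem R x ∧ A.OptMem R y ∧ H K = x * A.kap R * y := by
  have ht := touch_singletons K
  have hch := chain_singletons (W := Q)
  have h := hch.apply_eq_mul (X := K) (G := H) (by rw [iUnion_of_singleton]; exact subset_univ _) hc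
    (by rwa [ht]) (by rwa [ht]) hpq (hH.mono (subset_univ K))
  have hmid := isOpenInterval_midTouch (U := fun x : Q => ({x} : Set Q)) (X := K) (by rwa [ht])
    (by rwa [ht]) hpq
  have hsub : midTouch (fun x : Q => ({x} : Set Q)) K ⊆ K := fun x hx =>
    hch.apply_subset_of_mid hc hx rfl
  rw [part_singletons, hK _ hsub hmid] at h
  refine ⟨_, _, ?_, ?_, h⟩
  · by_cases hl : ∃ i, IsLeast (touch (fun x : Q => ({x} : Set Q)) K) i
    · obtain ⟨i, hi⟩ := hl
      have hiK : i ∈ K := by rw [← ht]; exact hi.1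
      rw [firstBlock_of_isLeast hi, inter_eq_right.2 (singleton_subset_iff.2 hiK)]
      exact hR.optMem i
    · rw [firstBlock_of_not hl, hH.empty]
      exact Or.inl rfl
  · by_cases hl : ∃ i, IsGreatest (touch (fun x : Q => ({x} : Set Q)) K) i
    · obtain ⟨i, hi⟩ := hl
      have hiK : i ∈ K := by rw [← ht]; exact hi.1
      rw [lastBlock_of_isGreatest hi, inter_eq_right.2 (singleton_subset_iff.2 hiK)]
      exact hR.optMem i
    · rw [lastBlock_of_not hl, hH.empty]
      exact Or.inl rfl

variable {C : Type} [LinearOrder C] [EtaOrder C] {K : C → Set Q}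

/-- An open interval `L` meeting two classes is a first block, an open interval of full classes and
a last block. The first block has no least element, so it has the form `κ x` and is absorbed;
symmetrically for the last. -/
theorem openKap_iUnion (hH : RespMul A univ H) (hR : Shuffled A R.1 fun q => H {q})
    (hK : Chain univ K) (hΦ : ∀ c, OpenKap H R (K c))
    (hopen : ∀ C', IsOpenInterval C' → H (part K C') = A.kap R) : OpenKap H R (⋃ c, K c) := by
  intro L hL hLo
  by_cases hs : ∃ c, L ⊆ K c
  · obtain ⟨c, hc⟩ := hs
    exact hΦ c L hc hLo
  obtain ⟨i, hi, j, hj, hij⟩ := exists_touch_lt hL hs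
  rw [hK.apply_eq_mul hL hLo.ordConnected hi hj hij (hH.mono (subset_univ _)),
    hopen _ (isOpenInterval_midTouch hi hj hij)]
  have h1 : H (firstBlock K L) * A.kap R = A.kap R := by
    by_cases hl : ∃ c, IsLeast (touch K L) c
    · obtain ⟨c, hc⟩ := hl
      rw [firstBlock_of_isLeast hc]
      obtain ⟨x, hx, he⟩ := (hΦ c).eq_kap_mul hH hR (L := L ∩ K c) inter_subset_right
        (hLo.ordConnected.inter (hK.ordConnected_apply c)) hc.1 (fun x hx => by
          obtain ⟨y, hy, hyx⟩ := hLo.exists_lt x hx.1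
          obtain ⟨d, hd⟩ := mem_iUnion.1 (hL hy)
          have := le_antisymm (hK.le_of_le hd hx.2 hyx.le) (hc.2 ⟨y, hy, hd⟩)
          exact ⟨y, ⟨hy, this ▸ hd⟩, hyx⟩)
      rw [he, hx.kap_mul_mul_kap]
    · rw [firstBlock_of_not hl, hH.empty, one_mul]
  have h2 : A.kap R * H (lastBlock K L) = A.kap R := by
    by_cases hl : ∃ c, IsGreatest (touch K L) c
    · obtain ⟨c, hc⟩ := hl
      rw [lastBlock_of_isGreatest hc]
      obtain ⟨x, hx, he⟩ := (hΦ c).eq_mul_kap hH hR (L := L ∩ K c) inter_subset_right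
        (hLo.ordConnected.inter (hK.ordConnected_apply c)) hc.1 (fun x hx => by
          obtain ⟨y, hy, hyx⟩ := hLo.exists_gt x hx.1
          obtain ⟨d, hd⟩ := mem_iUnion.1 (hL hy)
          have := le_antisymm (hc.2 ⟨y, hy, hd⟩) (hK.le_of_le hx.2 hd hyx.le)
          exact ⟨y, ⟨hy, this ▸ hd⟩, hyx⟩)
      rw [he, ← mul_assoc, hx.kap_mul_mul_kap]
    · rw [lastBlock_of_not hl, hH.empty, mul_one]
  rw [h1, h2]

/-- The values of a family of sets, as elements of the algebra. -/
def valueSet (H : Set Q → A.Ext) (K : C → Set Q) : Set S := {a | ∃ c, H (K c) = A.inj a}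

/-- A class is one point, with value in `R`, or has value `x R^κ y`. If all classes are points,
their union is convex and density produces every element of `R`; thus axiom 4 applies. -/
theorem kap_valueSet_eq_kap (hH : RespMul A univ H) (hR : Shuffled A R.1 fun q => H {q})
    (hK : Chain univ K) (hn : ∀ c, (K c).Nonempty) (hΦ : ∀ c, OpenKap H R (K c))
    (hne : (valueSet H K).Nonempty) : A.kap ⟨valueSet H K, hne⟩ = A.kap R := by
  have hcase : ∀ c, (∃ q, K c = {q}) ∨
      ∃ x y, A.OptMem R x ∧ A.OptMem R y ∧ H (K c) = x * A.kap R * y := by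
    intro c
    by_cases hs : ∃ p ∈ K c, ∃ q ∈ K c, p < q
    · obtain ⟨p, hp, q, hq, hpq⟩ := hs
      exact Or.inr ((hΦ c).eq_mul_kap_mul hH hR (hK.ordConnected_apply c) hp hq hpq)
    · push Not at hs
      obtain ⟨q, hq⟩ := hn c
      exact Or.inl ⟨q, subset_antisymm (fun p hp => le_antisymm (hs q hq p hp) (hs p hp q hq))
        (singleton_subset_iff.2 hq)⟩
  have hmem : ∀ c q, K c = {q} → ∀ r, H (K c) = A.inj r → r ∈ R.1 := by
    intro c q hq r hr
    obtain ⟨a, ha, he⟩ := hR.mem q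
    rw [hq] at hr
    rwa [← A.inj_injective (he.symm.trans hr)]
  apply OplusAlgebra.kap_eq_kap
  · rintro r ⟨c, hc⟩
    rcases hcase c with ⟨q, hq⟩ | ⟨x, y, hx, hy, he⟩
    · exact Or.inl (hmem c q hq r hc)
    · exact Or.inr ⟨x, y, hx, hy, by rw [← hc, he]⟩
  · by_cases hs : ∀ c, ∃ q, K c = {q}
    · left
      apply Subset.antisymm
      · rintro r ⟨c, hc⟩
        obtain ⟨q, hq⟩ := hs c
        exact hmem c q hq r hc
      · intro a ha
        obtain ⟨c⟩ := EtaOrder.nonempty (Q := C)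
        obtain ⟨d, hd⟩ := exists_gt c
        obtain ⟨p, hp⟩ := hn c
        obtain ⟨q, hq⟩ := hn d
        obtain ⟨t, h1, h2, h3⟩ := hR.dense a ha p q (hK.before c d hd p hp q hq)
        obtain ⟨e, he⟩ := mem_iUnion.1 (hK.ordConnected.out (mem_iUnion.2 ⟨c, hp⟩)
          (mem_iUnion.2 ⟨d, hq⟩) ⟨h1.le, h2.le⟩)
        obtain ⟨s, hs⟩ := hs e
        rw [hs, mem_singleton_iff] at he
        exact ⟨e, by rw [hs, ← he]; exact h3⟩
    · right
      push Not at hs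
      obtain ⟨c, hc⟩ := hs
      rcases hcase c with ⟨q, hq⟩ | ⟨x, y, hx, hy, he⟩
      · exact absurd hq (hc q)
      · have : H (K c) ≠ 1 := by
          rw [he]
          exact OplusAlgebra.mul_ne_one_left (OplusAlgebra.mul_ne_one_right (A.inj_ne_one _))
        obtain ⟨r, hr⟩ := A.exists_inj_of_ne_one this
        exact ⟨r, ⟨c, hr⟩, x, y, hx, hy, by rw [← hr, he]⟩

end OpenKap

/-! ### Regrouping a shuffle as another shuffle -/

section ShuffleKappa

variable {W : Type*} [LinearOrder W] {J : Type} [LinearOrder J] [EtaOrder J] {A : OplusAlgebra S}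
  {v : Set W → A.Ext} {U : J → Set W} {D : Set W} {P R : {P : Set S // P.Nonempty}}
  {Q : Type} [LinearOrder Q] [EtaOrder Q] {X : Q → Set W} {C : Type} [LinearOrder C] [EtaOrder C]
  {K : C → Set Q}

/-- If no open interval of `Q` between two different classes takes the value `R^κ`, then a block
`U i` meets at most one class. -/
theorem eq_of_mem_touch (hU : Chain D U) (hk : ∀ i, RespKappa A (U i) v)
    (hX : Chain (⋃ i, U i) X)
    (hR : Shuffled A R.1 fun q => shuffleVal v U (A.kap P) (X q))
    (hK : Chain univ K) (hKn : ∀ c, (K c).Nonempty)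
    (hnot : ∀ c d, c < d → ∀ p ∈ K c, ∀ q ∈ K d,
      ¬ OpenKap (fun L => shuffleVal v U (A.kap P) (part X L)) R (Icc p q))
    {i : J} {c d : C} (hc : i ∈ touch U (part X (K c))) (hd : i ∈ touch U (part X (K d))) :
    c = d := by
  have key : ∀ c d, i ∈ touch U (part X (K c)) → i ∈ touch U (part X (K d)) → ¬ c < d := by
    rintro c d ⟨x, hx, hxi⟩ ⟨y, hy, hyi⟩ hcd
    obtain ⟨p, hp, hxp⟩ := mem_part.1 hx
    obtain ⟨q, hq, hyq⟩ := mem_part.1 hy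
    -- Members of the family indexed between `c'` and `d'` lie between two points of `U i`, hence
    -- inside it, where compatibility of `v` with shuffles gives the excluded value `R^κ`.
    obtain ⟨c', h1, h2⟩ := exists_between hcd
    obtain ⟨d', h3, h4⟩ := exists_between h2
    obtain ⟨p', hp'⟩ := hKn c'
    obtain ⟨q', hq'⟩ := hKn d'
    refine hnot c' d' h3 p' hp' q' hq' fun L hL hLo => ?_
    have hsub : ∀ t ∈ L, X t ⊆ U i := by
      intro t ht z hz
      obtain ⟨j, hj⟩ := mem_iUnion.1 (hX.apply_subset t hz)
      have hpt : p < t := (hK.before c c' h1 p hp p' hp').trans_le (hL ht).1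
      have htq : t < q := (hL ht).2.trans_lt (hK.before d' d h4 q' hq' q hq)
      have := le_antisymm (hU.le_of_le hxi hj (hX.before p t hpt x hxp z hz).le)
        (hU.le_of_le hj hyi (hX.before t q htq z hz y hyq).le)
      rwa [this]
    have hsub' : part X L ⊆ U i := iUnion₂_subset hsub
    have := hLo.etaOrder
    show shuffleVal v U (A.kap P) (part X L) = _
    rw [shuffleVal_of_subset hsub']
    rw [part_eq_iUnion] at hsub' ⊢
    refine hk i L (fun t => X t) R ((hX.restrict hLo.ordConnected).mono hsub') ?_
    have := hR.restrict hLo.ordConnected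
    simpa only [fun t : L => shuffleVal_of_subset (v := v) (k := A.kap P) (hsub t t.2)] using this
  rcases lt_trichotomy c d with h | h | h
  · exact absurd h (key c d hc hd)
  · exact h
  · exact absurd h (key d c hd hc)

theorem exists_mem_touch_class
    (hX : Chain (⋃ i, U i) X) (hXn : ∀ q, (X q).Nonempty) (hKn : ∀ c, (K c).Nonempty)
    (c : C) : ∃ i, i ∈ touch U (part X (K c)) := by
  obtain ⟨x, hx⟩ := part_nonempty hXn (hKn c)
  obtain ⟨i, hi⟩ := mem_iUnion.1 (hX.part_subset _ hx)
  exact ⟨i, x, hx, hi⟩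

theorem touch_class_lt
    (hU : Chain D U) (hX : Chain (⋃ i, U i) X) (hK : Chain univ K)
    (huniq : ∀ i c d, i ∈ touch U (part X (K c)) → i ∈ touch U (part X (K d)) → c = d)
    {c d : C} (hcd : c < d) {i j : J} (hi : i ∈ touch U (part X (K c)))
    (hj : j ∈ touch U (part X (K d))) : i < j := by
  refine lt_of_le_of_ne (hU.touch_le (hX.before_part (hK.before c d hcd)) hi hj) ?_
  rintro rfl
  exact hcd.ne (huniq i c d hi hj)

/-- Each class meets some block and later classes meet strictly later blocks, so over an open
interval of classes there is neither a first nor a last block. -/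
theorem shuffleVal_part_classes
    (hU : Chain D U) (hv : ∀ i, RespMul A (U i) v) (hX : Chain (⋃ i, U i) X)
    (hXn : ∀ q, (X q).Nonempty) (hK : Chain univ K) (hKn : ∀ c, (K c).Nonempty)
    (huniq : ∀ i c d, i ∈ touch U (part X (K c)) → i ∈ touch U (part X (K d)) → c = d)
    {C' : Set C} (hC : IsOpenInterval C') :
    shuffleVal v U (A.kap P) (part X (part K C')) = A.kap P := by
  have he : v ∅ = 1 := (hv (Classical.arbitrary J)).empty
  have hmono : ∀ c ∈ C', touch U (part X (K c)) ⊆ touch U (part X (part K C')) := fun c hc =>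
    touch_mono U (part_mono X (subset_part K hc))
  have hex : ∀ i ∈ touch U (part X (part K C')), ∃ c ∈ C', i ∈ touch U (part X (K c)) := by
    rintro i ⟨x, hx, hxi⟩
    obtain ⟨q, hq, hxq⟩ := mem_part.1 hx
    obtain ⟨c, hc, hqc⟩ := mem_part.1 hq
    exact ⟨c, hc, x, mem_part.2 ⟨q, hqc, hxq⟩, hxi⟩
  obtain ⟨c, hc⟩ := hC.nonempty
  obtain ⟨d, hd, hcd⟩ := hC.exists_gt c hc
  obtain ⟨i, hi⟩ := exists_mem_touch_class hX hXn hKn c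
  obtain ⟨j, hj⟩ := exists_mem_touch_class hX hXn hKn d
  rw [shuffleVal_of_not_subset (hU.not_subset_of_touch_lt (hmono c hc hi) (hmono d hd hj)
    (touch_class_lt hU hX hK huniq hcd hi hj)), firstBlock_of_not, lastBlock_of_not, he, one_mul,
    mul_one]
  · rintro ⟨i, hi, hle⟩
    obtain ⟨c, hc, hic⟩ := hex i hi
    obtain ⟨d, hd, hcd⟩ := hC.exists_gt c hc
    obtain ⟨j, hj⟩ := exists_mem_touch_class hX hXn hKn d
    exact (touch_class_lt hU hX hK huniq hcd hic hj).not_ge (hle (hmono d hd hj))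
  · rintro ⟨i, hi, hle⟩
    obtain ⟨c, hc, hic⟩ := hex i hi
    obtain ⟨d, hd, hcd⟩ := hC.exists_lt c hc
    obtain ⟨j, hj⟩ := exists_mem_touch_class hX hXn hKn d
    exact (touch_class_lt hU hX hK huniq hcd hj hic).not_ge (hle (hmono d hd hj))

/-- Each class is a union of whole blocks: a single block, with value in `P`, or of value `x P^κ y`.
If all are single blocks, their values fill `P`; axiom 4 concludes. -/
theorem kap_valueSet_classes
    (hU : Chain D U) (hUn : ∀ i, (U i).Nonempty) (hv : ∀ i, RespMul A (U i) v)
    (hP : Shuffled A P.1 fun i => v (U i)) (hX : Chain (⋃ i, U i) X) (hXn : ∀ q, (X q).Nonempty)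
    (hK : Chain univ K) (hKn : ∀ c, (K c).Nonempty)
    (huniq : ∀ i c d, i ∈ touch U (part X (K c)) → i ∈ touch U (part X (K d)) → c = d)
    (hne : (valueSet (fun L => shuffleVal v U (A.kap P) (part X L)) K).Nonempty) :
    A.kap ⟨valueSet (fun L => shuffleVal v U (A.kap P) (part X L)) K, hne⟩ = A.kap P := by
  have he : v ∅ = 1 := (hv (Classical.arbitrary J)).empty
  have hZc : (part X (⋃ c, K c)).OrdConnected := hX.ordConnected_part hK.ordConnected
  have hmono : ∀ c, touch U (part X (K c)) ⊆ touch U (part X (⋃ c, K c)) := fun c =>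
    touch_mono U (part_mono X (subset_iUnion K c))
  have hmid : ∀ m ∈ midTouch U (part X (⋃ c, K c)), ∃ c, U m ⊆ part X (K c) := by
    intro m hm
    have hsub := hU.apply_subset_of_mid hZc hm
    obtain ⟨z, hz⟩ := hUn m
    have hex : ∀ z ∈ U m, ∃ c, z ∈ part X (K c) := fun z hz => by
      have := hsub hz
      rw [part_iUnion] at this
      exact mem_iUnion.1 this
    obtain ⟨c, hc⟩ := hex z hz
    refine ⟨c, fun y hy => ?_⟩
    obtain ⟨d, hd⟩ := hex y hy
    rwa [huniq m c d ⟨z, hc, hz⟩ ⟨y, hd, hy⟩]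
  -- As `C` has no endpoints, `U i` lies strictly between two touched blocks. It is therefore
  -- covered by the classes, and by `huniq` by this class alone.
  have hfull : ∀ c, ∀ i ∈ touch U (part X (K c)), U i ⊆ part X (K c) := by
    intro c i hi
    obtain ⟨c₁, h₁⟩ := exists_lt c
    obtain ⟨c₂, h₂⟩ := exists_gt c
    obtain ⟨a, ha⟩ := exists_mem_touch_class hX hXn hKn c₁
    obtain ⟨b, hb⟩ := exists_mem_touch_class hX hXn hKn c₂
    obtain ⟨d, hd⟩ := hmid i ⟨⟨a, hmono c₁ ha, touch_class_lt hU hX hK huniq h₁ ha hi⟩,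
      b, hmono c₂ hb, touch_class_lt hU hX hK huniq h₂ hi hb⟩
    obtain ⟨z, hz⟩ := hUn i
    rwa [huniq i c d hi ⟨z, hd hz, hz⟩]
  have hsmall : ∀ c i, part X (K c) ⊆ U i → part X (K c) = U i := by
    intro c i hi
    obtain ⟨j, hj⟩ := exists_mem_touch_class hX hXn hKn c
    have : j = i := hU.touch_eq hi hj
    exact Subset.antisymm hi (hfull c i (this ▸ hj))
  have hbig : ∀ c, (¬ ∃ i, part X (K c) ⊆ U i) → ∃ x y, A.OptMem P x ∧ A.OptMem P y ∧
      shuffleVal v U (A.kap P) (part X (K c)) = x * A.kap P * y := by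
    intro c hc
    refine ⟨_, _, ?_, ?_, shuffleVal_of_not_subset hc⟩
    · by_cases hl : ∃ i, IsLeast (touch U (part X (K c))) i
      · obtain ⟨i, hi⟩ := hl
        rw [firstBlock_of_isLeast hi, inter_eq_right.2 (hfull c i hi.1)]
        exact hP.optMem i
      · rw [firstBlock_of_not hl, he]
        exact Or.inl rfl
    · by_cases hl : ∃ i, IsGreatest (touch U (part X (K c))) i
      · obtain ⟨i, hi⟩ := hl
        rw [lastBlock_of_isGreatest hi, inter_eq_right.2 (hfull c i hi.1)]
        exact hP.optMem i
      · rw [lastBlock_of_not hl, he]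
        exact Or.inl rfl
  have hmem : ∀ c i, part X (K c) ⊆ U i → ∀ r,
      shuffleVal v U (A.kap P) (part X (K c)) = A.inj r → r ∈ P.1 := by
    intro c i hi r hr
    obtain ⟨a, ha, hea⟩ := hP.mem i
    rw [shuffleVal_of_subset hi, hsmall c i hi] at hr
    rwa [← A.inj_injective (hea.symm.trans hr)]
  apply OplusAlgebra.kap_eq_kap
  · rintro r ⟨c, hc⟩
    by_cases hs : ∃ i, part X (K c) ⊆ U i
    · obtain ⟨i, hi⟩ := hs
      exact Or.inl (hmem c i hi r hc)
    · obtain ⟨x, y, hx, hy, h⟩ := hbig c hs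
      exact Or.inr ⟨x, y, hx, hy, hc.symm.trans h⟩
  · by_cases hs : ∀ c, ∃ i, part X (K c) ⊆ U i
    · left
      apply Subset.antisymm
      · rintro r ⟨c, hc⟩
        obtain ⟨i, hi⟩ := hs c
        exact hmem c i hi r hc
      · intro a ha
        obtain ⟨c⟩ := EtaOrder.nonempty (Q := C)
        obtain ⟨d, hcd⟩ := exists_gt c
        obtain ⟨i, hi⟩ := exists_mem_touch_class hX hXn hKn c
        obtain ⟨j, hj⟩ := exists_mem_touch_class hX hXn hKn d
        obtain ⟨m, h1, h2, h3⟩ := hP.dense a ha i j (touch_class_lt hU hX hK huniq hcd hi hj)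
        obtain ⟨e, hme⟩ := hmid m ⟨⟨i, hmono c hi, h1⟩, j, hmono d hj, h2⟩
        obtain ⟨l, hl⟩ := hs e
        obtain ⟨z, hz⟩ := hUn m
        have : m = l := hU.eq_of_mem hz (hl (hme hz))
        refine ⟨e, ?_⟩
        show shuffleVal v U (A.kap P) (part X (K e)) = _
        rw [shuffleVal_of_subset hl, hsmall e l hl, ← this, h3]
    · right
      push Not at hs
      obtain ⟨c, hc⟩ := hs
      obtain ⟨x, y, hx, hy, h⟩ := hbig c (by push Not; exact hc)
      have hne1 : shuffleVal v U (A.kap P) (part X (K c)) ≠ 1 := by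
        rw [h]
        exact OplusAlgebra.mul_ne_one_left (OplusAlgebra.mul_ne_one_right (A.inj_ne_one _))
      obtain ⟨r, hr⟩ := A.exists_inj_of_ne_one hne1
      exact ⟨r, ⟨c, hr⟩, x, y, hx, hy, hr.symm.trans h⟩

end ShuffleKappa

/-- Condensation on the index set `Q`, for the property that open intervals have value `R^κ`. Cuts
and limits are handled by `kap_of_cut` and `kap_of_omega`; for dense classes, comparing their values
with both `P` and `R` gives `P^κ = R^κ`. -/
theorem respKappa_shuffleVal [Finite S] {W : Type*} [LinearOrder W] {J : Type} [LinearOrder J]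
    [EtaOrder J] {A : OplusAlgebra S} {v : Set W → A.Ext} {U : J → Set W} {D : Set W}
    {P : {P : Set S // P.Nonempty}} (hU : Chain D U) (hUn : ∀ i, (U i).Nonempty)
    (hv : ∀ i, RespMul A (U i) v) (ht : ∀ i, RespTau A (U i) v) (ht' : ∀ i, RespTauOp A (U i) v)
    (hk : ∀ i, RespKappa A (U i) v) (hP : Shuffled A P.1 fun i => v (U i)) :
    RespKappa A (⋃ i, U i) (shuffleVal v U (A.kap P)) := by
  intro Q _ _ X R hX hR
  have hm := respMul_shuffleVal hU hUn hv hP.optMem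
  have hH := hm.comp hX
  have hT := (respTau_shuffleVal hU hUn hv hP.optMem ht).comp hX
  have hT' := (respTauOp_shuffleVal hU hUn hv hP.optMem ht').comp hX
  have hR' : Shuffled A R.1 fun q => shuffleVal v U (A.kap P) (part X {q}) := by
    simpa only [part_singleton] using hR
  have hXn : ∀ q, (X q).Nonempty := fun q => by
    rw [nonempty_iff_ne_empty]
    intro h0
    obtain ⟨a, -, ha⟩ := hR.mem q
    rw [h0, hm.empty] at ha
    exact A.inj_ne_one a ha.symm
  -- No colours are needed here: the values of the classes enter only through `valueSet`, not
  -- through how they recur.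
  have hclosed : CondensationClosed (fun _ : Set Q => ())
      (OpenKap (fun L => shuffleVal v U (A.kap P) (part X L)) R) := by
    refine ⟨fun D D' h _ hD K hK => hD K (hK.trans h), fun x K hK hKo => ?_,
      fun K₁ K₂ hB _ h₁ h₂ L hL hLo => ?_, fun D _ _ _ hD L hL hLo => ?_,
      fun D _ _ _ hD L hL hLo => ?_, fun C _ _ K hK hKn hΦ _ hnot => ?_⟩
    · obtain ⟨y, hy⟩ := hKo.nonempty
      obtain ⟨z, hz, hyz⟩ := hKo.exists_gt y hy
      rw [mem_singleton_iff.1 (hK hy), mem_singleton_iff.1 (hK hz)] at hyz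
      exact absurd hyz (lt_irrefl _)
    · rcases (L ∩ K₁).eq_empty_or_nonempty with h0 | hn₁
      · exact h₂ L (fun x hx => (hL hx).resolve_left fun h => by
          have : x ∈ L ∩ K₁ := ⟨hx, h⟩
          rwa [h0] at this) hLo
      rcases (L ∩ K₂).eq_empty_or_nonempty with h0 | hn₂
      · exact h₁ L (fun x hx => (hL hx).resolve_right fun h => by
          have : x ∈ L ∩ K₂ := ⟨hx, h⟩
          rwa [h0] at this) hLo
      exact kap_of_cut hH hR' hLo hB hn₁ hn₂
        (fun q hq h1 h2 => ((hL hq).elim h1 h2).elim)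
        (fun K hK => h₁ K (hK.trans inter_subset_right))
        (fun K hK => h₂ K (hK.trans inter_subset_right))
    · refine kap_of_omega hH hT hR' hLo ?_
      rintro K hK hKo ⟨b, hb, hKb⟩
      exact hD b (hL hb) K (subset_inter (hK.trans hL) hKb) hKo
    · refine kap_of_omegaOp hH hT' hR' hLo ?_
      rintro K hK hKo ⟨b, hb, hKb⟩
      exact hD b (hL hb) K (subset_inter (hK.trans hL) hKb) hKo
    · have huniq : ∀ i c d, i ∈ touch U (part X (K c)) → i ∈ touch U (part X (K d)) → c = d :=
        fun i c d hc hd => eq_of_mem_touch hU hk hX hR hK hKn hnot hc hd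
      have hne : (valueSet (fun L => shuffleVal v U (A.kap P) (part X L)) K).Nonempty := by
        obtain ⟨c⟩ := EtaOrder.nonempty (Q := C)
        obtain ⟨q, hq⟩ := hKn c
        have hval : shuffleVal v U (A.kap P) (part X (K c)) ≠ 1 := by
          have := hH.inter_Iio_mul (hK.ordConnected_apply c) hq
          obtain ⟨a, -, ha⟩ := hR'.mem q
          rw [this, ha]
          exact OplusAlgebra.mul_ne_one_left (OplusAlgebra.mul_ne_one_right (A.inj_ne_one a))
        obtain ⟨r, hr⟩ := A.exists_inj_of_ne_one hval
        exact ⟨r, c, hr⟩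
      have hkap : A.kap P = A.kap R := by
        rw [← kap_valueSet_classes hU hUn hv hP hX hXn hK hKn huniq hne,
          kap_valueSet_eq_kap hH hR' hK hKn hΦ hne]
      refine openKap_iUnion hH hR' hK hΦ fun C' hC' => ?_
      rw [← hkap]
      exact shuffleVal_part_classes hU hv hX hXn hK hKn huniq hC'
  have := hclosed.prop_univ univ Subset.rfl isOpenInterval_univ
  simpa only [part_univ] using this

/-! ### Every nonempty countable word is good -/

/-- A shuffle of good sets is good. -/
theorem Good.shuffle [Finite S] {W : Type*} [LinearOrder W] {J : Type} [LinearOrder J]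
    [EtaOrder J] {A : OplusAlgebra S} {f : W → S} {U : J → Set W} {D : Set W}
    {P : {P : Set S // P.Nonempty}} (hU : Chain D U) (hUn : ∀ i, (U i).Nonempty)
    (h : ∀ i, Good A f (U i)) (hP : Shuffled A P.1 fun i => canon A f (U i)) :
    Good A f (⋃ i, U i) := by
  have hv : ∀ i, IsVal A (U i) (canon A f) f := fun i => (h i).isVal_canon
  refine ⟨shuffleVal (canon A f) U (A.kap P), ⟨?_, ?_,
    respMul_shuffleVal hU hUn (fun i => (hv i).respMul) hP.optMem,
    respTau_shuffleVal hU hUn (fun i => (hv i).respMul) hP.optMem fun i => (hv i).respTau,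
    respTauOp_shuffleVal hU hUn (fun i => (hv i).respMul) hP.optMem fun i => (hv i).respTauOp,
    respKappa_shuffleVal hU hUn (fun i => (hv i).respMul) (fun i => (hv i).respTau)
      (fun i => (hv i).respTauOp) (fun i => (hv i).respKappa) hP⟩, ?_⟩
  · intro X hX hc hn
    by_cases hs : ∃ i, X ⊆ U i
    · obtain ⟨i, hi⟩ := hs
      rw [shuffleVal_of_subset hi]
      exact (hv i).respNonempty X hi hc hn
    · rw [shuffleVal_of_not_subset hs]
      exact OplusAlgebra.mul_ne_one_left (OplusAlgebra.mul_ne_one_right (A.inj_ne_one _))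
  · intro x hx
    obtain ⟨i, hi⟩ := mem_iUnion.1 hx
    rw [shuffleVal_of_subset (singleton_subset_iff.2 hi), (hv i).single x hi]
  · intro X hX hc G hG
    by_cases hs : ∃ i, X ⊆ U i
    · obtain ⟨i, hi⟩ := hs
      rw [shuffleVal_of_subset hi]
      exact (h i).eq_canon hi hc hG
    · obtain ⟨i, hi, j, hj, hij⟩ := exists_touch_lt hX hs
      have hsmall : ∀ i, G (X ∩ U i) = canon A f (X ∩ U i) := fun i =>
        (h i).eq_canon inter_subset_right (hc.inter (hU.ordConnected_apply i))
          (hG.mono inter_subset_left)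
      have hGe := hG.respMul.empty
      have he := (hv i).respMul.empty
      have hmid : IsOpenInterval (midTouch U X) := isOpenInterval_midTouch hi hj hij
      have hmsub : part U (midTouch U X) ⊆ X :=
        iUnion₂_subset fun i hi => hU.apply_subset_of_mid hc hi
      have hGm : G (part U (midTouch U X)) = A.kap P := by
        have := hmid.etaOrder
        rw [part_eq_iUnion] at hmsub ⊢
        refine hG.respKappa _ (fun i : midTouch U X => U i) P
          ((hU.restrict hmid.ordConnected).mono hmsub) ?_
        have hGU : ∀ i : midTouch U X, G (U i) = canon A f (U i) := fun i => by
          have := hsmall i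
          rwa [inter_eq_right.2 (hU.apply_subset_of_mid hc i.2)] at this
        have := hP.restrict hmid.ordConnected
        simpa only [hGU] using this
      rw [hU.apply_eq_mul hX hc hi hj hij hG.respMul, hGm, shuffleVal_of_not_subset hs]
      congr 1
      · congr 1
        by_cases hl : ∃ i, IsLeast (touch U X) i
        · obtain ⟨i, hi⟩ := hl
          rw [firstBlock_of_isLeast hi, hsmall]
        · rw [firstBlock_of_not hl, hGe, he]
      · by_cases hl : ∃ i, IsGreatest (touch U X) i
        · obtain ⟨i, hi⟩ := hl
          rw [lastBlock_of_isGreatest hi, hsmall]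
        · rw [lastBlock_of_not hl, hGe, he]

/-- Of two members of a chain inside a point, one is empty. So constant sequences have value `1` and
shuffles do not occur. -/
theorem good_singleton {W : Type*} [LinearOrder W] (A : OplusAlgebra S) (f : W → S) (x : W) :
    Good A f {x} := by
  classical
  have hcase : ∀ X ⊆ ({x} : Set W), X = ∅ ∨ X = {x} := fun X hX => subset_singleton_iff_eq.1 hX
  have hsub : ∀ {ι : Type} [LinearOrder ι] {X : ι → Set W}, Chain {x} X → ∀ i j, i < j →
      X i = ∅ ∨ X j = ∅ := by
    intro ι _ X hX i j hij
    by_contra hne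
    push Not at hne
    obtain ⟨⟨y, hy⟩, z, hz⟩ := hne
    have := hX.before i j hij y hy z hz
    rw [mem_singleton_iff.1 (hX.apply_subset i hy), mem_singleton_iff.1 (hX.apply_subset j hz)] at this
    exact lt_irrefl _ this
  let F : Set W → A.Ext := fun X => if X.Nonempty then A.inj (f x) else 1
  have Fe : F ∅ = 1 := if_neg Set.not_nonempty_empty
  have Fn : ∀ {X}, X.Nonempty → F X = A.inj (f x) := fun h => if_pos h
  have F1 : ∀ {X}, F X = 1 → X = ∅ := fun {X} h => by
    by_contra hX
    rw [Fn (nonempty_iff_ne_empty.2 hX)] at h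
    exact A.inj_ne_one _ h
  refine ⟨F, ⟨fun X _ _ hn => ?_, ?_, ⟨Fe, ?_⟩, ?_, ?_, ?_⟩, ?_⟩
  · rw [Fn hn]; exact A.inj_ne_one _
  · rintro y rfl
    exact Fn (singleton_nonempty y)
  · intro X Y hXY _ hD
    rcases X.eq_empty_or_nonempty with rfl | ⟨y, hy⟩
    · rw [Fe, empty_union, one_mul]
    rcases Y.eq_empty_or_nonempty with rfl | ⟨z, hz⟩
    · rw [Fe, union_empty, mul_one]
    have := hXY y hy z hz
    rw [mem_singleton_iff.1 (hD (Or.inl hy)), mem_singleton_iff.1 (hD (Or.inr hz))] at this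
    exact absurd this (lt_irrefl _)
  · intro X a hX ha
    have h1 : a = 1 := by
      rcases hsub hX 0 1 Nat.zero_lt_one with h | h
      · rw [← ha 0, h, Fe]
      · rw [← ha 1, h, Fe]
    have : ∀ n, X n = ∅ := fun n => F1 ((ha n).trans h1)
    rw [iUnion_eq_empty.2 this, Fe, h1, A.tauExt_one]
  · intro X a hX ha
    have h1 : a = 1 := by
      rcases hsub hX (OrderDual.toDual 1) (OrderDual.toDual 0) Nat.zero_lt_one with h | h
      · rw [← ha (OrderDual.toDual 1), h, Fe]
      · rw [← ha (OrderDual.toDual 0), h, Fe]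
    have : ∀ n, X n = ∅ := fun n => F1 ((ha n).trans h1)
    rw [iUnion_eq_empty.2 this, Fe, h1, A.tauOpExt_one]
  · intro Q _ _ X P hX hP
    exfalso
    obtain ⟨p⟩ := EtaOrder.nonempty (Q := Q)
    obtain ⟨q, hpq⟩ := exists_gt p
    have hno : ∀ q, X q ≠ ∅ := fun q h => by
      obtain ⟨a, -, ha⟩ := hP.mem q
      rw [h, Fe] at ha
      exact A.inj_ne_one a ha.symm
    exact (hsub hX p q hpq).elim (hno p) (hno q)
  · intro X hX _ G hG
    rcases hcase X hX with rfl | rfl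
    · rw [Fe, hG.respMul.empty]
    · rw [hG.single x rfl, Fn (singleton_nonempty x)]

/-- Every nonempty countable word has a unique valuation. -/
theorem good_univ [Finite S] {W : Type} [LinearOrder W] [Countable W] [Nonempty W]
    (A : OplusAlgebra S) (f : W → S) : Good A f univ := by
  refine CondensationClosed.prop_univ (col := canon A f) ⟨fun D D' h _ hD => hD.mono h,
    good_singleton A f, fun X Y hB hc h₁ h₂ => h₁.concat hB hc h₂, fun D _ hn _ h => Good.omega hn h,
    fun D _ hn _ h => Good.omegaOp hn h, fun Q _ _ K hK hKn h hcol _ => ?_⟩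
  have hval : ∀ q, ∃ a, canon A f (K q) = A.inj a := fun q =>
    A.exists_inj_of_ne_one ((h q).isVal_canon.respNonempty _ Subset.rfl (hK.ordConnected_apply q)
      (hKn q))
  choose g hg using hval
  -- The colour of a class is its value, so homogeneity says that the classes are shuffled with
  -- exactly the values in `range g`.
  refine Good.shuffle (P := ⟨range g, range_nonempty g⟩) hK hKn h
    ⟨fun q => ⟨g q, mem_range_self q, hg q⟩, ?_⟩
  rintro _ ⟨r, rfl⟩ p q hpq
  obtain ⟨t, h1, h2, h3⟩ := hcol p q r hpq
  exact ⟨t, h1, h2, h3.trans (hg r)⟩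

/-- Any valuation is given by `canon`. -/
theorem IsVal.eq_canon [Finite S] {W : Type} [LinearOrder W] [Countable W] [Nonempty W]
    {A : OplusAlgebra S} {f : W → S} {X : Set W} (hX : X.OrdConnected) {G : Set W → A.Ext}
    (hG : IsVal A X G f) : G X = canon A f X :=
  (good_univ A f).eq_canon (subset_univ X) hX hG

/-! ### The product of a word and its associativity -/

section Product

variable [Finite S] (A : OplusAlgebra S)

theorem isVal_canon_univ {W : Type} [LinearOrder W] [Countable W] [Nonempty W] (f : W → S) :
    IsVal A univ (canon A f) f := (good_univ A f).isVal_canon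

/-- The value of a word is obtained by evaluating the word made up of the values of the blocks of
a decomposition. -/
theorem canon_univ_eq_iUnion {W α : Type} [LinearOrder W] [Countable W] [Nonempty W]
    [LinearOrder α] [Countable α] [Nonempty α] {f : W → S} {g : α → S} {X : α → Set W}
    (hX : Chain univ X) (hn : ∀ i, (X i).Nonempty) (hg : ∀ i, canon A f (X i) = A.inj (g i)) :
    canon A g univ = canon A f (⋃ i, X i) := by
  -- The valuation of `f` induces one of the word `g` of block values, and uniqueness identifies it
  -- with the canonical one.
  rw [← ((isVal_canon_univ A f).comp hX hn hg).eq_canon ordConnected_univ, part_univ]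

theorem canon_univ_eq_range {W α : Type} [LinearOrder W] [Countable W] [Nonempty W]
    [LinearOrder α] [Countable α] [Nonempty α] {f : W → S} {g : α → S} {e : α → W}
    (he : StrictMono e) (hr : (range e).OrdConnected) (hg : ∀ i, f (e i) = g i) :
    canon A g univ = canon A f (range e) := by
  have hU : (⋃ i, ({e i} : Set W)) = range e := by ext; simp [eq_comm]
  rw [← hU]
  refine canon_univ_eq_iUnion A ⟨?_, by rwa [hU], subset_univ _⟩ (fun i => singleton_nonempty _) ?_
  · rintro i j hij _ rfl _ rfl
    exact he hij
  · intro i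
    rw [(isVal_canon_univ A f).single _ (mem_univ _), hg]

theorem canon_univ_eq_of_iso {v w : LWord S} [Nonempty v.dom] [Nonempty w.dom]
    (h : LWord.Iso v w) : canon A v.label univ = canon A w.label univ := by
  obtain ⟨e, he⟩ := h
  rw [canon_univ_eq_range A e.strictMono (by rw [e.range_eq]; exact ordConnected_univ) he,
    e.range_eq]

theorem exists_canon_univ_eq (w : NLWord S) : ∃ a, canon A w.1.label univ = A.inj a := by
  have := w.2
  exact A.exists_inj_of_ne_one ((isVal_canon_univ A w.1.label).respNonempty univ Subset.rfl
    ordConnected_univ univ_nonempty)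

/-- The product of a nonempty word. -/
noncomputable def OplusAlgebra.eval (w : NLWord S) : S := (exists_canon_univ_eq A w).choose

theorem OplusAlgebra.inj_eval (w : NLWord S) : A.inj (A.eval w) = canon A w.1.label univ :=
  (exists_canon_univ_eq A w).choose_spec.symm

theorem OplusAlgebra.eval_eq_of_iso (v w : NLWord S) (h : LWord.Iso v.1 w.1) :
    A.eval v = A.eval w := by
  have := v.2
  have := w.2
  apply A.inj_injective
  rw [A.inj_eval, A.inj_eval, canon_univ_eq_of_iso A h]

/-- The product induced by a finite `⊕`-algebra. -/
noncomputable def OplusAlgebra.prod : NWord S → S :=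
  Quotient.lift A.eval fun v w h => A.eval_eq_of_iso v w h

theorem OplusAlgebra.inj_prod (w : LWord S) (hw : Nonempty w.dom) :
    A.inj (A.prod (NWord.mk w hw)) = canon A w.label univ := A.inj_eval ⟨w, hw⟩

theorem OplusAlgebra.isProduct_prod : IsProduct A.prod where
  letter a := by
    apply A.inj_injective
    rw [A.inj_prod]
    have : Nonempty (LWord.letter a).dom := ⟨()⟩
    have h := (isVal_canon_univ A (LWord.letter a).label).single () (mem_univ _)
    have e : (univ : Set (LWord.letter a).dom) = {()} := (eq_univ_of_forall fun x => rfl).symm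
    exact (congrArg (canon A (LWord.letter a).label) e).trans h
  assoc α _ _ hα u hu := by
    apply A.inj_injective
    refine (A.inj_prod _ hα).trans (Eq.trans ?_ (A.inj_prod _ _).symm)
    have hW : Nonempty (LWord.concat α u).dom := LWord.concat_nonempty α u hu
    -- The factors, as convex sets of positions in the concatenation.
    let B : α → Set (LWord.concat α u).dom := fun i => {x | (ofLex x).1 = i}
    have hB : Chain univ B := by
      have hU : (⋃ i, B i) = univ := eq_univ_of_forall fun x => mem_iUnion.2 ⟨_, rfl⟩
      refine ⟨?_, by rw [hU]; exact ordConnected_univ, subset_univ _⟩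
      rintro i j hij x rfl y rfl
      exact Sigma.Lex.lt_def.2 (Or.inl hij)
    have hU : (⋃ i, B i) = univ := eq_univ_of_forall fun x => mem_iUnion.2 ⟨_, rfl⟩
    have hblock : ∀ i, canon A (LWord.concat α u).label (B i) =
        A.inj (A.prod (NWord.mk (u i) (hu i))) := by
      intro i
      have := hu i
      rw [A.inj_prod]
      let e : (u i).dom → (LWord.concat α u).dom := fun x => toLex ⟨i, x⟩
      have he : StrictMono e := fun x y hxy => Sigma.Lex.right _ _ hxy
      have hr : range e = B i := by
        ext x
        constructor
        · rintro ⟨y, rfl⟩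
          rfl
        · rintro rfl
          exact ⟨(ofLex x).2, rfl⟩
      rw [← hr]
      exact (canon_univ_eq_range A he (by rw [hr]; exact hB.ordConnected_apply i) fun _ => rfl).symm
    have hn : ∀ i, (B i).Nonempty := fun i => by
      obtain ⟨x⟩ := hu i
      exact ⟨toLex ⟨i, x⟩, rfl⟩
    have := canon_univ_eq_iUnion A hB hn hblock
    rw [hU] at this
    exact this

theorem OplusAlgebra.inducedBy_prod : A.InducedBy A.prod where
  mul a b := by
    apply A.inj_injective
    rw [A.inj_prod]
    have : Nonempty (LWord.pair a b).dom := ⟨(0 : Fin 2)⟩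
    have hv := isVal_canon_univ A (LWord.pair a b).label
    have e : ({(0 : Fin 2)} ∪ {(1 : Fin 2)} : Set (LWord.pair a b).dom) = univ :=
      eq_univ_of_forall (Fin.forall_fin_two.2 ⟨Or.inl rfl, Or.inr rfl⟩)
    have h := hv.respMul.mul {(0 : Fin 2)} {(1 : Fin 2)}
      (by rintro x rfl y rfl; exact (Fin.zero_lt_one : (0 : Fin 2) < 1))
      (by rw [e]; exact ordConnected_univ) (subset_univ _)
    rw [e] at h
    rw [h, A.inj_mul]
    exact (congrArg₂ _ (hv.single (0 : Fin 2) (mem_univ _)) (hv.single (1 : Fin 2) (mem_univ _))).symm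
  tau a := by
    apply A.inj_injective
    rw [A.inj_prod]
    have : Nonempty (LWord.omegaPow a).dom := ⟨(0 : ℕ)⟩
    have hv := isVal_canon_univ A (LWord.omegaPow a).label
    have hch : Chain univ fun n : ℕ => ({n} : Set (LWord.omegaPow a).dom) := chain_singletons
    have h := hv.respTau _ (A.inj a) hch fun n => hv.single n (mem_univ _)
    rw [← A.tauExt_inj, ← h]
    exact congrArg _ (iUnion_of_singleton ℕ)
  tauOp a := by
    apply A.inj_injective
    rw [A.inj_prod]
    have : Nonempty (LWord.omegaOpPow a).dom := ⟨OrderDual.toDual (0 : ℕ)⟩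
    have hv := isVal_canon_univ A (LWord.omegaOpPow a).label
    have hch : Chain univ fun n : ℕᵒᵈ => ({n} : Set (LWord.omegaOpPow a).dom) := chain_singletons
    have h := hv.respTauOp _ (A.inj a) hch fun n => hv.single n (mem_univ _)
    rw [← A.tauOpExt_inj, ← h]
    exact congrArg _ (iUnion_of_singleton ℕᵒᵈ)
  kappa P w hw hs := by
    apply A.inj_injective
    rw [A.inj_prod]
    have hv := isVal_canon_univ A w.label
    obtain ⟨e⟩ := hs.orderType
    have : EtaOrder w.dom :=
      { toCountable := inferInstance
        toDenselyOrdered := ⟨fun x y hxy => by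
          obtain ⟨z, h1, h2⟩ := exists_between (e.strictMono hxy)
          exact ⟨e.symm z, by rwa [e.lt_symm_apply], by rwa [e.symm_apply_lt]⟩⟩
        toNoMinOrder := ⟨fun x => by
          obtain ⟨z, h⟩ := exists_lt (e x)
          exact ⟨e.symm z, by rwa [e.symm_apply_lt]⟩⟩
        toNoMaxOrder := ⟨fun x => by
          obtain ⟨z, h⟩ := exists_gt (e x)
          exact ⟨e.symm z, by rwa [e.lt_symm_apply]⟩⟩
        nonempty := hw }
    have h := hv.respKappa w.dom (fun x => {x}) P chain_singletons
      ⟨fun q => ⟨_, hs.label_mem q, hv.single q (mem_univ _)⟩, fun a ha q r hqr => by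
        obtain ⟨z, h1, h2, h3⟩ := hs.dense a ha q r hqr
        exact ⟨z, h2, h3, by rw [← h1]; exact hv.single z (mem_univ _)⟩⟩
    rw [iUnion_of_singleton] at h
    exact h.symm

end Product

/-! ### Uniqueness of the product -/

section Uniqueness

/-- The restriction of a word to a set of positions. -/
def LWord.restrict (w : LWord S) (X : Set w.dom) : LWord S where
  dom := X
  label x := w.label x

theorem LWord.restrict_univ_iso (w : LWord S) : LWord.Iso (w.restrict univ) w :=
  ⟨OrderIso.Set.univ, fun _ => rfl⟩

theorem LWord.concat_restrict_iso (w : LWord S) {ι : Type} [LinearOrder ι] [Countable ι]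
    {X : ι → Set w.dom} {D : Set w.dom} (hX : Chain D X) :
    LWord.Iso (LWord.concat ι fun i => w.restrict (X i)) (w.restrict (⋃ i, X i)) := by
  let φ : (LWord.concat ι fun i => w.restrict (X i)).dom → (w.restrict (⋃ i, X i)).dom :=
    fun x => ⟨(ofLex x).2.1, mem_iUnion.2 ⟨_, (ofLex x).2.2⟩⟩
  have hmono : StrictMono φ := by
    intro x y hxy
    rcases Sigma.Lex.lt_def.1 hxy with h | ⟨h, h'⟩
    · exact hX.before _ _ h _ (ofLex x).2.2 _ (ofLex y).2.2
    · obtain ⟨i, x⟩ := x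
      obtain ⟨j, y⟩ := y
      obtain rfl : i = j := h
      exact h'
  have hsurj : Function.Surjective φ := by
    rintro ⟨x, hx⟩
    obtain ⟨i, hi⟩ := mem_iUnion.1 hx
    exact ⟨toLex ⟨i, ⟨x, hi⟩⟩, rfl⟩
  exact ⟨hmono.orderIsoOfSurjective φ hsurj, fun x => rfl⟩

variable {A : OplusAlgebra S} {π : NWord S → S}

open Classical in
/-- The values of the convex subwords of a word under a product. -/
noncomputable def productVal (A : OplusAlgebra S) (π : NWord S → S) (w : LWord S) (X : Set w.dom) :
    A.Ext :=
  if h : X.Nonempty then A.inj (π (NWord.mk (w.restrict X) h.to_subtype)) else 1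

theorem productVal_empty (w : LWord S) : productVal A π w ∅ = 1 := dif_neg Set.not_nonempty_empty

theorem productVal_of_nonempty (w : LWord S) {X : Set w.dom} (h : X.Nonempty) :
    productVal A π w X = A.inj (π (NWord.mk (w.restrict X) h.to_subtype)) := dif_pos h

theorem productVal_nonempty (w : LWord S) {X : Set w.dom} {a : S}
    (h : productVal A π w X = A.inj a) : X.Nonempty := by
  rw [nonempty_iff_ne_empty]
  rintro rfl
  rw [productVal_empty] at h
  exact A.inj_ne_one a h.symm

theorem productVal_iUnion (hπ : IsProduct π) (w : LWord S) {ι : Type} [LinearOrder ι] [Countable ι]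
    [hι : Nonempty ι] {X : ι → Set w.dom} {D : Set w.dom} (hX : Chain D X) {g : ι → S}
    (hg : ∀ i, productVal A π w (X i) = A.inj (g i)) :
    productVal A π w (⋃ i, X i) = A.inj (π (NWord.mk (LWord.ofFun ι g) hι)) := by
  have hn : ∀ i, (X i).Nonempty := fun i => productVal_nonempty w (hg i)
  have hU : (⋃ i, X i).Nonempty := by
    obtain ⟨i⟩ := hι
    exact (hn i).mono (subset_iUnion X i)
  have hg' : g = fun i => π (NWord.mk (w.restrict (X i)) (hn i).to_subtype) := by
    funext i
    have := hg i
    rw [productVal_of_nonempty w (hn i)] at this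
    exact (A.inj_injective this).symm
  subst hg'
  rw [productVal_of_nonempty w hU]
  refine congrArg A.inj (Eq.trans ?_
    (hπ.assoc ι (fun i => w.restrict (X i)) fun i => (hn i).to_subtype).symm)
  exact congrArg π (Quotient.sound ((LWord.iso_equivalence S).symm (w.concat_restrict_iso hX)))

/-- Associativity of `π` reduces each decomposition to the word of its values; that word is a pair,
an `ω`- or `ω*`-power or a shuffle, on which `π` is the corresponding operation. -/
theorem isVal_productVal (hπ : IsProduct π) (hA : A.InducedBy π) (w : LWord S) :
    IsVal A univ (productVal A π w) w.label where
  respNonempty X _ _ hn := by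
    rw [productVal_of_nonempty w hn]
    exact A.inj_ne_one _
  single x _ := by
    rw [productVal_of_nonempty w (singleton_nonempty x)]
    congr 1
    rw [← hπ.letter (w.label x)]
    congr 1
    refine Quotient.sound ⟨⟨⟨fun _ => (), fun _ => ⟨x, rfl⟩, fun y => ?_, fun y => rfl⟩, ?_⟩, ?_⟩
    · exact Subsingleton.elim (α := ({x} : Set w.dom)) _ _
    · intro a b
      exact iff_of_true le_rfl (le_of_eq (Subsingleton.elim (α := ({x} : Set w.dom)) _ _))
    · rintro ⟨y, rfl⟩
      rfl
  respMul := by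
    refine ⟨productVal_empty w, fun X Y hXY hc _ => ?_⟩
    rcases X.eq_empty_or_nonempty with rfl | hX
    · rw [productVal_empty, empty_union, one_mul]
    rcases Y.eq_empty_or_nonempty with rfl | hY
    · rw [productVal_empty, union_empty, mul_one]
    have hU : (⋃ i : Fin 2, ![X, Y] i) = X ∪ Y := by
      ext x
      simp [Fin.exists_fin_two]
    have hch : Chain univ ![X, Y] := by
      refine ⟨?_, by rwa [hU], subset_univ _⟩
      intro i j hij
      fin_cases i <;> fin_cases j <;> first | exact hXY | exact absurd hij (by decide)
    have := productVal_iUnion (A := A) hπ w hch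
      (g := ![π (NWord.mk (w.restrict X) hX.to_subtype), π (NWord.mk (w.restrict Y) hY.to_subtype)])
      (fun i => by
        fin_cases i
        · exact productVal_of_nonempty w hX
        · exact productVal_of_nonempty w hY)
    rw [hU] at this
    rw [this, productVal_of_nonempty w hX, productVal_of_nonempty w hY, ← A.inj_mul, hA.mul]
    rfl
  respTau X a hX ha := by
    rcases A.eq_one_or_inj a with rfl | ⟨a, rfl⟩
    · have : ∀ n, X n = ∅ := fun n => by
        by_contra h
        have := ha n
        rw [productVal_of_nonempty w (nonempty_iff_ne_empty.2 h)] at this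
        exact A.inj_ne_one _ this
      rw [iUnion_eq_empty.2 this, productVal_empty, A.tauExt_one]
    · rw [productVal_iUnion hπ w hX ha, A.tauExt_inj, hA.tau]
      rfl
  respTauOp X a hX ha := by
    rcases A.eq_one_or_inj a with rfl | ⟨a, rfl⟩
    · have : ∀ n, X n = ∅ := fun n => by
        by_contra h
        have := ha n
        rw [productVal_of_nonempty w (nonempty_iff_ne_empty.2 h)] at this
        exact A.inj_ne_one _ this
      rw [iUnion_eq_empty.2 this, productVal_empty, A.tauOpExt_one]
    · have : Countable ℕᵒᵈ := inferInstanceAs (Countable ℕ)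
      have : Nonempty ℕᵒᵈ := ⟨OrderDual.toDual 0⟩
      rw [productVal_iUnion hπ w hX ha, A.tauOpExt_inj, hA.tauOp]
      rfl
  respKappa Q _ _ X P hX hP := by
    choose g hgP hg using hP.mem
    have hQ : Nonempty Q := EtaOrder.nonempty
    refine (productVal_iUnion hπ w hX hg).trans
      (congrArg A.inj (hA.kappa P (LWord.ofFun Q g) hQ ⟨?_, hgP, ?_⟩).symm)
    -- Cantor's theorem on countable dense orders without endpoints.
    · exact Order.iso_of_countable_dense Q ℚ
    · intro a ha x y hxy
      obtain ⟨t, h1, h2, h3⟩ := hP.dense a ha x y hxy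
      exact ⟨t, A.inj_injective ((hg t).symm.trans h3), h1, h2⟩

theorem eq_prod [Finite S] (hπ : IsProduct π) (hA : A.InducedBy π) : π = A.prod := by
  funext w
  induction w using Quotient.inductionOn with
  | h w =>
    obtain ⟨w, hw⟩ := w
    apply A.inj_injective
    refine Eq.trans ?_ (A.inj_prod w hw).symm
    have h := (isVal_productVal hπ hA w).eq_canon ordConnected_univ
    rw [productVal_of_nonempty w univ_nonempty] at h
    rw [← h]
    congr 2
    exact Quotient.sound ((LWord.iso_equivalence S).symm w.restrict_univ_iso)

end Uniqueness

/-! ### Identifying the adjoined identity with that of a `⊛`-algebra -/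

section Collapse

variable {M : Type u} (A : OstarAlgebra M)

namespace OstarAlgebra

/-- The retraction of the extension of a `⊛`-algebra by an identity onto the algebra. -/
def collapse (x : A.toOplusAlgebra.Ext) : M := Option.elim x A.one id

theorem collapse_one : A.collapse 1 = A.one := rfl

theorem collapse_inj (a : M) : A.collapse (A.inj a) = a := rfl

theorem collapse_mul (x y : A.toOplusAlgebra.Ext) :
    A.collapse (x * y) = A.mul (A.collapse x) (A.collapse y) := by
  rcases A.eq_one_or_inj x with rfl | ⟨a, rfl⟩
  · rw [_root_.one_mul, collapse_one, A.one_mul]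
  rcases A.eq_one_or_inj y with rfl | ⟨b, rfl⟩
  · rw [_root_.mul_one, collapse_one, A.mul_one]
  · rfl

theorem collapse_tauExt (x : A.toOplusAlgebra.Ext) :
    A.collapse (A.tauExt x) = A.tau (A.collapse x) := by
  rcases A.eq_one_or_inj x with rfl | ⟨a, rfl⟩
  · rw [A.tauExt_one, collapse_one, A.tau_one]
  · rfl

theorem collapse_tauOpExt (x : A.toOplusAlgebra.Ext) :
    A.collapse (A.tauOpExt x) = A.tauOp (A.collapse x) := by
  rcases A.eq_one_or_inj x with rfl | ⟨a, rfl⟩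
  · rw [A.tauOpExt_one, collapse_one, A.tauOp_one]
  · rfl

end OstarAlgebra

/-- Members of a homogeneous chain may be empty: they only contribute the identity to the
shuffled set. -/
theorem IsVal.collapse_iUnion {A : OstarAlgebra M} {W : Type*} [LinearOrder W] {f : W → M}
    {F : Set W → A.toOplusAlgebra.Ext} (hF : IsVal A.toOplusAlgebra univ F f) {Q : Type}
    [LinearOrder Q] [EtaOrder Q] {X : Q → Set W} (hX : Chain univ X)
    (hcol : ∀ p q r, p < q → ∃ t, p < t ∧ t < q ∧ F (X t) = F (X r)) :
    A.collapse (F (⋃ q, X q)) =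
      A.kappa ⟨range (fun q => A.collapse (F (X q))) ∪ {A.one}, (singleton_nonempty _).inr⟩ := by
  have hne : ∀ q, F (X q) ≠ 1 ↔ (X q).Nonempty := by
    intro q
    refine ⟨fun h => ?_, hF.respNonempty _ (subset_univ _) (hX.ordConnected_apply q)⟩
    by_contra h0
    rw [not_nonempty_iff_eq_empty] at h0
    exact h (by rw [h0, hF.respMul.empty])
  by_cases hI : ∃ r, (X r).Nonempty
  · obtain ⟨r, hr⟩ := hI
    -- A nonempty member has value different from `1`, which recurs in every interval, so the
    -- nonempty members alone are indexed by a dense order without endpoints.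
    let I : Set Q := {q | (X q).Nonempty}
    have hcol' : ∀ p q : Q, ∀ s ∈ I, p < q → ∃ t ∈ I, p < t ∧ t < q ∧ F (X t) = F (X s) := by
      intro p q s hs hpq
      obtain ⟨t, h1, h2, h3⟩ := hcol p q s hpq
      exact ⟨t, (hne t).1 (h3 ▸ (hne s).2 hs), h1, h2, h3⟩
    have hη : EtaOrder I :=
      { toCountable := inferInstance
        toDenselyOrdered := ⟨fun p q hpq => by
          obtain ⟨t, ht, h1, h2, -⟩ := hcol' p q r hr hpq
          exact ⟨⟨t, ht⟩, h1, h2⟩⟩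
        toNoMinOrder := ⟨fun p => by
          obtain ⟨q, hq⟩ := exists_lt (p : Q)
          obtain ⟨t, ht, -, h2, -⟩ := hcol' q p r hr hq
          exact ⟨⟨t, ht⟩, h2⟩⟩
        toNoMaxOrder := ⟨fun p => by
          obtain ⟨q, hq⟩ := exists_gt (p : Q)
          obtain ⟨t, ht, h1, -, -⟩ := hcol' p q r hr hq
          exact ⟨⟨t, ht⟩, h1⟩⟩
        nonempty := ⟨⟨r, hr⟩⟩ }
    have hU : (⋃ i : I, X i) = ⋃ q, X q := by
      ext x
      simp only [mem_iUnion]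
      exact ⟨fun ⟨i, hi⟩ => ⟨i, hi⟩, fun ⟨q, hq⟩ => ⟨⟨q, ⟨x, hq⟩⟩, hq⟩⟩
    have hch : Chain univ fun i : I => X i :=
      ⟨fun i j hij => hX.before i j hij, by rw [hU]; exact hX.ordConnected, subset_univ _⟩
    choose g hg using fun i : I => A.exists_inj_of_ne_one ((hne i).2 i.2)
    have hk := hF.respKappa I (fun i => X i) ⟨range g, ⟨_, mem_range_self ⟨r, hr⟩⟩⟩ hch
      ⟨fun i => ⟨g i, mem_range_self i, hg i⟩, by
        rintro _ ⟨s, rfl⟩ p q hpq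
        obtain ⟨t, ht, h1, h2, h3⟩ := hcol' p q s s.2 hpq
        exact ⟨⟨t, ht⟩, h1, h2, h3.trans (hg s)⟩⟩
    rw [← hU, hk, OplusAlgebra.kap, A.collapse_inj, A.kappa_union_one]
    congr 2
    ext a
    simp only [mem_union, mem_range, mem_singleton_iff]
    refine or_congr_left' fun ha => ⟨?_, ?_⟩
    · rintro ⟨i, rfl⟩
      exact ⟨i, by rw [hg, A.collapse_inj]⟩
    · rintro ⟨q, rfl⟩
      by_cases hq : q ∈ I
      · exact ⟨⟨q, hq⟩, by rw [hg ⟨q, hq⟩, A.collapse_inj]⟩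
      · refine absurd ?_ ha
        rw [not_not.1 (fun h => hq ((hne q).1 h)), A.collapse_one]
  · have hall : ∀ q, X q = ∅ := fun q => not_nonempty_iff_eq_empty.1 fun h => hI ⟨q, h⟩
    rw [iUnion_eq_empty.2 hall, hF.respMul.empty, A.collapse_one]
    refine A.kappa_one.symm.trans (congrArg A.kappa (Subtype.ext ?_))
    simp [hall, hF.respMul.empty, A.collapse_one, range_const]

end Collapse

/-! ### Comparing two valuations along limits -/

section Rel

variable {W : Type*} [LinearOrder W] {A : OplusAlgebra S} {F G : Set W → A.Ext}

theorem RespMul.iUnion_nat_eq_mul_tauExt (h : RespMul A univ F) (ht : RespTau A univ F)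
    {X : ℕ → Set W} (hX : Chain univ X) {a : A.Ext} (ha : ∀ n, F (X (n + 1)) = a) :
    F (⋃ n, X n) = F (X 0) * A.tauExt a := by
  have e : Iio 1 = ({0} : Set ℕ) := by ext; simp
  rw [h.iUnion_nat hX 1, e, part_singleton, ← iUnion_shift]
  rw [ht _ a (hX.shift 1) fun n => by rw [add_comm]; exact ha n]

/-- Two maps compatible with `ω`-powers whose values on bounded sets are related have related
values. -/
theorem rel_of_omega [Finite S] [Countable W] {R : A.Ext → A.Ext → Prop}
    (hmul : ∀ x x' y y', R x x' → R y y' → R (x * y) (x' * y'))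
    (htau : ∀ x x', R x x' → R (A.tauExt x) (A.tauExt x'))
    (hF : RespMul A univ F) (hFt : RespTau A univ F) (hG : RespMul A univ G)
    (hGt : RespTau A univ G) {D : Set W} (hn : D.Nonempty)
    (h : ∀ y ∈ D, ∀ X ⊆ D ∩ Iic y, X.OrdConnected → R (F X) (G X)) :
    ∀ X ⊆ D, X.OrdConnected → R (F X) (G X) := by
  intro X hXD hc
  rcases X.eq_empty_or_nonempty with rfl | hXn
  · obtain ⟨y, hy⟩ := hn
    exact h y hy ∅ (empty_subset _) hc
  by_cases hmax : ∀ x ∈ X, ∃ y ∈ X, x < y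
  -- Colouring by the pair of values gives one decomposition that suits both maps.
  · obtain ⟨Z, c, hZ, hU, hZn, hcol⟩ := exists_monochromatic_chain (fun Z => (F Z, G Z)) hc hXn hmax
    have hZ' : Chain univ Z := hZ.mono (subset_univ _)
    have hb : ∀ n, R (F (Z n)) (G (Z n)) := by
      intro n
      obtain ⟨y, hy⟩ := hZn (n + 1)
      have hsub : ∀ m, Z m ⊆ X := fun m => hZ.apply_subset m
      refine h y (hXD (hsub _ hy)) _ (fun x hx => ⟨hXD (hsub _ hx), ?_⟩) (hZ.ordConnected_apply n)
      exact (hZ.before n (n + 1) (Nat.lt_succ_self n) x hx y hy).le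
    rw [← hU, hF.iUnion_nat_eq_mul_tauExt hFt hZ' fun n => congrArg Prod.fst (hcol n),
      hG.iUnion_nat_eq_mul_tauExt hGt hZ' fun n => congrArg Prod.snd (hcol n)]
    refine hmul _ _ _ _ (hb 0) (htau _ _ ?_)
    rw [← hcol 0]
    exact hb 1
  · push Not at hmax
    obtain ⟨m, hm, hle⟩ := hmax
    exact h m (hXD hm) X (fun x hx => ⟨hXD hx, hle x hx⟩) hc

theorem rel_of_omegaOp [Finite S] [Countable W] {R : A.Ext → A.Ext → Prop}
    (hmul : ∀ x x' y y', R x x' → R y y' → R (x * y) (x' * y'))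
    (htau : ∀ x x', R x x' → R (A.tauOpExt x) (A.tauOpExt x'))
    (hF : RespMul A univ F) (hFt : RespTauOp A univ F) (hG : RespMul A univ G)
    (hGt : RespTauOp A univ G) {D : Set W} (hn : D.Nonempty)
    (h : ∀ y ∈ D, ∀ X ⊆ D ∩ Ici y, X.OrdConnected → R (F X) (G X)) :
    ∀ X ⊆ D, X.OrdConnected → R (F X) (G X) := by
  have : Countable Wᵒᵈ := inferInstanceAs (Countable W)
  intro X hX hc
  refine rel_of_omega (W := Wᵒᵈ) (A := A.op) (R := R) ?_ htau hF.dual hFt.dual hG.dual hGt.dual hn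
    (fun y hy X hX hc => h y hy X hX hc.dual) X hX hc.dual
  intro x x' y y' hx hy
  exact (congrArg₂ R (A.op_mul x y) (A.op_mul x' y')).mpr (hmul _ _ _ _ hy hx)

end Rel

/-! ### Deleting neutral letters -/

section Deletion

variable {M : Type u} {A : OstarAlgebra M}

theorem Chain.preimage {W V ι : Type*} [LinearOrder W] [LinearOrder V] [LinearOrder ι]
    {X : ι → Set W} {D : Set W} (hX : Chain D X) {e : V → W} (he : StrictMono e) :
    Chain univ fun i => e ⁻¹' X i where
  before i j hij x hx y hy := he.lt_iff_lt.1 (hX.before i j hij _ hx _ hy)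
  ordConnected := by
    rw [← preimage_iUnion]
    exact hX.ordConnected.preimage_mono he.monotone
  subset := subset_univ _

/-- Values of words that agree up to positions with neutral values agree up to neutral values. -/
theorem collapse_eq_preimage [Finite M] {W V : Type} [LinearOrder W] [Countable W] [Nonempty W]
    [LinearOrder V] {e : V → W} (he : StrictMono e)
    {f : W → M} {g : V → M} {F : Set W → A.toOplusAlgebra.Ext} {G : Set V → A.toOplusAlgebra.Ext}
    (hF : IsVal A.toOplusAlgebra univ F f) (hG : IsVal A.toOplusAlgebra univ G g)
    (hfg : ∀ v, f (e v) = g v) (hf : ∀ w ∉ range e, f w = A.one) :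
    A.collapse (F univ) = A.collapse (G univ) := by
  have hGm : RespMul A.toOplusAlgebra univ fun X => G (e ⁻¹' X) :=
    ⟨hG.respMul.empty, fun X Y hXY hc _ => hG.respMul.mul _ _
      (fun x hx y hy => he.lt_iff_lt.1 (hXY _ hx _ hy)) (hc.preimage_mono he.monotone)
      (subset_univ _)⟩
  have hGt : RespTau A.toOplusAlgebra univ fun X => G (e ⁻¹' X) := fun X a hX ha => by
    dsimp only
    rw [preimage_iUnion]
    exact hG.respTau _ a (hX.preimage he) ha
  have hGo : RespTauOp A.toOplusAlgebra univ fun X => G (e ⁻¹' X) := fun X a hX ha => by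
    dsimp only
    rw [preimage_iUnion]
    exact hG.respTauOp _ a (hX.preimage he) ha
  have hmul : ∀ x x' y y' : A.toOplusAlgebra.Ext, A.collapse x = A.collapse x' →
      A.collapse y = A.collapse y' → A.collapse (x * y) = A.collapse (x' * y') := by
    intro x x' y y' hx hy
    rw [A.collapse_mul, A.collapse_mul, hx, hy]
  -- The colour records both values, so a homogeneous shuffle is homogeneous for `F` and for `G` at
  -- once.
  have key := CondensationClosed.prop_univ (W := W) (col := fun X => (F X, G (e ⁻¹' X)))
    (Φ := fun D => ∀ X ⊆ D, X.OrdConnected → A.collapse (F X) = A.collapse (G (e ⁻¹' X)))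
    ⟨fun D D' h _ hD X hX => hD X (hX.trans h), ?_, ?_, ?_, ?_, ?_⟩
  · exact key univ Subset.rfl ordConnected_univ
  · intro w X hX _
    rcases subset_singleton_iff_eq.1 hX with rfl | rfl
    · rw [preimage_empty, hF.respMul.empty, hG.respMul.empty]
    · rw [hF.single w (mem_univ w)]
      by_cases hw : w ∈ range e
      · obtain ⟨v, rfl⟩ := hw
        have : e ⁻¹' {e v} = {v} := by ext x; simp [he.injective.eq_iff]
        rw [this, hG.single v (mem_univ v), hfg]
      · have : e ⁻¹' {w} = ∅ := by
          ext x
          simp only [mem_preimage, mem_singleton_iff, mem_empty_iff_false, iff_false]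
          exact fun h => hw ⟨x, h⟩
        rw [this, hG.respMul.empty, hf w hw, A.collapse_inj, A.collapse_one]
  · intro X Y hXY hc h1 h2 Z hZ hZc
    have e1 : Z = (Z ∩ X) ∪ (Z ∩ Y) := by rw [← inter_union_distrib_left, inter_eq_left.2 hZ]
    have hb : Before (Z ∩ X) (Z ∩ Y) := fun x hx y hy => hXY x hx.2 y hy.2
    have c1 : (Z ∩ X).OrdConnected := by
      refine ⟨fun a ha b hb' x hx => ?_⟩
      have hxZ := hZc.out ha.1 hb'.1 hx
      refine ⟨hxZ, (hZ hxZ).resolve_right fun hxY => ?_⟩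
      exact absurd hx.2 (not_le.2 (hXY b hb'.2 x hxY))
    have c2 : (Z ∩ Y).OrdConnected := by
      refine ⟨fun a ha b hb' x hx => ?_⟩
      have hxZ := hZc.out ha.1 hb'.1 hx
      refine ⟨hxZ, (hZ hxZ).resolve_left fun hxX => ?_⟩
      exact absurd hx.1 (not_le.2 (hXY x hxX a ha.2))
    have hZc' : (Z ∩ X ∪ Z ∩ Y).OrdConnected := by rwa [← e1]
    rw [e1, hF.respMul.mul _ _ hb hZc' (subset_univ _)]
    refine Eq.trans ?_ (congrArg A.collapse (hGm.mul _ _ hb hZc' (subset_univ _)).symm)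
    exact hmul _ _ _ _ (h1 _ inter_subset_right c1) (h2 _ inter_subset_right c2)
  · intro D _ hn _ h
    exact rel_of_omega (R := fun x y => A.collapse x = A.collapse y) hmul
      (fun x y h => by rw [A.collapse_tauExt, A.collapse_tauExt, h]) hF.respMul hF.respTau hGm hGt hn h
  · intro D _ hn _ h
    exact rel_of_omegaOp (R := fun x y => A.collapse x = A.collapse y) hmul
      (fun x y h => by rw [A.collapse_tauOpExt, A.collapse_tauOpExt, h]) hF.respMul hF.respTauOp
      hGm hGo hn h
  · intro Q _ _ K hK _ hΦ hcol _ X hX hc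
    by_cases hs : ∃ q, X ⊆ K q
    · obtain ⟨q, hq⟩ := hs
      exact hΦ q X hq hc
    obtain ⟨i, hi, j, hj, hij⟩ := exists_touch_lt hX hs
    rw [hK.apply_eq_mul hX hc hi hj hij (hF.respMul.mono (subset_univ _))]
    refine Eq.trans ?_ (congrArg A.collapse
      (hK.apply_eq_mul hX hc hi hj hij (hGm.mono (subset_univ _))).symm)
    have h0 : A.collapse (F ∅) = A.collapse (G (e ⁻¹' ∅)) := by
      rw [preimage_empty, hF.respMul.empty, hG.respMul.empty]
    refine hmul _ _ _ _ (hmul _ _ _ _ ?_ ?_) ?_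
    · by_cases hl : ∃ i, IsLeast (touch K X) i
      · obtain ⟨l, hl⟩ := hl
        rw [firstBlock_of_isLeast hl]
        exact hΦ l _ inter_subset_right (hc.inter (hK.ordConnected_apply l))
      · rw [firstBlock_of_not hl]
        exact h0
    · have hopen := isOpenInterval_midTouch hi hj hij
      have := hopen.etaOrder
      have hch := hK.restrict hopen.ordConnected
      have hcol' : ∀ p q r : midTouch K X, p < q → ∃ t : midTouch K X, p < t ∧ t < q ∧
          (F (K t), G (e ⁻¹' K t)) = (F (K r), G (e ⁻¹' K r)) := by
        intro p q r hpq
        obtain ⟨t, h1, h2, h3⟩ := hcol p q r hpq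
        exact ⟨⟨t, hopen.ordConnected.out p.2 q.2 ⟨h1.le, h2.le⟩⟩, h1, h2, h3⟩
      -- Preimages of nonempty classes may be empty, but both sides become `κ` of the collapsed
      -- values together with `1`, and the collapsed values agree class by class.
      rw [part_eq_iUnion, preimage_iUnion,
        hF.collapse_iUnion hch fun p q r hpq => (hcol' p q r hpq).imp fun t ht =>
          ⟨ht.1, ht.2.1, congrArg Prod.fst ht.2.2⟩,
        hG.collapse_iUnion (hch.preimage he) fun p q r hpq => (hcol' p q r hpq).imp fun t ht =>
          ⟨ht.1, ht.2.1, congrArg Prod.snd ht.2.2⟩]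
      congr 3
      refine congrArg range (funext fun q => ?_)
      exact hΦ q _ Subset.rfl (hK.ordConnected_apply q)
    · by_cases hl : ∃ i, IsGreatest (touch K X) i
      · obtain ⟨l, hl⟩ := hl
        rw [lastBlock_of_isGreatest hl]
        exact hΦ l _ inter_subset_right (hc.inter (hK.ordConnected_apply l))
      · rw [lastBlock_of_not hl]
        exact h0

end Deletion

/-! ### The product of a `⊛`-algebra -/

section StarProduct

theorem isVal_canon_of_isEmpty (A : OplusAlgebra S) {W : Type} [LinearOrder W] [IsEmpty W]
    (f : W → S) : IsVal A univ (canon A f) f := by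
  have hone : IsVal A univ (fun _ => 1) f :=
    { respNonempty := fun X _ _ hn => (isEmptyElim hn.some)
      single := fun x => isEmptyElim x
      respMul := ⟨rfl, fun _ _ _ _ _ => (mul_one 1).symm⟩
      respTau := fun X a _ ha => by rw [← ha 0, A.tauExt_one]
      respTauOp := fun X a _ ha => by rw [← ha 0, A.tauOpExt_one]
      respKappa := fun Q _ _ X P _ hP => by
        obtain ⟨q⟩ : Nonempty Q := EtaOrder.nonempty
        obtain ⟨a, -, ha⟩ := hP.mem q
        exact absurd ha.symm (A.inj_ne_one a) }
  refine hone.congr fun X _ _ => ?_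
  have h : ∃ G, IsVal A X G f := ⟨_, hone.mono (subset_univ X)⟩
  have hc : canon A f X = h.choose X := dif_pos h
  rw [hc]
  exact h.choose_spec.respMul.empty.symm.trans (congrArg h.choose (eq_empty_of_isEmpty X).symm)

theorem isVal_canon [Finite S] (A : OplusAlgebra S) {W : Type} [LinearOrder W] [Countable W]
    (f : W → S) : IsVal A univ (canon A f) f := by
  cases isEmpty_or_nonempty W
  · exact isVal_canon_of_isEmpty A f
  · exact isVal_canon_univ A f

variable {M : Type u} [Finite M] (A : OstarAlgebra M)

/-- The product of a word over a finite `⊛`-algebra. -/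
noncomputable def OstarAlgebra.eval (w : LWord M) : M :=
  A.collapse (canon A.toOplusAlgebra w.label univ)

theorem OstarAlgebra.eval_of_isEmpty (w : LWord M) [IsEmpty w.dom] : A.eval w = A.one := by
  have h := (isVal_canon A.toOplusAlgebra w.label).respMul.empty
  rw [eval, eq_empty_of_isEmpty univ, h, A.collapse_one]

theorem OstarAlgebra.eval_eq_prod (w : LWord M) (hw : Nonempty w.dom) :
    A.eval w = A.toOplusAlgebra.prod (NWord.mk w hw) := by
  rw [eval, ← A.toOplusAlgebra.inj_prod w hw, A.collapse_inj]

/-- Letters equal to the identity can be deleted. -/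
theorem OstarAlgebra.eval_eq_of_strictMono (v w : LWord M) {e : v.dom → w.dom} (he : StrictMono e)
    (hlabel : ∀ x, w.label (e x) = v.label x) (hone : ∀ y ∉ range e, w.label y = A.one) :
    A.eval w = A.eval v := by
  cases isEmpty_or_nonempty w.dom
  · have : IsEmpty v.dom := Function.isEmpty e
    rw [A.eval_of_isEmpty, A.eval_of_isEmpty]
  · exact collapse_eq_preimage he (isVal_canon _ _) (isVal_canon _ _) hlabel hone

theorem OstarAlgebra.eval_eq_of_iso (v w : LWord M) (h : LWord.Iso v w) : A.eval v = A.eval w := by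
  obtain ⟨e, he⟩ := h
  exact (A.eval_eq_of_strictMono v w e.strictMono he fun y hy => absurd (e.surjective y) hy).symm

/-- The product induced by a finite `⊛`-algebra. -/
noncomputable def OstarAlgebra.prod : CWord M → M := Quotient.lift A.eval A.eval_eq_of_iso

theorem OstarAlgebra.prod_mk (w : LWord M) : A.prod (CWord.mk w) = A.eval w := rfl

theorem OstarAlgebra.prod_toCWord (w : NWord M) : A.prod w.toCWord = A.toOplusAlgebra.prod w := by
  induction w using Quotient.inductionOn with
  | h w => exact A.eval_eq_prod w.1 w.2

/-- Empty factors can be removed from a concatenation. -/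
theorem LWord.concat_subtype_iso {α : Type} [LinearOrder α] [Countable α] (u : α → LWord S) :
    LWord.Iso (LWord.concat {i // Nonempty (u i).dom} fun i => u i) (LWord.concat α u) := by
  let φ : (LWord.concat {i // Nonempty (u i).dom} fun i => u i).dom → (LWord.concat α u).dom :=
    fun x => toLex ⟨(ofLex x).1, (ofLex x).2⟩
  have hmono : StrictMono φ := by
    intro x y hxy
    rcases Sigma.Lex.lt_def.1 hxy with h | ⟨h, h'⟩
    · exact Sigma.Lex.left _ _ h
    · obtain ⟨i, x⟩ := x
      obtain ⟨j, y⟩ := y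
      obtain rfl : i = j := h
      exact Sigma.Lex.right _ _ h'
  have hsurj : Function.Surjective φ := fun x => ⟨toLex ⟨⟨(ofLex x).1, ⟨(ofLex x).2⟩⟩, (ofLex x).2⟩, rfl⟩
  exact ⟨hmono.orderIsoOfSurjective φ hsurj, fun x => rfl⟩

/-- Empty factors contribute nothing to the concatenation and letters `1` to the word of values.
Both can be removed, leaving the associativity of the `⊕`-product, or two empty words. -/
theorem OstarAlgebra.isStarProduct_prod : IsStarProduct A.prod where
  letter a := (A.prod_toCWord (NWord.mk (LWord.letter a) ⟨()⟩)).trans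
    (A.toOplusAlgebra.isProduct_prod.letter a)
  assoc α _ _ u := by
    simp only [prod_mk]
    rw [← A.eval_eq_of_iso _ _ (LWord.concat_subtype_iso u)]
    refine (A.eval_eq_of_strictMono
      (LWord.ofFun {i // Nonempty (u i).dom} fun i => A.eval (u i)) _
      (e := fun i : {i // Nonempty (u i).dom} => (i : α)) (fun i j h => h) (fun _ => rfl) ?_).trans ?_
    · intro i hi
      have : IsEmpty (u i).dom := not_nonempty_iff.1 fun h => hi ⟨⟨i, h⟩, rfl⟩
      exact A.eval_of_isEmpty (u i)
    · cases isEmpty_or_nonempty {i // Nonempty (u i).dom} with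
      | inl h =>
        have h1 : IsEmpty (LWord.ofFun {i // Nonempty (u i).dom} fun i => A.eval (u i)).dom := h
        have h2 : IsEmpty (LWord.concat {i // Nonempty (u i).dom} fun i => u i).dom :=
          ⟨fun x => h.false (ofLex x).1⟩
        rw [A.eval_of_isEmpty, A.eval_of_isEmpty]
      | inr h =>
        have hassoc := A.toOplusAlgebra.isProduct_prod.assoc {i // Nonempty (u i).dom}
          (fun i => u i) fun i => i.2
        rw [A.eval_eq_prod _ (LWord.concat_nonempty _ _ fun i => i.2), ← hassoc,
          A.eval_eq_prod _ h]
        refine congrArg (fun f => A.toOplusAlgebra.prod (NWord.mk (LWord.ofFun _ f) h)) ?_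
        exact funext fun i => A.eval_eq_prod (u i) i.2

theorem OstarAlgebra.inducedBy_prod : A.InducedBy A.prod where
  one := by
    have : IsEmpty (LWord.empty M).dom := inferInstanceAs (IsEmpty Empty)
    exact (A.eval_of_isEmpty (LWord.empty M)).symm
  ops := by
    have : (fun w : NWord M => A.prod w.toCWord) = A.toOplusAlgebra.prod := funext A.prod_toCWord
    rw [this]
    exact A.toOplusAlgebra.inducedBy_prod

/-- On nonempty words `π` is a product inducing the `⊕`-operations, hence determined by (i); on the
empty word it is fixed by `1 = π(ε)`. -/
theorem eq_starProd {A : OstarAlgebra M} {π : CWord M → M} (hπ : IsStarProduct π)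
    (hA : A.InducedBy π) : π = A.prod := by
  have hprod : IsProduct fun w : NWord M => π w.toCWord :=
    ⟨hπ.letter, fun α _ _ _ u _ => hπ.assoc α u⟩
  have heq := eq_prod hprod hA.ops
  funext w
  induction w using Quotient.inductionOn with
  | h w =>
    cases isEmpty_or_nonempty w.dom with
    | inl h =>
      have hw : CWord.mk w = CWord.mk (LWord.empty M) := by
        have : IsEmpty (LWord.empty M).dom := inferInstanceAs (IsEmpty Empty)
        exact Quotient.sound ⟨OrderIso.ofIsEmpty _ _, fun x => isEmptyElim x⟩
      exact (congrArg π hw).trans (hA.one.symm.trans (A.eval_of_isEmpty w).symm)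
    | inr h => exact (congrFun heq (NWord.mk w h)).trans (A.eval_eq_prod w h).symm

end StarProduct

theorem mainTheorem1 :
    (∀ (S : Type u) [Finite S] (A : OplusAlgebra S),
      ∃! π : NWord S → S, IsProduct π ∧ A.InducedBy π) ∧
    (∀ (M : Type u) [Finite M] (A : OstarAlgebra M),
      ∃! π : CWord M → M, IsStarProduct π ∧ A.InducedBy π) := by
  refine ⟨fun S _ A => ?_, fun M _ A => ?_⟩
  · exact ⟨A.prod, ⟨A.isProduct_prod, A.inducedBy_prod⟩, fun π h => eq_prod h.1 h.2⟩
  · exact ⟨A.prod, ⟨A.isStarProduct_prod, A.inducedBy_prod⟩, fun π h => eq_starProd h.1 h.2⟩
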